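/- Let $p\in[2,3)$. There is a constant $K>0$, depending only on $p$, such that the following holds. Let $T>0$, $\mathbb T=\mathbb R/\mathbb Z$, and let $\mathbf G=(G,\mathbb G)\in\mathcal{RD}^p_a(H^2)$ be a three-dimensional geometric anti-symmetric rough driver on $[0,T]$. This means: $G\in\mathcal V_2^p(0,T;H^2(\mathbb T;\mathcal L_a(\mathbb R^3)))$ and $\mathbb G\in\mathcal V_2^{p/2}(0,T;H^2(\mathbb T;\mathcal L(\mathbb R^3)))$, where $\mathcal L_a(\mathbb R^3)$ denotes the anti-symmetric linear maps; $G_{s,t}=G_{s,r}+G_{r,t}$ and $\mathbb G_{s,t}-\mathbb G_{s,r}-\mathbb G_{r,t}=G_{r,t}G_{s,r}$ for $s\le r\le t$; and $\mathbf G$ is the limit, in the $(p,\frac p2)$-variation topology of $L^2(\mathbb T;\mathcal L(\mathbb R^3))$, of rough drivers of the form $\big(\Gamma^n_t-\Gamma^n_s,\ \int_s^t d\Gamma^n_r\,(\Gamma^n_r-\Gamma^n_s)\big)$ with smooth paths $\Gamma^n:[0,T]\to L^2(\mathbb T;\mathcal L_a(\mathbb R^3))$. Put $$\omega_{\mathbf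 G}(s,t)=\|G\|^p_{\mathcal V_2^p(s,t;H^2)}+\|\mathbb G\|^{p/2}_{\mathcal V_2^{p/2}(s,t;H^2)}+\|G\|^{2p}_{\mathcal V_2^p(s,t;H^2)} .$$ Let $u^0\in H^1(\mathbb T;\mathbb S^2)$ and let $u:[0,T]\to L^2(\mathbb T;\mathbb R^3)$ belong to $L^\infty(0,T;H^1)\cap L^2(0,T;H^2)$, with $|u_t(x)|=1$ for a.e. $(t,x)$, and solve the rough Landau--Lifshitz--Gilbert equation $$u_t-u_s=\int_s^t\big(u_r\times\partial_x^2u_r-u_r\times(u_r\times\partial_x^2u_r)\big)\,dr+G_{s,t}u_s+\mathbb G_{s,t}u_s+u^\natural_{s,t}\quad\text{in }L^2(\mathbb T;\mathbb R^3),\qquad 0\le s\le t\le T,$$ where the drift belongs to $L^2(0,T;L^2)$, $u_t\rightharpoonup u^0$ weakly in $L^2$ as $t\downarrow0$, and, for some $0<q<1$ and some finite covering of $[0,T]$ by compact intervals, $u^\natural$ has finite $q$-variation in $L^2$ on each of these intervals. Let $\mathcal T_u=\partial_x^2u+u|\partial_xu|^2$. Then $u_t\in H^1$ for every $t\in[0,T]$,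 and $$\sup_{t\in[0,T]}\|\partial_xu_t\|_{L^2}^2+\int_0^T\|\mathcal T_{u_t}\|_{L^2}^2\,dt\ \le\ K e^{K(T+\omega_{\mathbf G}(0,T))}\,\|u^0\|_{H^1}^2 ,$$ $$\int_0^T\|\partial_x^2u_t\|_{L^2}^2\,dt\ \le\ K e^{K(T+\omega_{\mathbf G}(0,T))}\big(T\|u^0\|_{H^1}^6+\|u^0\|_{H^1}^2\big) .$$ Moreover $u\in\mathcal V^p([0,T];L^2)$, and for all $0\le s\le t\le T$ $$\|\delta u\|_{\mathcal V_2^p(s,t;L^2)}\ \le\ K\Big(\omega_{\mathbf G}(s,t)^{1/p}+\int_s^t\|\mathcal T_{u_r}\|_{L^2}\,dr\Big).$$ Here $\mathcal V_2^p(a,b;E)$ is the space of continuous maps $G:\{a\le s\le t\le b\}\to E$ with $G_{t,t}=0$ and $\|G_{s,t}\|_E\le w(s,t)^{1/p}$ for some control $w$ (a continuous, superadditive, nonnegative function vanishing on the diagonal); $\|G\|^p_{\mathcal V_2^p(a,b;E)}=\sup\sum_i\|G_{t_i,t_{i+1}}\|_E^p$ over the partitions of $[a,b]$; $\delta u_{s,t}=u_t-u_s$;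 and $u\in\mathcal V^p([a,b];E)$ means that $u$ is continuous and $\delta u\in\mathcal V^p_2(a,b;E)$. -/

import Mathlib

open MeasureTheory Set Filter Topology
open scoped ENNReal ContDiff

noncomputable section

/-! ### Function spaces on the unit torus -/

/-- The Euclidean space of dimension three. -/
abbrev R3 := EuclideanSpace ℝ (Fin 3)

/-- Linear maps of the Euclidean space of dimension three, with the operator norm. -/
abbrev LR3 := R3 →L[ℝ] R3

/-- The Lebesgue space of square integrable `E`-valued functions on `ℝ / ℤ`. -/
abbrev L2T (E : Type*) [NormedAddCommGroup E] := Lp E 2 (volume : Measure UnitAddCircle)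

/-- Derivative of a function on the torus `ℝ / ℤ`. -/
def circleDeriv (φ : UnitAddCircle → ℝ) (x : UnitAddCircle) : ℝ :=
  deriv (fun h : ℝ => φ (x + (h : UnitAddCircle))) 0

/-- Smooth real functions on the torus. -/
def IsSmoothOnCircle (φ : UnitAddCircle → ℝ) : Prop :=
  ContDiff ℝ ∞ (fun t : ℝ => φ (t : UnitAddCircle))

/-- `g` is the weak derivative of `f` on the torus. -/
def HasWeakDeriv {E : Type*} [NormedAddCommGroup E] [NormedSpace ℝ E] (f g : L2T E) : Prop :=
  ∀ φ : UnitAddCircle → ℝ, IsSmoothOnCircle φ →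
    ∫ x, circleDeriv φ x • f x = -∫ x, φ x • g x

theorem IsSmoothOnCircle.continuous {φ : UnitAddCircle → ℝ} (h : IsSmoothOnCircle φ) :
    Continuous φ :=
  continuous_coinduced_dom.2 (ContDiff.continuous h)

theorem IsSmoothOnCircle.continuous_circleDeriv {φ : UnitAddCircle → ℝ}
    (h : IsSmoothOnCircle φ) : Continuous (circleDeriv φ) := by
  refine continuous_coinduced_dom.2 ?_
  have h1 : Continuous (deriv (fun t : ℝ => φ (t : UnitAddCircle))) :=
    ContDiff.continuous_deriv h (by simp)
  refine h1.congr fun t => ?_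
  change _ = deriv (fun s : ℝ => φ ((t : UnitAddCircle) + (s : UnitAddCircle))) 0
  have h2 := deriv_comp_const_add (fun s : ℝ => φ (s : UnitAddCircle)) t 0
  simp only [add_zero, AddCircle.coe_add] at h2
  exact h2.symm

theorem integrable_continuous_smul {E : Type*} [NormedAddCommGroup E] [NormedSpace ℝ E]
    {φ : UnitAddCircle → ℝ} (h : Continuous φ) (f : L2T E) :
    Integrable (fun x => φ x • f x) := by
  obtain ⟨C, hC⟩ := isCompact_univ.exists_bound_of_continuousOn h.continuousOn
  have hf : Integrable (f : UnitAddCircle → E) :=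
    (Lp.memLp f).integrable (by norm_num)
  exact hf.bdd_smul C h.aestronglyMeasurable
    (Eventually.of_forall fun x => hC x (mem_univ x))

theorem integral_smul_add {E : Type*} [NormedAddCommGroup E] [NormedSpace ℝ E]
    {φ : UnitAddCircle → ℝ} (h : Continuous φ) (f g : L2T E) :
    ∫ x, φ x • (f + g : L2T E) x = (∫ x, φ x • f x) + ∫ x, φ x • g x := by
  rw [← integral_add (integrable_continuous_smul h f) (integrable_continuous_smul h g)]
  refine integral_congr_ae ?_
  filter_upwards [Lp.coeFn_add f g] with x hx
  rw [hx, Pi.add_apply, smul_add]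

theorem integral_smul_const_smul {E : Type*} [NormedAddCommGroup E] [NormedSpace ℝ E]
    (φ : UnitAddCircle → ℝ) (c : ℝ) (f : L2T E) :
    ∫ x, φ x • (c • f : L2T E) x = c • ∫ x, φ x • f x := by
  rw [← integral_smul]
  refine integral_congr_ae ?_
  filter_upwards [Lp.coeFn_smul c f] with x hx
  rw [hx, Pi.smul_apply, smul_comm]

theorem HasWeakDeriv.add {E : Type*} [NormedAddCommGroup E] [NormedSpace ℝ E]
    {f f' g g' : L2T E} (h : HasWeakDeriv f f') (h' : HasWeakDeriv g g') :
    HasWeakDeriv (f + g) (f' + g') := by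
  intro φ hφ
  rw [integral_smul_add hφ.continuous_circleDeriv, integral_smul_add hφ.continuous,
    h φ hφ, h' φ hφ, neg_add]

theorem HasWeakDeriv.smul {E : Type*} [NormedAddCommGroup E] [NormedSpace ℝ E]
    {f f' : L2T E} (c : ℝ) (h : HasWeakDeriv f f') : HasWeakDeriv (c • f) (c • f') := by
  intro φ hφ
  rw [integral_smul_const_smul, integral_smul_const_smul, h φ hφ, smul_neg]

theorem HasWeakDeriv.zero {E : Type*} [NormedAddCommGroup E] [NormedSpace ℝ E] :
    HasWeakDeriv (0 : L2T E) 0 := by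
  have h : ∀ φ : UnitAddCircle → ℝ, ∫ x, φ x • (0 : L2T E) x = 0 := fun φ => by
    simp
  intro φ _
  rw [h, h, neg_zero]

/-- The Sobolev space `H^k(ℝ / ℤ; E)`. An element is a function together with its weak derivatives
of order at most `k`; the norm is the square root of the sum of their squared `L²` norms. -/
def SobolevH (k : ℕ) (E : Type*) [NormedAddCommGroup E] [NormedSpace ℝ E] :
    Submodule ℝ (PiLp 2 (fun _ : Fin (k + 1) => L2T E)) where
  carrier := {f | ∀ j : Fin k, HasWeakDeriv (f j.castSucc) (f j.succ)}
  add_mem' hf hg j := (hf j).add (hg j)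
  zero_mem' _ := HasWeakDeriv.zero
  smul_mem' c _ hf j := (hf j).smul c

/-- The function underlying an element of a Sobolev space. -/
def sobolevFn {k : ℕ} {E : Type*} [NormedAddCommGroup E] [NormedSpace ℝ E]
    (f : SobolevH k E) : L2T E := f.1 0

/-- The path `u` belongs to `L^q(0,T; H^k)`. -/
def MemLpSobolev (q : ℝ≥0∞) (T : ℝ) (k : ℕ) {E : Type*} [NormedAddCommGroup E]
    [NormedSpace ℝ E] (u : ℝ → L2T E) : Prop :=
  ∃ U : ℝ → SobolevH k E, MemLp U q (volume.restrict (Icc 0 T)) ∧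
    ∀ᵐ t ∂(volume.restrict (Icc 0 T)), sobolevFn (U t) = u t

/-! ### Controls and variation spaces -/

/-- The pairs `s ≤ t` in `[a,b]`. -/
def simplex2 (a b : ℝ) : Set (ℝ × ℝ) := {z | a ≤ z.1 ∧ z.1 ≤ z.2 ∧ z.2 ≤ b}

/-- Controls on `[a,b]`. -/
structure IsControl (a b : ℝ) (w : ℝ → ℝ → ℝ) : Prop where
  continuousOn : ContinuousOn (fun z : ℝ × ℝ => w z.1 z.2) (simplex2 a b)
  nonneg : ∀ s t, a ≤ s → s ≤ t → t ≤ b → 0 ≤ w s t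
  diag : ∀ t ∈ Icc a b, w t t = 0
  superadditive : ∀ s r t, a ≤ s → s ≤ r → r ≤ t → t ≤ b → w s r + w r t ≤ w s t

/-- The space `𝒱₂^q([a,b]; E)` of two-index maps of finite `q`-variation. -/
def MemV2 (q a b : ℝ) {E : Type*} [NormedAddCommGroup E] (G : ℝ → ℝ → E) : Prop :=
  ContinuousOn (fun z : ℝ × ℝ => G z.1 z.2) (simplex2 a b) ∧
  (∀ t ∈ Icc a b, G t t = 0) ∧
  ∃ w : ℝ → ℝ → ℝ, IsControl a b w ∧
    ∀ s t, a ≤ s → s ≤ t → t ≤ b → ‖G s t‖ ≤ w s t ^ (1 / q)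

/-- The increments `δg` of a path `g`. -/
def increment {E : Type*} [NormedAddCommGroup E] (g : ℝ → E) (s t : ℝ) : E := g t - g s

/-- The space `𝒱^q([a,b]; E)` of continuous paths of finite `q`-variation. -/
def MemV (q a b : ℝ) {E : Type*} [NormedAddCommGroup E] (g : ℝ → E) : Prop :=
  ContinuousOn g (Icc a b) ∧ MemV2 q a b (increment g)

/-- The space `𝒱₂,loc^{1-}([a,b]; E)`: there are an exponent `0 < q < 1` and a finite covering of
`[a,b]` by compact intervals on each of which the map has finite `q`-variation. -/
def MemV2LocOneMinus (a b : ℝ) {E : Type*} [NormedAddCommGroup E] (R : ℝ → ℝ → E) : Prop :=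
  ∃ q : ℝ, 0 < q ∧ q < 1 ∧ ∃ (n : ℕ) (c d : Fin n → ℝ),
    (∀ k, a ≤ c k ∧ c k ≤ d k ∧ d k ≤ b) ∧ (Icc a b ⊆ ⋃ k, Icc (c k) (d k)) ∧
    ∀ k, MemV2 q (c k) (d k) R

/-- The `q`-th power `‖G‖^q` of the `q`-variation seminorm of `G` in `𝒱₂^q([a,b]; E)`: the supremum
of `∑ ‖G (t i) (t (i+1))‖^q` over the partitions `a = t 0 ≤ ⋯ ≤ t n = b`. -/
def variationPow (q a b : ℝ) {E : Type*} [NormedAddCommGroup E] (G : ℝ → ℝ → E) : ℝ≥0∞ :=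
  ⨆ (n : ℕ) (t : ℕ → ℝ) (_ : Monotone t) (_ : t 0 = a) (_ : t n = b),
    ∑ i ∈ Finset.range n, ‖G (t i) (t (i + 1))‖ₑ ^ q

/-- The `q`-variation seminorm of `G` in `𝒱₂^q([a,b]; E)`. -/
def variationNorm (q a b : ℝ) {E : Type*} [NormedAddCommGroup E] (G : ℝ → ℝ → E) : ℝ≥0∞ :=
  variationPow q a b G ^ (1 / q)

/-! ### Rough drivers -/

/-- Anti-symmetric linear maps. -/
def IsSkewMap (A : LR3) : Prop := ∀ v w : R3, inner ℝ (A v) w = -inner ℝ v (A w)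

/-- Three-dimensional rough drivers on `[0,T]`. -/
structure IsRoughDriver (T p : ℝ) (G GG : ℝ → ℝ → L2T LR3) : Prop where
  memV_fst : MemV2 p 0 T G
  memV_snd : MemV2 (p / 2) 0 T GG
  additive : ∀ s r t, 0 ≤ s → s ≤ r → r ≤ t → t ≤ T → G s t - G s r - G r t = 0
  chen : ∀ s r t, 0 ≤ s → s ≤ r → r ≤ t → t ≤ T →
    ∀ᵐ x, GG s t x - GG s r x - GG r t x = (G r t x).comp (G s r x)

/-- The pair `(δΓ, GG)` is the canonical lift of the smooth path `Γ`, that is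
`GG s t = ∫_s^t dΓ_r (Γ_r - Γ_s)`; the integral converges in `L¹(ℝ / ℤ)`, where the product of two
elements of `L²` lives. -/
structure IsSmoothRoughDriver (T p : ℝ) (Γ : ℝ → L2T LR3) (GG : ℝ → ℝ → L2T LR3) : Prop where
  smooth : ContDiffOn ℝ ∞ Γ (Icc 0 T)
  driver : IsRoughDriver T p (increment Γ) GG
  lift : ∀ s t, 0 ≤ s → s ≤ t → t ≤ T →
    GG s t =ᵐ[volume] (∫ r in s..t, ContinuousLinearMap.holder 1
      (ContinuousLinearMap.compL ℝ R3 R3 R3) (derivWithin Γ (Icc 0 T) r) (Γ r - Γ s) :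
        Lp LR3 1 (volume : Measure UnitAddCircle))

/-- The space `ℛ𝒟ₐ^p(H^k)` of geometric, anti-symmetric rough drivers on `[0,T]` with coefficients
in `H^k`. -/
structure IsAntisymmRoughDriver (T p : ℝ) (k : ℕ) (G GG : ℝ → ℝ → SobolevH k LR3) : Prop where
  memV_fst : MemV2 p 0 T G
  memV_snd : MemV2 (p / 2) 0 T GG
  antisymm : ∀ s t, 0 ≤ s → s ≤ t → t ≤ T → ∀ᵐ x, IsSkewMap (sobolevFn (G s t) x)
  driver : IsRoughDriver T p (fun s t => sobolevFn (G s t)) (fun s t => sobolevFn (GG s t))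
  geometric : ∃ (Γ : ℕ → ℝ → L2T LR3) (Λ : ℕ → ℝ → ℝ → L2T LR3),
    (∀ n, IsSmoothRoughDriver T p (Γ n) (Λ n)) ∧
    (∀ n, ∀ t ∈ Icc 0 T, ∀ᵐ x, IsSkewMap (Γ n t x)) ∧
    Tendsto (fun n => variationNorm p 0 T (fun s t => increment (Γ n) s t - sobolevFn (G s t)))
      atTop (𝓝 0) ∧
    Tendsto (fun n => variationNorm (p / 2) 0 T (fun s t => Λ n s t - sobolevFn (GG s t)))
      atTop (𝓝 0)

/-- The control
`ω(s,t) = ‖G‖^p_{𝒱₂^p(s,t;H^k)} + ‖GG‖^{p/2}_{𝒱₂^{p/2}(s,t;H^k)} + ‖G‖^{2p}_{𝒱₂^p(s,t;H^k)}`. -/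
def driverControl (p : ℝ) {k : ℕ} (G GG : ℝ → ℝ → SobolevH k LR3) (s t : ℝ) : ℝ≥0∞ :=
  variationPow p s t G + variationPow (p / 2) s t GG + variationPow p s t G ^ 2

/-! ### The rough Landau-Lifshitz-Gilbert equation -/

/-- The vector product of the Euclidean space of dimension three. -/
def cross3 (a b : R3) : R3 := WithLp.toLp 2 (crossProduct a.ofLp b.ofLp)

/-- `𝒯_f = ∂ₓ²f + |∂ₓf|² f`. -/
def tension (f : SobolevH 2 R3) (x : UnitAddCircle) : R3 :=
  f.1 2 x + ‖f.1 1 x‖ ^ 2 • f.1 0 x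

/-- The drift `f × ∂ₓ²f - f × (f × ∂ₓ²f)`. -/
def llgDrift (f : SobolevH 2 R3) (x : UnitAddCircle) : R3 :=
  cross3 (f.1 0 x) (f.1 2 x) - cross3 (f.1 0 x) (cross3 (f.1 0 x) (f.1 2 x))

/-- `u` is a solution in `L^∞(0,T; H¹) ∩ L²(0,T; H²)` of
`δu_{s,t} = ∫_s^t (u × ∂ₓ²u - u × (u × ∂ₓ²u)) dr + G_{s,t} u_s + GG_{s,t} u_s + R_{s,t}`
with remainder `R` in `𝒱₂,loc^{1-}([0,T]; L²)` and initial datum `u0`. The path `U` is `u` regarded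
as an element of `L²(0,T; H²)`, and `F` is the drift as an element of `L²(0,T; L²)`. -/
structure IsRoughLLGSolution (T : ℝ) (G GG : ℝ → ℝ → SobolevH 2 LR3) (u0 : SobolevH 1 R3)
    (u : ℝ → L2T R3) (U : ℝ → SobolevH 2 R3) : Prop where
  mem_H1 : MemLpSobolev ∞ T 1 u
  mem_H2 : MemLp U 2 (volume.restrict (Icc 0 T))
  eq_H2 : ∀ᵐ t ∂(volume.restrict (Icc 0 T)), sobolevFn (U t) = u t
  equation : ∃ (F : ℝ → L2T R3) (R : ℝ → ℝ → L2T R3),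
    MemLp F 2 (volume.restrict (Icc 0 T)) ∧
    (∀ᵐ r ∂(volume.restrict (Icc 0 T)), F r =ᵐ[volume] llgDrift (U r)) ∧
    MemV2LocOneMinus 0 T R ∧
    ∀ s t, 0 ≤ s → s ≤ t → t ≤ T →
      ∀ᵐ x, u t x - u s x - (∫ r in s..t, F r : L2T R3) x =
        sobolevFn (G s t) x (u s x) + sobolevFn (GG s t) x (u s x) + R s t x
  initial : ∀ φ : L2T R3,
    Tendsto (fun t => inner ℝ (u t) φ) (𝓝[>] 0) (𝓝 (inner ℝ (sobolevFn u0) φ))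

end

/-!
The proof removes the driver from the equation by a change of frame, and then runs the classical
energy estimate of the harmonic map heat flow in the moving frame.

**The frame.** On an interval `[a, b]` where `ω = driverSize p G GG` is small, the operators
`1 + G_{s,t} + 𝔾_{s,t}` on the Hilbert space `H²` are multiplicative up to `ω(s,t)^{3/p}`, by Chen's
relation. As `3 / p > 1`, multiplicative sewing provides orbits: paths `φ` in `H²` with
`φ_t = (1 + G_{s,t} + 𝔾_{s,t}) φ_s + O(ω(s,t)^{3/p})`. They are obtained as weak limits of products
along finite sets of times (`IsAlmostFlow.exists_orbit`, `exists_driver_orbit`). The first level of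
the driver is anti-symmetric, and geometricity gives `𝔾 + 𝔾ᵀ = G²`
(`IsAntisymmRoughDriver.symmetric_part`), so that one step of the flow preserves pointwise inner
products up to `O(ω^{3/p})`. An additive function of intervals that is small compared with a
superadditive one vanishes (`additive_eq_zero_of_small`), hence inner products of orbits are constant
in time, and the orbits that start from the standard basis remain orthonormal at almost every point
(`exists_moving_frame`).

**The equation in the frame.** The same argument applies to the pairing `φ · u` of an orbit with the
solution: the driver cancels, the remainder is negligible on each interval of the covering, and
`φ_t · u_t - φ_s · u_s = ∫_s^t φ_r · F_r dr` with the drift `F`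
(`IsRoughPath.sobDot_sub_eq_integral`). The intervals of the covering are glued by connectedness.

**The energy.** For the coordinates `wⁱ = φⁱ · u` one has
`‖∂wⁱ_t‖² - ‖∂wⁱ_a‖² = -2 ∫ ⟨φⁱ · F, ∂²wⁱ⟩`, mode by mode in Fourier series
(`norm_sq_sub_eq_integral`). Up to terms with at most one derivative of `u`, the sum over `i` of the
integrands is `⟨F, ∂²u⟩`, which for a unit vector field is `‖𝒯_u‖² = ‖F‖² / 2`
(`llgDrift_identities`, `sum_inner_dotSecond_ge`). On short intervals the error terms are absorbed:
the energy `1 + ‖∂u‖²` plus the dissipation grows at most by a fixed factor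
(`IsSphereSolution.energy_le_of_short`). The number of such intervals is proportional to
`T + ω(0, T)`, since only superadditivity of `ω` is needed for a greedy subdivision
(`growth_of_superadditive`), and this is the exponential bound (`exists_energy_bound`). It is
homogeneous in the initial datum because `1 + ‖∂u⁰‖² = ‖u⁰‖_{H¹}²` for fields of unit vectors.

**The other bounds.** The identity `|∂²u|² = |𝒯_u|² + |∂u|⁴` and the Sobolev inequality for `|∂u|²`
bound the second derivative (`norm_sq_second_deriv_le`). The increments of the coordinates are
integrals of the drift, and those of the frame are of order `ω^{1/p}`, which bounds the increments of
`u` (`exists_increment_bound`) and, by superadditivity, their `p`-variation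
(`variationNorm_increment_le`, `memV_of_increment_le`).
-/

noncomputable section

/-! ### Additive two-parameter maps and the product formula -/

/-- An additive two-parameter map whose increments are small compared with a superadditive function
vanishes: this is the uniqueness half of the sewing lemma. -/
theorem additive_eq_zero_of_small {E : Type*} [NormedAddCommGroup E] {a b : ℝ} (hab : a ≤ b)
    (D : ℝ → ℝ → E) (W : ℝ → ℝ → ℝ)
    (hadd : ∀ s r t, a ≤ s → s ≤ r → r ≤ t → t ≤ b → D s t = D s r + D r t)
    (hW : ∀ s r t, a ≤ s → s ≤ r → r ≤ t → t ≤ b → W s r + W r t ≤ W s t)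
    (hD : ∀ ε > 0, ∃ δ > 0, ∀ s t, a ≤ s → s ≤ t → t ≤ b → t - s < δ → ‖D s t‖ ≤ ε * W s t) :
    D a b = 0 := by
  have key : ∀ ε > 0, ‖D a b‖ ≤ ε * W a b := by
    intro ε hε
    obtain ⟨δ, hδ, h⟩ := hD ε hε
    obtain ⟨n, hn⟩ := exists_nat_gt ((b - a) / δ)
    have hn0 : 0 < (n : ℝ) := lt_of_le_of_lt (div_nonneg (by linarith) hδ.le) hn
    have hstep : (b - a) / n < δ := by
      rw [div_lt_iff₀ hδ] at hn
      rw [div_lt_iff₀ hn0]; linarith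
    have hstep0 : 0 ≤ (b - a) / n := div_nonneg (by linarith) hn0.le
    have hend : ∀ i : ℕ, i ≤ n → a + i * ((b - a) / n) ≤ b := by
      intro i hi
      have : (i : ℝ) * ((b - a) / n) ≤ n * ((b - a) / n) := by gcongr
      have h2 : (n : ℝ) * ((b - a) / n) = b - a := by field_simp
      linarith
    have hind : ∀ i : ℕ, i ≤ n → ‖D a (a + i * ((b - a) / n))‖ ≤
        ε * W a (a + i * ((b - a) / n)) := by
      intro i
      induction i with
      | zero =>
        intro _
        have := h a a le_rfl le_rfl hab (by simpa using hδ)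
        simpa using this
      | succ i ih =>
        intro hi
        have h1 := ih (by omega)
        have h0 : a ≤ a + i * ((b - a) / n) := by
          have : 0 ≤ (i : ℝ) * ((b - a) / n) := by positivity
          linarith
        have hle : a + (i : ℝ) * ((b - a) / n) ≤ a + ((i + 1 : ℕ) : ℝ) * ((b - a) / n) := by
          push_cast; nlinarith
        have h2 := h _ _ h0 hle (hend _ hi) (by push_cast; linarith)
        rw [hadd _ _ _ le_rfl h0 hle (hend _ hi)]
        have h3 := hW _ _ _ le_rfl h0 hle (hend _ hi)
        calc _ ≤ _ := norm_add_le _ _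
          _ ≤ ε * (W a (a + i * ((b - a) / n)) +
                W (a + i * ((b - a) / n)) (a + ((i + 1 : ℕ) : ℝ) * ((b - a) / n))) := by linarith
          _ ≤ _ := by gcongr
    have := hind n le_rfl
    have h2 : a + (n : ℝ) * ((b - a) / n) = b := by field_simp; ring
    rwa [h2] at this
  have hlim : Tendsto (fun ε : ℝ => ε * W a b) (𝓝[>] 0) (𝓝 0) := by
    have : Tendsto (fun ε : ℝ => ε * W a b) (𝓝 0) (𝓝 (0 * W a b)) :=
      tendsto_id.mul_const _
    rw [zero_mul] at this
    exact this.mono_left nhdsWithin_le_nhds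
  have := ge_of_tendsto hlim (eventually_nhdsWithin_of_forall fun ε hε => key ε hε)
  simpa using this

/-- Primitives of integrable functions are continuous. -/
theorem continuousOn_of_integral_form {E : Type*} [NormedAddCommGroup E] [NormedSpace ℝ E]
    {a b : ℝ} (hab : a ≤ b) {F f : ℝ → E} (hf : IntervalIntegrable f volume a b)
    (hF : ∀ t ∈ Icc a b, F t = F a + ∫ r in a..t, f r) : ContinuousOn F (Icc a b) := by
  have h := intervalIntegral.continuousOn_primitive_interval' hf left_mem_uIcc
  rw [uIcc_of_le hab] at h
  exact (continuousOn_const.add h).congr hF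

theorem intervalIntegrable_sub_Icc {E : Type*} [NormedAddCommGroup E] {a b s t : ℝ} {f : ℝ → E}
    (hf : IntervalIntegrable f volume a b) (has : a ≤ s) (hst : s ≤ t) (htb : t ≤ b) :
    IntervalIntegrable f volume s t :=
  hf.mono_set (by
    rw [uIcc_of_le hst, uIcc_of_le (has.trans (hst.trans htb))]
    exact Icc_subset_Icc has htb)

theorem intervalIntegrable_bilin_right {E F G : Type*} [NormedAddCommGroup E] [NormedSpace ℝ E]
    [NormedAddCommGroup F] [NormedSpace ℝ F] [NormedAddCommGroup G] [NormedSpace ℝ G]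
    (B : E →L[ℝ] F →L[ℝ] G) {a b : ℝ} (hab : a ≤ b) {f : ℝ → E} {H : ℝ → F}
    (hf : IntervalIntegrable f volume a b) (hH : ContinuousOn H (Icc a b)) :
    IntervalIntegrable (fun r => B (f r) (H r)) volume a b := by
  rw [intervalIntegrable_iff_integrableOn_Icc_of_le hab] at hf ⊢
  obtain ⟨C, hC⟩ := isCompact_Icc.exists_bound_of_continuousOn hH
  exact B.integrable_of_bilin_of_bdd_right C hf
    (hH.aestronglyMeasurable_of_isCompact isCompact_Icc measurableSet_Icc)
    ((ae_restrict_iff' measurableSet_Icc).2 (Eventually.of_forall hC))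

theorem sub_eq_integral_of_integral_form {E : Type*} [NormedAddCommGroup E] [NormedSpace ℝ E]
    {a b : ℝ} {P f : ℝ → E} (hf : IntervalIntegrable f volume a b)
    (hP : ∀ t ∈ Icc a b, P t = P a + ∫ r in a..t, f r) (s t : ℝ) (has : a ≤ s) (hst : s ≤ t)
    (htb : t ≤ b) : P t - P s = ∫ r in s..t, f r := by
  rw [hP t ⟨has.trans hst, htb⟩, hP s ⟨has, hst.trans htb⟩, add_sub_add_left_eq_sub,
    intervalIntegral.integral_interval_sub_left]
  · exact intervalIntegrable_sub_Icc hf le_rfl (has.trans hst) htb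
  · exact intervalIntegrable_sub_Icc hf le_rfl has (hst.trans htb)

/-- The product formula `B(F_b, H_b) - B(F_a, H_a) = ∫ B(f, H) + B(F, h)` for the primitives `F` and
`H` of two integrable functions with values in Banach spaces. -/
theorem bilin_sub_eq_integral {E F G : Type*} [NormedAddCommGroup E] [NormedSpace ℝ E]
    [CompleteSpace E] [NormedAddCommGroup F] [NormedSpace ℝ F] [CompleteSpace F]
    [NormedAddCommGroup G] [NormedSpace ℝ G] [CompleteSpace G]
    (B : E →L[ℝ] F →L[ℝ] G) {a b : ℝ} (hab : a ≤ b) {P f : ℝ → E} {Q h : ℝ → F}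
    (hf : IntervalIntegrable f volume a b) (hh : IntervalIntegrable h volume a b)
    (hP : ∀ t ∈ Icc a b, P t = P a + ∫ r in a..t, f r)
    (hQ : ∀ t ∈ Icc a b, Q t = Q a + ∫ r in a..t, h r) :
    B (P b) (Q b) - B (P a) (Q a) = ∫ r in a..b, (B (f r) (Q r) + B (P r) (h r)) := by
  have hPc := continuousOn_of_integral_form hab hf hP
  have hQc := continuousOn_of_integral_form hab hh hQ
  have hi1 := intervalIntegrable_bilin_right B hab hf hQc
  have hi2 : IntervalIntegrable (fun r => B (P r) (h r)) volume a b :=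
    intervalIntegrable_bilin_right B.flip hab hh hPc
  have hi := hi1.add hi2
  have hz := additive_eq_zero_of_small hab
    (fun s t => B (P t) (Q t) - B (P s) (Q s) - ∫ r in s..t, (B (f r) (Q r) + B (P r) (h r)))
    (fun s t => ∫ r in s..t, (‖f r‖ + ‖h r‖)) ?_ ?_ ?_
  · exact sub_eq_zero.1 hz
  · intro s r t has hsr hrt htb
    rw [← intervalIntegral.integral_add_adjacent_intervals
      (intervalIntegrable_sub_Icc hi has hsr (hrt.trans htb))
      (intervalIntegrable_sub_Icc hi (has.trans hsr) hrt htb)]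
    abel
  · intro s r t has hsr hrt htb
    have hn := hf.norm.add hh.norm
    exact (intervalIntegral.integral_add_adjacent_intervals
      (intervalIntegrable_sub_Icc hn has hsr (hrt.trans htb))
      (intervalIntegrable_sub_Icc hn (has.trans hsr) hrt htb)).le
  · intro ε hε
    have hB : 0 < ‖B‖ + 1 := by positivity
    have huP := isCompact_Icc.uniformContinuousOn_of_continuous hPc
    have huQ := isCompact_Icc.uniformContinuousOn_of_continuous hQc
    rw [Metric.uniformContinuousOn_iff] at huP huQ
    obtain ⟨δ₁, hδ₁, h1⟩ := huP (ε / (‖B‖ + 1)) (by positivity)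
    obtain ⟨δ₂, hδ₂, h2⟩ := huQ (ε / (‖B‖ + 1)) (by positivity)
    refine ⟨min δ₁ δ₂, lt_min hδ₁ hδ₂, fun s t has hst htb hd => ?_⟩
    have hsub : Icc s t ⊆ Icc a b := Icc_subset_Icc has htb
    have hfs := intervalIntegrable_sub_Icc hf has hst htb
    have hhs := intervalIntegrable_sub_Icc hh has hst htb
    have e1 : B (P t) (Q t) - B (P s) (Q s) =
        ∫ r in s..t, (B (f r) (Q t) + B (P s) (h r)) := by
      have hi3 : IntervalIntegrable (fun r => B (f r) (Q t)) volume s t :=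
        intervalIntegrable_bilin_right B hst hfs continuousOn_const
      have hi4 : IntervalIntegrable (fun r => B (P s) (h r)) volume s t :=
        intervalIntegrable_bilin_right B.flip hst hhs continuousOn_const
      rw [intervalIntegral.integral_add hi3 hi4]
      have e2 : ∫ r in s..t, B (f r) (Q t) = B (P t - P s) (Q t) := by
        rw [sub_eq_integral_of_integral_form hf hP s t has hst htb]
        exact (B.flip (Q t)).intervalIntegral_comp_comm hfs
      have e3 : ∫ r in s..t, B (P s) (h r) = B (P s) (Q t - Q s) := by
        rw [sub_eq_integral_of_integral_form hh hQ s t has hst htb]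
        exact (B (P s)).intervalIntegral_comp_comm hhs
      rw [e2, e3]; simp
    have hi3 : IntervalIntegrable (fun r => B (f r) (Q t) + B (P s) (h r)) volume s t :=
      (intervalIntegrable_bilin_right B hst hfs continuousOn_const).add
        (intervalIntegrable_bilin_right B.flip hst hhs continuousOn_const)
    rw [e1, ← intervalIntegral.integral_sub hi3 (intervalIntegrable_sub_Icc hi has hst htb),
      ← intervalIntegral.integral_const_mul]
    refine intervalIntegral.norm_integral_le_of_norm_le hst ?_ ((hfs.norm.add hhs.norm).const_mul _)
    refine Eventually.of_forall fun r hr => ?_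
    have hr' : r ∈ Icc s t := ⟨hr.1.le, hr.2⟩
    have hdr : dist t r < min δ₁ δ₂ := by
      rw [Real.dist_eq, abs_of_nonneg (by linarith [hr'.2])]; linarith [hr'.1]
    have hdr' : dist s r < min δ₁ δ₂ := by
      rw [Real.dist_eq, abs_of_nonpos (by linarith [hr'.1])]; linarith [hr'.2]
    have n1 := (h2 t (hsub ⟨hst, le_rfl⟩) r (hsub hr') (hdr.trans_le (min_le_right _ _))).le
    have n2 := (h1 s (hsub ⟨le_rfl, hst⟩) r (hsub hr') (hdr'.trans_le (min_le_left _ _))).le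
    rw [dist_eq_norm] at n1 n2
    have e : B (f r) (Q t) + B (P s) (h r) - (B (f r) (Q r) + B (P r) (h r)) =
        B (f r) (Q t - Q r) + B (P s - P r) (h r) := by
      simp only [map_sub, sub_apply]; abel
    rw [e]
    calc _ ≤ ‖B‖ * ‖f r‖ * ‖Q t - Q r‖ + ‖B‖ * ‖P s - P r‖ * ‖h r‖ :=
          (norm_add_le _ _).trans (add_le_add (B.le_opNorm₂ _ _) (B.le_opNorm₂ _ _))
      _ ≤ (‖B‖ + 1) * ‖f r‖ * (ε / (‖B‖ + 1)) + (‖B‖ + 1) * (ε / (‖B‖ + 1)) * ‖h r‖ := by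
          gcongr <;> linarith
      _ = ε * (‖f r‖ + ‖h r‖) := by field_simp

/-! ### Weak limits along ultrafilters -/

/-- A bounded family in a Hilbert space converges weakly along every ultrafilter. -/
theorem exists_weak_limit_of_bounded {ι X : Type*} [NormedAddCommGroup X] [InnerProductSpace ℝ X]
    [CompleteSpace X] (𝒰 : Ultrafilter ι) (x : ι → X) {M : ℝ} (hx : ∀ᶠ i in 𝒰, ‖x i‖ ≤ M) :
    ∃ y : X, ‖y‖ ≤ M ∧ ∀ z : X, Tendsto (fun i => inner ℝ (x i) z) 𝒰 (𝓝 (inner ℝ y z)) := by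
  let Φ : ι → WeakDual ℝ X := fun i =>
    WeakDual.toStrongDual.symm (InnerProductSpace.toDual ℝ X (x i))
  have hmem : ∀ᶠ i in 𝒰, Φ i ∈ WeakDual.toStrongDual ⁻¹' Metric.closedBall
      (0 : StrongDual ℝ X) M := by
    filter_upwards [hx] with i hi
    simp only [mem_preimage, Φ, LinearEquiv.apply_symm_apply, mem_closedBall_zero_iff]
    simpa using hi
  obtain ⟨ℓ, hℓ, hlim⟩ := (WeakDual.isCompact_closedBall (𝕜 := ℝ) (0 : StrongDual ℝ X)
    M).ultrafilter_le_nhds (𝒰.map Φ) (by rw [le_principal_iff]; exact hmem)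
  refine ⟨(InnerProductSpace.toDual ℝ X).symm (WeakDual.toStrongDual ℓ), ?_, fun z => ?_⟩
  · simpa using hℓ
  · have h1 : Tendsto Φ 𝒰 (𝓝 ℓ) := hlim
    have h2 := ((WeakBilin.eval_continuous (topDualPairing ℝ X) z).tendsto ℓ).comp h1
    have e1 : ∀ i, (topDualPairing ℝ X) (Φ i) z = inner ℝ (x i) z := fun i => by
      change (InnerProductSpace.toDual ℝ X (x i)) z = _
      simp
    have e2 : (topDualPairing ℝ X) ℓ z =
        inner ℝ ((InnerProductSpace.toDual ℝ X).symm (WeakDual.toStrongDual ℓ)) z := by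
      rw [InnerProductSpace.toDual_symm_apply]; rfl
    rw [← e2]
    exact h2.congr fun i => e1 i

/-- The norm is lower semicontinuous for weak convergence. -/
theorem norm_le_of_weak_limit {ι X : Type*} [NormedAddCommGroup X] [InnerProductSpace ℝ X]
    {l : Filter ι} [l.NeBot] {x : ι → X} {y : X} {M : ℝ} (hM : ∀ᶠ i in l, ‖x i‖ ≤ M)
    (h : ∀ z : X, Tendsto (fun i => inner ℝ (x i) z) l (𝓝 (inner ℝ y z))) : ‖y‖ ≤ M := by
  have h1 : inner ℝ y y ≤ M * ‖y‖ := by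
    refine le_of_tendsto (h y) ?_
    filter_upwards [hM] with i hi
    exact (real_inner_le_norm _ _).trans (by gcongr)
  rw [real_inner_self_eq_norm_mul_norm] at h1
  rcases (norm_nonneg y).eq_or_lt with h0 | h0
  · obtain ⟨i, hi⟩ := hM.exists
    rw [← h0]; exact (norm_nonneg _).trans hi
  · exact le_of_mul_le_mul_right h1 h0

/-! ### Multiplicative sewing -/

/-- Superadditive nonnegative functions of intervals. -/
structure IsSuperadditive (a b : ℝ) (w : ℝ → ℝ → ℝ) : Prop where
  nonneg : ∀ s t, a ≤ s → s ≤ t → t ≤ b → 0 ≤ w s t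
  add_le : ∀ s r t, a ≤ s → s ≤ r → r ≤ t → t ≤ b → w s r + w r t ≤ w s t

theorem IsSuperadditive.diag {a b : ℝ} {w : ℝ → ℝ → ℝ} (h : IsSuperadditive a b w) {t : ℝ}
    (h1 : a ≤ t) (h2 : t ≤ b) : w t t = 0 := by
  have := h.nonneg t t h1 le_rfl h2
  have := h.add_le t t t h1 le_rfl le_rfl h2
  linarith

theorem IsSuperadditive.mono {a b : ℝ} {w : ℝ → ℝ → ℝ} (h : IsSuperadditive a b w)
    {s s' t' t : ℝ} (h1 : a ≤ s) (h2 : s ≤ s') (h3 : s' ≤ t') (h4 : t' ≤ t) (h5 : t ≤ b) :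
    w s' t' ≤ w s t := by
  have e1 := h.add_le s s' t h1 h2 (h3.trans h4) h5
  have e2 := h.add_le s' t' t (h1.trans h2) h3 h4 h5
  have e3 := h.nonneg s s' h1 h2 (h3.trans (h4.trans h5))
  have e4 := h.nonneg t' t (h1.trans (h2.trans h3)) h4 h5
  linarith

theorem IsSuperadditive.restrict {a b c d : ℝ} {w : ℝ → ℝ → ℝ} (h : IsSuperadditive a b w)
    (hac : a ≤ c) (hdb : d ≤ b) : IsSuperadditive c d w :=
  ⟨fun s t h1 h2 h3 => h.nonneg s t (hac.trans h1) h2 (h3.trans hdb),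
    fun s r t h1 h2 h3 h4 => h.add_le s r t (hac.trans h1) h2 h3 (h4.trans hdb)⟩

/-- An almost multiplicative family of operators close to the identity: `A t t = 1` and
`A r t * A s r - A s t` is of order `w(s,t)^θ`. The constants `η` and `L` are coupled so that the
defect of arbitrarily long products is at most `L * w(s,t)^θ`. -/
structure IsAlmostFlow {X : Type*} [NormedAddCommGroup X] [NormedSpace ℝ X]
    (a b θ C η L : ℝ) (w : ℝ → ℝ → ℝ) (A : ℝ → ℝ → X →L[ℝ] X) : Prop where
  superadditive : IsSuperadditive a b w
  one_lt : 1 < θ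
  eta_nonneg : 0 ≤ η
  C_nonneg : 0 ≤ C
  L_nonneg : 0 ≤ L
  coupling : 2 * (1 / 2) ^ θ * (1 + 2 * η) ^ 2 * L + C * (2 + η) ≤ L
  small : L * w a b ^ θ ≤ η
  diag : ∀ t, a ≤ t → t ≤ b → A t t = 1
  near_one : ∀ s t, a ≤ s → s ≤ t → t ≤ b → ‖A s t - 1‖ ≤ η
  defect : ∀ s r t, a ≤ s → s ≤ r → r ≤ t → t ≤ b → ‖A r t * A s r - A s t‖ ≤ C * w s t ^ θ

section Flow

variable {X : Type*} [NormedAddCommGroup X]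

theorem IsAlmostFlow.norm_apply_le [NormedSpace ℝ X] {a b θ C η L : ℝ} {w : ℝ → ℝ → ℝ}
    {A : ℝ → ℝ → X →L[ℝ] X} (h : IsAlmostFlow a b θ C η L w A) {s t : ℝ} (h1 : a ≤ s) (h2 : s ≤ t)
    (h3 : t ≤ b) (x : X) : ‖A s t x‖ ≤ (1 + η) * ‖x‖ := by
  have e : A s t x = x + (A s t - 1) x := by simp
  rw [e]
  calc _ ≤ ‖x‖ + ‖(A s t - 1) x‖ := norm_add_le _ _
    _ ≤ ‖x‖ + η * ‖x‖ := by
        gcongr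
        exact ((A s t - 1).le_opNorm x).trans (by gcongr; exact h.near_one s t h1 h2 h3)
    _ = _ := by ring

/-- The uniform estimate of the sewing lemma: products of an almost flow along any sequence of
times differ from the single step by at most `L * w ^ θ`. The induction, on a bound `l` for the
number of steps, cuts the interval where half of `w` has been used; each half then contributes
`L * (w / 2) ^ θ`, and `2 * (1 / 2) ^ θ < 1` leaves room for the defects at the cut. -/
theorem IsAlmostFlow.norm_sub_le [NormedSpace ℝ X] {a b θ C η L : ℝ} {w : ℝ → ℝ → ℝ}
    {A : ℝ → ℝ → X →L[ℝ] X} (h : IsAlmostFlow a b θ C η L w A) {t : ℕ → ℝ} (ht : Monotone t)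
    (ha : ∀ i, a ≤ t i) (hb : ∀ i, t i ≤ b) {x : ℕ → X}
    (hx : ∀ i, x (i + 1) = A (t i) (t (i + 1)) (x i)) (l : ℕ) :
    ∀ m n, m ≤ n → n - m ≤ l → ‖x n - A (t m) (t n) (x m)‖ ≤ L * w (t m) (t n) ^ θ * ‖x m‖ := by
  have hw := h.superadditive
  have hw0 : ∀ i j, i ≤ j → 0 ≤ w (t i) (t j) := fun i j hij => hw.nonneg _ _ (ha i) (ht hij) (hb j)
  have hab : a ≤ b := (ha 0).trans (hb 0)
  have hθ0 : 0 ≤ θ := zero_le_one.trans h.one_lt.le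
  have hη := h.eta_nonneg
  have hL := h.L_nonneg
  have hC := h.C_nonneg
  have hbase : ∀ m n, m = n → ‖x n - A (t m) (t n) (x m)‖ ≤ L * w (t m) (t n) ^ θ * ‖x m‖ := by
    rintro m _ rfl
    rw [h.diag _ (ha m) (hb m)]
    simp only [one_apply_eq_self, sub_self, norm_zero]
    have := Real.rpow_nonneg (hw0 m m le_rfl) θ
    positivity
  induction l with
  | zero => intro m n hmn hl; exact hbase m n (by omega)
  | succ l ih =>
    intro m n hmn hl
    rcases hmn.eq_or_lt with rfl | hlt
    · exact hbase _ _ rfl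
    set W := w (t m) (t n) with hWdef
    have hW0 : 0 ≤ W := hw0 m n hmn
    -- the last index before `n` at which at most half of `w` has been used
    obtain ⟨k, hmk, hkn, hk1, hk2⟩ : ∃ k, m ≤ k ∧ k + 1 ≤ n ∧ w (t m) (t k) ≤ W / 2 ∧
        w (t (k + 1)) (t n) ≤ W / 2 := by
      classical
      let P : ℕ → Prop := fun j => m ≤ j ∧ w (t m) (t j) ≤ W / 2
      have hPm : P m := ⟨le_rfl, by rw [hw.diag (ha m) (hb m)]; positivity⟩
      have hle : m ≤ n - 1 := by omega
      have hPk : P (Nat.findGreatest P (n - 1)) := Nat.findGreatest_spec hle hPm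
      have hkle := Nat.findGreatest_le (P := P) (n - 1)
      refine ⟨Nat.findGreatest P (n - 1), hPk.1, by omega, hPk.2, ?_⟩
      rcases (show Nat.findGreatest P (n - 1) + 1 ≤ n by omega).eq_or_lt with he | hlt'
      · rw [he, hw.diag (ha n) (hb n)]; positivity
      · have hnot : ¬ P (Nat.findGreatest P (n - 1) + 1) :=
          Nat.findGreatest_is_greatest (Nat.lt_succ_self _) (by omega)
        have h3 : ¬ w (t m) (t (Nat.findGreatest P (n - 1) + 1)) ≤ W / 2 :=
          fun h' => hnot ⟨by have := hPk.1; omega, h'⟩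
        have h4 := hw.add_le (t m) (t (Nat.findGreatest P (n - 1) + 1)) (t n) (ha m)
          (ht (by have := hPk.1; omega)) (ht (by omega)) (hb n)
        linarith
    have hWθ : 0 ≤ W ^ θ := Real.rpow_nonneg hW0 _
    have hhalf : (W / 2) ^ θ = W ^ θ * (1 / 2) ^ θ := by
      rw [div_eq_mul_one_div, Real.mul_rpow hW0 (by norm_num)]
    have hh0 : (0 : ℝ) ≤ (1 / 2) ^ θ := by positivity
    have hh1 : (1 / 2 : ℝ) ^ θ ≤ 1 := Real.rpow_le_one (by norm_num) (by norm_num) hθ0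
    have hWab : W ^ θ ≤ w a b ^ θ :=
      Real.rpow_le_rpow hW0 (hw.mono le_rfl (ha m) (ht hmn) (hb n) le_rfl) hθ0
    have hLW : L * W ^ θ ≤ η := (by gcongr : L * W ^ θ ≤ L * w a b ^ θ).trans h.small
    set N := ‖x m‖ with hN
    have hN0 : 0 ≤ N := norm_nonneg _
    -- the two halves
    have i1 : ‖x k - A (t m) (t k) (x m)‖ ≤ L * (W ^ θ * (1 / 2) ^ θ) * N := by
      refine (ih m k hmk (by omega)).trans ?_
      rw [← hhalf]
      have := Real.rpow_le_rpow (hw0 m k hmk) hk1 hθ0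
      gcongr
    have i2 : ‖x n - A (t (k + 1)) (t n) (x (k + 1))‖ ≤
        L * (W ^ θ * (1 / 2) ^ θ) * ‖x (k + 1)‖ := by
      refine (ih (k + 1) n hkn (by omega)).trans ?_
      rw [← hhalf]
      have := Real.rpow_le_rpow (hw0 (k + 1) n hkn) hk2 hθ0
      gcongr
    have n0 : ‖x k‖ ≤ (1 + 2 * η) * N := by
      have e : x k = A (t m) (t k) (x m) + (x k - A (t m) (t k) (x m)) := by abel
      rw [e]
      have := h.norm_apply_le (ha m) (ht hmk) (hb k) (x m)
      have h5 : L * (W ^ θ * (1 / 2) ^ θ) * N ≤ η * N := by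
        gcongr
        calc _ ≤ L * (W ^ θ * 1) := by gcongr
          _ ≤ η := by rw [mul_one]; exact hLW
      calc _ ≤ _ := norm_add_le _ _
        _ ≤ (1 + η) * N + η * N := by linarith
        _ = _ := by ring
    have n1 : ‖x (k + 1)‖ ≤ (1 + 2 * η) ^ 2 * N := by
      rw [hx k]
      refine (h.norm_apply_le (ha k) (ht k.le_succ) (hb _) _).trans ?_
      calc _ ≤ (1 + 2 * η) * ((1 + 2 * η) * N) := by gcongr; linarith
        _ = _ := by ring
    have d1 := h.defect (t m) (t k) (t (k + 1)) (ha m) (ht hmk) (ht k.le_succ) (hb _)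
    have d2 := h.defect (t m) (t (k + 1)) (t n) (ha m) (ht (by omega)) (ht hkn) (hb _)
    have hmono : w (t m) (t (k + 1)) ^ θ ≤ W ^ θ :=
      Real.rpow_le_rpow (hw0 m (k + 1) (by omega))
        (hw.mono (ha m) le_rfl (ht (by omega)) (ht hkn) (hb n)) hθ0
    have e : x n - A (t m) (t n) (x m) =
        (x n - A (t (k + 1)) (t n) (x (k + 1))) +
        A (t (k + 1)) (t n) (A (t k) (t (k + 1)) (x k - A (t m) (t k) (x m))) +
        A (t (k + 1)) (t n) ((A (t k) (t (k + 1)) * A (t m) (t k) - A (t m) (t (k + 1))) (x m)) +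
        (A (t (k + 1)) (t n) * A (t m) (t (k + 1)) - A (t m) (t n)) (x m) := by
      rw [hx k]
      simp only [map_sub, sub_apply, mul_apply_eq_comp]
      abel
    have b2 : ‖A (t (k + 1)) (t n) (A (t k) (t (k + 1)) (x k - A (t m) (t k) (x m)))‖ ≤
        (1 + 2 * η) ^ 2 * (L * (W ^ θ * (1 / 2) ^ θ) * N) := by
      refine (h.norm_apply_le (ha _) (ht hkn) (hb _) _).trans ?_
      calc _ ≤ (1 + η) * ((1 + η) * ‖x k - A (t m) (t k) (x m)‖) := by
            gcongr; exact h.norm_apply_le (ha _) (ht k.le_succ) (hb _) _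
        _ ≤ (1 + 2 * η) * ((1 + 2 * η) * (L * (W ^ θ * (1 / 2) ^ θ) * N)) := by
            gcongr <;> linarith
        _ = _ := by ring
    have b3 : ‖A (t (k + 1)) (t n)
        ((A (t k) (t (k + 1)) * A (t m) (t k) - A (t m) (t (k + 1))) (x m))‖ ≤
        (1 + η) * (C * W ^ θ * N) := by
      refine (h.norm_apply_le (ha _) (ht hkn) (hb _) _).trans ?_
      gcongr
      refine (ContinuousLinearMap.le_opNorm _ _).trans ?_
      gcongr
      exact d1.trans (by gcongr)
    have b4 : ‖(A (t (k + 1)) (t n) * A (t m) (t (k + 1)) - A (t m) (t n)) (x m)‖ ≤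
        C * W ^ θ * N := by
      refine (ContinuousLinearMap.le_opNorm _ _).trans ?_
      gcongr
    have b1 : ‖x n - A (t (k + 1)) (t n) (x (k + 1))‖ ≤
        L * (W ^ θ * (1 / 2) ^ θ) * ((1 + 2 * η) ^ 2 * N) := i2.trans (by gcongr)
    rw [e]
    calc _ ≤ L * (W ^ θ * (1 / 2) ^ θ) * ((1 + 2 * η) ^ 2 * N) +
          (1 + 2 * η) ^ 2 * (L * (W ^ θ * (1 / 2) ^ θ) * N) +
          (1 + η) * (C * W ^ θ * N) + C * W ^ θ * N :=
          (norm_add_le _ _).trans (add_le_add ((norm_add_le _ _).trans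
            (add_le_add ((norm_add_le _ _).trans (add_le_add b1 b2)) b3)) b4)
      _ = (2 * (1 / 2) ^ θ * (1 + 2 * η) ^ 2 * L + C * (2 + η)) * (W ^ θ * N) := by ring
      _ ≤ L * (W ^ θ * N) := by gcongr; exact h.coupling
      _ = _ := by ring

/-- Discrete orbits of an almost flow along the points of a finite set. -/
theorem IsAlmostFlow.exists_finset_orbit [NormedSpace ℝ X] {a b θ C η L : ℝ} {w : ℝ → ℝ → ℝ}
    {A : ℝ → ℝ → X →L[ℝ] X} (h : IsAlmostFlow a b θ C η L w A) (x₀ : X) (S : Finset ℝ)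
    (haS : a ∈ S) (hS : ∀ s ∈ S, a ≤ s ∧ s ≤ b) :
    ∃ y : ℝ → X, y a = x₀ ∧ ∀ s ∈ S, ∀ t ∈ S, s ≤ t →
      ‖y t - A s t (y s)‖ ≤ L * w s t ^ θ * ‖y s‖ := by
  classical
  have hn : 0 < S.card := Finset.card_pos.2 ⟨a, haS⟩
  let e := S.orderEmbOfFin rfl
  let t : ℕ → ℝ := fun i => e ⟨min i (S.card - 1), by omega⟩
  have ht : Monotone t := fun i j hij => e.monotone (Fin.mk_le_mk.2 (min_le_min_right _ hij))
  have hmem : ∀ i, t i ∈ S := fun i => S.orderEmbOfFin_mem rfl _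
  have ha : ∀ i, a ≤ t i := fun i => (hS _ (hmem i)).1
  have hb : ∀ i, t i ≤ b := fun i => (hS _ (hmem i)).2
  let x : ℕ → X := fun n => Nat.rec x₀ (fun i xi => A (t i) (t (i + 1)) xi) n
  have hx : ∀ i, x (i + 1) = A (t i) (t (i + 1)) (x i) := fun i => rfl
  have hidx : ∀ s ∈ S, ∃ i : Fin S.card, e i = s := by
    intro s hs
    have : s ∈ Set.range e := by rw [S.range_orderEmbOfFin rfl]; exact hs
    exact this
  have : Nonempty (Fin S.card) := ⟨⟨0, hn⟩⟩
  choose! idx hidx using hidx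
  have htidx : ∀ s ∈ S, t (idx s).1 = s := by
    intro s hs
    have : (⟨min (idx s).1 (S.card - 1), by omega⟩ : Fin S.card) = idx s := by
      ext; simp; have := (idx s).2; omega
    simp only [t, this, hidx s hs]
  have hθ0 : θ ≠ 0 := (zero_lt_one.trans h.one_lt).ne'
  refine ⟨fun s => x (idx s).1, ?_, ?_⟩
  · have h1 := h.norm_sub_le ht ha hb hx _ 0 (idx a).1 (Nat.zero_le _) le_rfl
    have h0 : t 0 = a := le_antisymm ((ht (Nat.zero_le (idx a).1)).trans (htidx a haS).le) (ha 0)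
    have hab : a ≤ b := (hS a haS).2
    rw [htidx a haS, h0, h.superadditive.diag le_rfl hab, Real.zero_rpow hθ0,
      h.diag a le_rfl hab] at h1
    simp only [mul_zero, zero_mul, one_apply_eq_self, norm_le_zero_iff] at h1
    exact sub_eq_zero.1 h1
  · intro s hs r hr hsr
    have hle : (idx s).1 ≤ (idx r).1 := by
      have : e (idx s) ≤ e (idx r) := by rw [hidx s hs, hidx r hr]; exact hsr
      exact e.le_iff_le.1 this
    have h1 := h.norm_sub_le ht ha hb hx _ (idx s).1 (idx r).1 hle le_rfl
    rwa [htidx s hs, htidx r hr] at h1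

/-- Existence half of multiplicative sewing in a Hilbert space: an orbit is found as a weak limit of
the discrete orbits along the finite subsets of the interval. -/
theorem IsAlmostFlow.exists_orbit [InnerProductSpace ℝ X] [CompleteSpace X] {a b θ C η L : ℝ}
    (hab : a ≤ b) {w : ℝ → ℝ → ℝ} {A : ℝ → ℝ → X →L[ℝ] X}
    (h : IsAlmostFlow a b θ C η L w A) (x₀ : X) :
    ∃ y : ℝ → X, y a = x₀ ∧ (∀ t ∈ Icc a b, ‖y t‖ ≤ (1 + 2 * η) * ‖x₀‖) ∧
      ∀ s t, a ≤ s → s ≤ t → t ≤ b →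
        ‖y t - A s t (y s)‖ ≤ L * w s t ^ θ * ((1 + 2 * η) * ‖x₀‖) := by
  classical
  let S : Finset ℝ → Finset ℝ := fun D => insert a (D.filter fun r => a ≤ r ∧ r ≤ b)
  have hS : ∀ D, ∀ s ∈ S D, a ≤ s ∧ s ≤ b := by
    intro D s hs
    rcases Finset.mem_insert.1 hs with rfl | hs
    · exact ⟨le_rfl, hab⟩
    · exact (Finset.mem_filter.1 hs).2
  have haS : ∀ D, a ∈ S D := fun D => Finset.mem_insert_self _ _
  choose y hya hy using fun D => h.exists_finset_orbit x₀ (S D) (haS D) (hS D)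
  have hL := h.L_nonneg
  have hη := h.eta_nonneg
  have hθ0 : 0 ≤ θ := zero_le_one.trans h.one_lt.le
  have hbound : ∀ D, ∀ t ∈ S D, ‖y D t‖ ≤ (1 + 2 * η) * ‖x₀‖ := by
    intro D t ht
    have h1 := hy D a (haS D) t ht (hS D t ht).1
    rw [hya] at h1
    have h2 := h.norm_apply_le le_rfl (hS D t ht).1 (hS D t ht).2 x₀
    have h3 : L * w a t ^ θ ≤ η := by
      refine le_trans ?_ h.small
      have := Real.rpow_le_rpow (h.superadditive.nonneg a t le_rfl (hS D t ht).1 (hS D t ht).2)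
        (h.superadditive.mono le_rfl le_rfl (hS D t ht).1 (hS D t ht).2 le_rfl) hθ0
      gcongr
    have e : y D t = A a t x₀ + (y D t - A a t x₀) := by abel
    rw [e]
    calc _ ≤ _ := norm_add_le _ _
      _ ≤ (1 + η) * ‖x₀‖ + η * ‖x₀‖ := add_le_add h2 (h1.trans (by gcongr))
      _ = _ := by ring
  let 𝒰 : Ultrafilter (Finset ℝ) := Ultrafilter.of atTop
  have hev : ∀ t ∈ Icc a b, ∀ᶠ D in 𝒰, t ∈ S D := by
    intro t ht
    have : ∀ᶠ D : Finset ℝ in atTop, t ∈ S D := by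
      filter_upwards [eventually_ge_atTop {t}] with D hD
      exact Finset.mem_insert_of_mem (Finset.mem_filter.2 ⟨hD (Finset.mem_singleton_self t), ht⟩)
    exact Ultrafilter.of_le atTop this
  have hlim : ∀ t, ∃ z : X, t ∈ Icc a b → (‖z‖ ≤ (1 + 2 * η) * ‖x₀‖ ∧
      ∀ v : X, Tendsto (fun D => inner ℝ (y D t) v) 𝒰 (𝓝 (inner ℝ z v))) := by
    intro t
    by_cases ht : t ∈ Icc a b
    · obtain ⟨z, hz⟩ := exists_weak_limit_of_bounded 𝒰 (fun D => y D t)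
        ((hev t ht).mono fun D hD => hbound D t hD)
      exact ⟨z, fun _ => hz⟩
    · exact ⟨0, fun h' => absurd h' ht⟩
  choose z hz using hlim
  refine ⟨z, ?_, fun t ht => (hz t ht).1, fun s t has hst htb => ?_⟩
  · refine ext_inner_right ℝ fun v => ?_
    refine tendsto_nhds_unique ((hz a ⟨le_rfl, hab⟩).2 v) ?_
    exact tendsto_const_nhds.congr fun D => by rw [hya]
  · have hs : s ∈ Icc a b := ⟨has, hst.trans htb⟩
    have ht : t ∈ Icc a b := ⟨has.trans hst, htb⟩
    refine norm_le_of_weak_limit (l := (𝒰 : Filter (Finset ℝ)))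
      (x := fun D => y D t - A s t (y D s)) ?_ fun v => ?_
    · filter_upwards [hev s hs, hev t ht] with D hsD htD
      have h0 := Real.rpow_nonneg (h.superadditive.nonneg s t has hst htb) θ
      exact (hy D s hsD t htD hst).trans (by gcongr; exact hbound D s hsD)
    · have h1 := (hz t ht).2 v
      have h2 := (hz s hs).2 ((ContinuousLinearMap.adjoint (A s t)) v)
      simp only [ContinuousLinearMap.adjoint_inner_right] at h2
      simpa only [inner_sub_left] using h1.sub h2

end Flow

/-! ### Growth along a superadditive function -/

/-- If a relation on intervals `P n s t` composes additively in `n` and holds with `n = 1` wherever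
`w ≤ ε`, then it holds with `n` proportional to `w`. No continuity of `w` is needed beyond uniform
smallness on short intervals. -/
theorem growth_of_superadditive {a b ε δ : ℝ} {w : ℝ → ℝ → ℝ} (hw : IsSuperadditive a b w)
    (hε : 0 < ε) (hδ : 0 < δ)
    (hsmall : ∀ s t, a ≤ s → s ≤ t → t ≤ b → t - s ≤ δ → w s t ≤ ε)
    (P : ℕ → ℝ → ℝ → Prop)
    (hone : ∀ s t, a ≤ s → s ≤ t → t ≤ b → w s t ≤ ε → P 1 s t)
    (hcomp : ∀ m n s r t, a ≤ s → s ≤ r → r ≤ t → t ≤ b → P m s r → P n r t → P (m + n) s t) :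
    ∀ n : ℕ, ∀ s t, a ≤ s → s ≤ t → t ≤ b → w s t ≤ (n + 1 : ℕ) * ε → P (2 * n + 1) s t := by
  intro n
  induction n with
  | zero => intro s t h1 h2 h3 h4; exact hone s t h1 h2 h3 (by simpa using h4)
  | succ n ih =>
    intro s t h1 h2 h3 h4
    let R : Set ℝ := {r | s ≤ r ∧ r ≤ t ∧ w s r ≤ ε}
    have hsR : s ∈ R := ⟨le_rfl, h2, by rw [hw.diag h1 (h2.trans h3)]; exact hε.le⟩
    have hbdd : BddAbove R := ⟨t, fun r hr => hr.2.1⟩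
    obtain ⟨r, hr, hlt⟩ := exists_lt_of_lt_csSup ⟨s, hsR⟩ (show sSup R - δ / 2 < sSup R by linarith)
    have hrle : r ≤ sSup R := le_csSup hbdd hr
    by_cases hcase : sSup R + δ / 2 ≤ t
    · -- just beyond the supremum more than `ε` has been used
      set r' := sSup R + δ / 2
      have hsr' : s ≤ r' := by have := le_csSup hbdd hsR; simp only [r']; linarith
      have hr'R : r' ∉ R := fun hmem => by have := le_csSup hbdd hmem; simp only [r'] at this; linarith
      have hw1 : ε < w s r' := by
        by_contra hcon
        exact hr'R ⟨hsr', hcase, not_lt.1 hcon⟩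
      have hrr' : r ≤ r' := by simp only [r']; linarith
      have hw2 := hw.add_le s r' t h1 hsr' hcase h3
      have q1 := hone s r h1 hr.1 (hr.2.1.trans h3) hr.2.2
      have q2 := hone r r' (h1.trans hr.1) hrr' (hcase.trans h3)
        (hsmall r r' (h1.trans hr.1) hrr' (hcase.trans h3) (by simp only [r']; linarith))
      have q3 := ih r' t (h1.trans hsr') hcase h3 (by push_cast at h4 ⊢; linarith)
      have := hcomp _ _ s r' t h1 hsr' hcase h3
        (hcomp _ _ s r r' h1 hr.1 hrr' (hcase.trans h3) q1 q2) q3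
      rwa [show 1 + 1 + (2 * n + 1) = 2 * (n + 1) + 1 by ring] at this
    · have q1 := hone s r h1 hr.1 (hr.2.1.trans h3) hr.2.2
      have q2 := hone r t (h1.trans hr.1) hr.2.1 h3
        (hsmall r t (h1.trans hr.1) hr.2.1 h3 (by linarith))
      -- the remaining steps are taken on the degenerate interval at `t`
      have q3 : ∀ m : ℕ, P (m + 1) t t := by
        intro m
        induction m with
        | zero => exact hone t t (h1.trans h2) le_rfl h3 (by rw [hw.diag (h1.trans h2) h3]; exact hε.le)
        | succ m ihm =>
          exact hcomp _ _ t t t (h1.trans h2) le_rfl le_rfl h3 ihm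
            (hone t t (h1.trans h2) le_rfl h3 (by rw [hw.diag (h1.trans h2) h3]; exact hε.le))
      have := hcomp _ _ s t t h1 h2 le_rfl h3 (hcomp _ _ s r t h1 hr.1 hr.2.1 h3 q1 q2) (q3 (2 * n))
      rwa [show 1 + 1 + (2 * n + 1) = 2 * (n + 1) + 1 by ring] at this

/-! ### Weak derivatives and primitives on the circle -/

/-- An integrable function stays integrable under multiplication by the real part of a continuous
function. -/
theorem integrable_re_smul {E : Type*} [NormedAddCommGroup E] [NormedSpace ℝ E]
    {h : UnitAddCircle → E} (hh : Integrable h) (f : C(UnitAddCircle, ℂ)) :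
    Integrable (fun x => (f x).re • h x) :=
  hh.bdd_smul ‖f‖ (Complex.continuous_re.comp f.continuous).aestronglyMeasurable
    (Eventually.of_forall fun x => (Complex.abs_re_le_norm _).trans (f.norm_coe_le_norm x))

/-- An integrable function on the circle which is orthogonal to all real trigonometric monomials
vanishes almost everywhere. -/
theorem ae_eq_zero_of_forall_integral_fourier {E : Type*} [NormedAddCommGroup E] [NormedSpace ℝ E]
    [CompleteSpace E] {h : UnitAddCircle → E} (hh : Integrable h)
    (H : ∀ (n : ℤ) (c : ℂ), ∫ x, (c * fourier n x).re • h x = 0) : h =ᵐ[volume] 0 := by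
  have hspan : ∀ f ∈ Submodule.span ℂ (Set.range (@fourier (1 : ℝ))), ∀ c : ℂ,
      ∫ x, ((c • f : C(UnitAddCircle, ℂ)) x).re • h x = 0 := by
    intro f hf
    induction hf using Submodule.span_induction with
    | mem f hf =>
      obtain ⟨n, rfl⟩ := hf
      intro c; simpa using H n c
    | zero => intro c; simp
    | add f g _ _ hf hg =>
      intro c
      have := integral_add (integrable_re_smul hh (c • f)) (integrable_re_smul hh (c • g))
      rw [hf c, hg c, add_zero] at this
      rw [← this]
      refine integral_congr_ae (Eventually.of_forall fun x => ?_)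
      simp [mul_add, sub_add_sub_comm, ← add_smul]
    | smul a f _ hf =>
      intro c; rw [smul_smul]; exact hf _
  have hall : ∀ f : C(UnitAddCircle, ℂ), ∫ x, (f x).re • h x = 0 := by
    intro f
    have hmem : f ∈ closure (Submodule.span ℂ (Set.range (@fourier (1 : ℝ))) :
        Set C(UnitAddCircle, ℂ)) := by
      rw [← Submodule.topologicalClosure_coe, span_fourier_closure_eq_top]; trivial
    have hle : ∀ ε > 0, ‖∫ x, (f x).re • h x‖ ≤ ε * ∫ x, ‖h x‖ := by
      intro ε hε
      obtain ⟨g, hg, hfg⟩ := Metric.mem_closure_iff.1 hmem ε hε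
      have h0 := hspan g hg 1
      rw [one_smul] at h0
      rw [← sub_zero (∫ x, (f x).re • h x), ← h0,
        ← integral_sub (integrable_re_smul hh f) (integrable_re_smul hh g), ← integral_const_mul]
      refine norm_integral_le_of_norm_le (hh.norm.const_mul _) (Eventually.of_forall fun x => ?_)
      rw [← sub_smul, norm_smul, ← Complex.sub_re]
      gcongr
      refine (Complex.abs_re_le_norm _).trans ?_
      rw [dist_eq_norm] at hfg
      exact ((f - g).norm_coe_le_norm x).trans hfg.le
    have hlim : Tendsto (fun ε : ℝ => ε * ∫ x, ‖h x‖) (𝓝[>] 0) (𝓝 0) := by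
      have : Tendsto (fun ε : ℝ => ε * ∫ x, ‖h x‖) (𝓝 0) (𝓝 (0 * ∫ x, ‖h x‖)) :=
        tendsto_id.mul_const _
      rw [zero_mul] at this
      exact this.mono_left nhdsWithin_le_nhds
    simpa using ge_of_tendsto hlim (eventually_nhdsWithin_of_forall fun ε hε => hle ε hε)
  refine ae_eq_zero_of_forall_setIntegral_isClosed_eq_zero hh fun s hs => ?_
  obtain ⟨δ, hδ0, hδ⟩ : ∃ δ : ℕ → ℝ, (∀ n, 0 < δ n) ∧ Tendsto δ atTop (𝓝 0) :=
    ⟨fun n => 1 / ((n : ℝ) + 1), fun n => by positivity, tendsto_one_div_add_atTop_nhds_zero_nat⟩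
  let ψ : ℕ → UnitAddCircle → ℝ := fun n x => (thickenedIndicator (hδ0 n) s x : ℝ)
  have hψc : ∀ n, Continuous (ψ n) := fun n =>
    NNReal.continuous_coe.comp (thickenedIndicator (hδ0 n) s).continuous
  have hz : ∀ n, ∫ x, ψ n x • h x = 0 := by
    intro n
    have := hall ⟨fun x => (ψ n x : ℂ), Complex.continuous_ofReal.comp (hψc n)⟩
    simpa using this
  have hlim : Tendsto (fun n => ∫ x, ψ n x • h x) atTop
      (𝓝 (∫ x, (s.indicator (fun _ => (1 : ℝ)) x) • h x)) := by
    refine tendsto_integral_of_dominated_convergence (fun x => ‖h x‖)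
      (fun n => ((hψc n).aestronglyMeasurable.smul hh.1)) hh.norm (fun n => ?_) ?_
    · refine Eventually.of_forall fun x => ?_
      rw [norm_smul]
      have : ‖ψ n x‖ ≤ 1 := by
        simp only [ψ, Real.norm_eq_abs, NNReal.abs_eq]
        exact_mod_cast thickenedIndicator_le_one (hδ0 n) s x
      exact mul_le_of_le_one_left (norm_nonneg _) this
    · refine Eventually.of_forall fun x => Tendsto.smul_const ?_ _
      have h1 := tendsto_pi_nhds.1 (thickenedIndicator_tendsto_indicator_closure hδ0 hδ s) x
      rw [hs.closure_eq] at h1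
      have h2 := (NNReal.continuous_coe.tendsto _).comp h1
      have e : s.indicator (fun _ => (1 : ℝ)) x =
          ((s.indicator (fun _ => (1 : NNReal)) x : NNReal) : ℝ) := by
        by_cases hx : x ∈ s <;> simp [hx]
      rw [e]
      exact h2
  simp only [hz] at hlim
  have h0 := tendsto_nhds_unique hlim tendsto_const_nhds
  rw [← integral_indicator hs.measurableSet, ← h0]
  refine integral_congr_ae (Eventually.of_forall fun x => ?_)
  by_cases hx : x ∈ s <;> simp [hx]

theorem integrable_L2T {E : Type*} [NormedAddCommGroup E] (f : L2T E) :
    Integrable (f : UnitAddCircle → E) :=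
  (Lp.memLp f).integrable (by norm_num)

theorem intervalIntegrable_coe {E : Type*} [NormedAddCommGroup E] {f : UnitAddCircle → E}
    (hf : Integrable f) (a b : ℝ) : IntervalIntegrable (fun t : ℝ => f (t : UnitAddCircle))
      volume a b := by
  have hper : Function.Periodic (fun t : ℝ => f (t : UnitAddCircle)) 1 := fun t => by simp
  refine hper.intervalIntegrable (t := 0) one_ne_zero ?_ a b
  rw [intervalIntegrable_iff_integrableOn_Ioc_of_le (by norm_num)]
  exact ((UnitAddCircle.measurePreserving_mk 0).integrable_comp hf.1).2 hf

/-- `F` is a primitive of `g` on the circle. -/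
def IsPrimitive {E : Type*} [NormedAddCommGroup E] [NormedSpace ℝ E] (F g : UnitAddCircle → E) :
    Prop := ∀ a b : ℝ, F b - F a = ∫ t in a..b, g (t : UnitAddCircle)

theorem circleDeriv_coe (φ : UnitAddCircle → ℝ) (t : ℝ) :
    circleDeriv φ t = deriv (fun s : ℝ => φ (s : UnitAddCircle)) t := by
  change deriv (fun s : ℝ => φ ((t : UnitAddCircle) + (s : UnitAddCircle))) 0 = _
  have h2 := deriv_comp_const_add (fun s : ℝ => φ (s : UnitAddCircle)) t 0
  simp only [add_zero, AddCircle.coe_add] at h2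
  exact h2

theorem IsSmoothOnCircle.isPrimitive {φ : UnitAddCircle → ℝ} (h : IsSmoothOnCircle φ) :
    IsPrimitive φ (circleDeriv φ) := by
  intro a b
  simp only [circleDeriv_coe]
  rw [intervalIntegral.integral_deriv_eq_sub]
  · intro x _
    exact (ContDiff.differentiable h (by simp)) x
  · exact (ContDiff.continuous_deriv h (by simp)).intervalIntegrable _ _

theorem IsPrimitive.continuous {E : Type*} [NormedAddCommGroup E] [NormedSpace ℝ E]
    {F g : UnitAddCircle → E} (h : IsPrimitive F g) (hg : Integrable g) : Continuous F := by
  refine continuous_coinduced_dom.2 ?_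
  have := intervalIntegral.continuous_primitive (fun a b => intervalIntegrable_coe hg a b) 0
  refine (this.add (continuous_const (y := F ((0 : ℝ) : UnitAddCircle)))).congr fun t => ?_
  change (∫ r in (0 : ℝ)..t, g r) + F ((0 : ℝ) : UnitAddCircle) = F t
  rw [← h 0 t]
  abel

/-- Leibniz' rule for primitives. -/
theorem IsPrimitive.bilin {E F G : Type*} [NormedAddCommGroup E] [NormedSpace ℝ E]
    [CompleteSpace E] [NormedAddCommGroup F] [NormedSpace ℝ F] [CompleteSpace F]
    [NormedAddCommGroup G] [NormedSpace ℝ G] [CompleteSpace G] (B : E →L[ℝ] F →L[ℝ] G)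
    {f f' : UnitAddCircle → E} {g g' : UnitAddCircle → F} (hf : IsPrimitive f f')
    (hg : IsPrimitive g g') (hf' : Integrable f') (hg' : Integrable g') :
    IsPrimitive (fun x => B (f x) (g x)) (fun x => B (f' x) (g x) + B (f x) (g' x)) := by
  have key : ∀ a b : ℝ, a ≤ b → B (f b) (g b) - B (f a) (g a) =
      ∫ t in a..b, (B (f' t) (g t) + B (f t) (g' t)) := fun a b hab =>
    bilin_sub_eq_integral B hab (P := fun t : ℝ => f t) (Q := fun t : ℝ => g t)
      (intervalIntegrable_coe hf' a b) (intervalIntegrable_coe hg' a b)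
      (fun t _ => by rw [← hf a t]; abel) (fun t _ => by rw [← hg a t]; abel)
  intro a b
  rcases le_total a b with hab | hab
  · exact key a b hab
  · rw [intervalIntegral.integral_symm, ← key b a hab]; abel

theorem IsPrimitive.integral_eq_zero {E : Type*} [NormedAddCommGroup E] [NormedSpace ℝ E]
    {F g : UnitAddCircle → E} (h : IsPrimitive F g) : ∫ x, g x = 0 := by
  rw [← UnitAddCircle.intervalIntegral_preimage 0 g, ← h 0 (0 + 1)]
  have : ((1 : ℝ) : UnitAddCircle) = 0 := AddCircle.coe_period 1
  simp [this]

/-- Integration by parts against a smooth function. -/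
theorem IsPrimitive.integral_circleDeriv_smul {E : Type*} [NormedAddCommGroup E] [NormedSpace ℝ E]
    [CompleteSpace E] {F g : UnitAddCircle → E} (h : IsPrimitive F g) (hg : Integrable g)
    {φ : UnitAddCircle → ℝ} (hφ : IsSmoothOnCircle φ) :
    ∫ x, circleDeriv φ x • F x = -∫ x, φ x • g x := by
  have hF : Integrable F := (h.continuous hg).integrable_of_hasCompactSupport
    (HasCompactSupport.of_compactSpace F)
  have hd : Integrable (circleDeriv φ) := hφ.continuous_circleDeriv.integrable_of_hasCompactSupport
    (HasCompactSupport.of_compactSpace _)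
  have h0 := (hφ.isPrimitive.bilin (ContinuousLinearMap.lsmul ℝ ℝ) h hd hg).integral_eq_zero
  simp only [ContinuousLinearMap.lsmul_apply] at h0
  have bdd : ∀ {ψ : UnitAddCircle → ℝ} {f : UnitAddCircle → E}, Continuous ψ → Integrable f →
      Integrable fun x => ψ x • f x := by
    intro ψ f hψ hf
    obtain ⟨C, hC⟩ := isCompact_univ.exists_bound_of_continuousOn hψ.continuousOn
    exact hf.bdd_smul C hψ.aestronglyMeasurable (Eventually.of_forall fun x => hC x (mem_univ x))
  rw [integral_add (bdd hφ.continuous_circleDeriv hF) (bdd hφ.continuous hg)] at h0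
  exact eq_neg_of_add_eq_zero_left h0

theorem hasWeakDeriv_of_isPrimitive {E : Type*} [NormedAddCommGroup E] [NormedSpace ℝ E]
    [CompleteSpace E] {f g : L2T E} {F G : UnitAddCircle → E} (hf : f =ᵐ[volume] F)
    (hg : g =ᵐ[volume] G) (h : IsPrimitive F G) : HasWeakDeriv f g := by
  intro φ hφ
  have e1 : ∫ x, circleDeriv φ x • f x = ∫ x, circleDeriv φ x • F x := by
    refine integral_congr_ae ?_
    filter_upwards [hf] with x hx
    rw [hx]
  have e2 : ∫ x, φ x • g x = ∫ x, φ x • G x := by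
    refine integral_congr_ae ?_
    filter_upwards [hg] with x hx
    rw [hx]
  rw [e1, e2, h.integral_circleDeriv_smul ((integrable_L2T g).congr hg) hφ]

/-- The real trigonometric monomials are smooth, with the expected derivative. -/
theorem smooth_fourier (n : ℤ) (c : ℂ) :
    IsSmoothOnCircle (fun x => (c * fourier n x).re) ∧
      ∀ x, circleDeriv (fun x => (c * fourier n x).re) x =
        (c * (2 * Real.pi * Complex.I * n) * fourier n x).re := by
  have hd : ∀ t : ℝ, HasDerivAt (fun s : ℝ => (c * fourier n (s : UnitAddCircle)).re)
      (c * (2 * Real.pi * Complex.I * n) * fourier n (t : UnitAddCircle)).re t := by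
    intro t
    have h1 := (hasDerivAt_fourier 1 n t).const_mul c
    have h2 := (Complex.reCLM.hasFDerivAt.comp_hasDerivAt t h1)
    simp only [Complex.ofReal_one, div_one, Complex.reCLM_apply] at h2
    rw [mul_assoc]
    exact h2
  constructor
  · change ContDiff ℝ ∞ (fun t : ℝ => (c * fourier n (t : UnitAddCircle)).re)
    have : (fun t : ℝ => (c * fourier n (t : UnitAddCircle)).re) =
        fun t : ℝ => Complex.reCLM (c * Complex.exp (2 * Real.pi * Complex.I * n * t)) := by
      funext t; rw [fourier_coe_apply]; simp
    rw [this]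
    refine Complex.reCLM.contDiff.comp (contDiff_const.mul ?_)
    exact (contDiff_const.mul Complex.ofRealCLM.contDiff).cexp
  · intro x
    induction x using QuotientAddGroup.induction_on with
    | H t =>
      rw [circleDeriv_coe]
      exact (hd t).deriv

/-- A function with a weak derivative agrees almost everywhere with a primitive of it. -/
theorem HasWeakDeriv.exists_isPrimitive {E : Type*} [NormedAddCommGroup E] [NormedSpace ℝ E]
    [CompleteSpace E] {f g : L2T E} (h : HasWeakDeriv f g) :
    ∃ F : UnitAddCircle → E, Continuous F ∧ f =ᵐ[volume] F ∧ IsPrimitive F g := by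
  have hgi := integrable_L2T g
  have hmean : ∫ x, g x = 0 := by
    have h1 := h (fun _ => 1) (contDiff_const : ContDiff ℝ ∞ fun _ : ℝ => (1 : ℝ))
    have h2 : ∀ x, circleDeriv (fun _ => (1 : ℝ)) x = 0 := fun x => by
      unfold circleDeriv; simp
    simpa [h2] using h1
  let γ : ℝ → E := fun t => g (t : UnitAddCircle)
  have hγ : ∀ a b, IntervalIntegrable γ volume a b := intervalIntegrable_coe hgi
  have hper : Function.Periodic (fun t : ℝ => ∫ r in (0 : ℝ)..t, γ r) 1 := by
    intro t
    have h1 : ∫ r in t..(t + 1), γ r = 0 := by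
      rw [← hmean]; exact UnitAddCircle.intervalIntegral_preimage t g
    change ∫ r in (0 : ℝ)..(t + 1), γ r = ∫ r in (0 : ℝ)..t, γ r
    rw [← intervalIntegral.integral_add_adjacent_intervals (hγ 0 t) (hγ t (t + 1)), h1, add_zero]
  let F₀ : UnitAddCircle → E := hper.lift
  have hF₀ : IsPrimitive F₀ g := by
    intro a b
    change (∫ r in (0 : ℝ)..b, γ r) - ∫ r in (0 : ℝ)..a, γ r = _
    exact intervalIntegral.integral_interval_sub_left (hγ _ _) (hγ _ _)
  have hF₀c := hF₀.continuous hgi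
  have hF₀i : Integrable F₀ :=
    hF₀c.integrable_of_hasCompactSupport (HasCompactSupport.of_compactSpace F₀)
  set m : E := ∫ x, ((f : UnitAddCircle → E) x - F₀ x) with hm
  have hfi := integrable_L2T f
  have hd : Integrable (fun x => f x - F₀ x) := hfi.sub hF₀i
  have hd' : Integrable (fun x => f x - F₀ x - m) := hd.sub (integrable_const m)
  have hzero : (fun x => f x - F₀ x - m) =ᵐ[volume] 0 := by
    refine ae_eq_zero_of_forall_integral_fourier hd' fun n c => ?_
    by_cases hn : n = 0
    · subst hn
      have e : ∀ x : UnitAddCircle, (c * fourier 0 x).re • (f x - F₀ x - m) =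
          c.re • (f x - F₀ x - m) := fun x => by rw [fourier_zero, mul_one]
      simp only [e]
      rw [integral_smul, integral_sub hd (integrable_const m)]
      simp [← hm, Measure.real]
    · have hn' : (2 * Real.pi * Complex.I * n : ℂ) ≠ 0 := by
        have : (Real.pi : ℂ) ≠ 0 := by exact_mod_cast Real.pi_ne_zero
        have : (n : ℂ) ≠ 0 := by exact_mod_cast hn
        simp [*]
      obtain ⟨hs, hder⟩ := smooth_fourier n (c / (2 * Real.pi * Complex.I * n))
      rw [div_mul_cancel₀ _ hn'] at hder
      set φ : UnitAddCircle → ℝ :=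
        fun x => (c / (2 * Real.pi * Complex.I * n) * fourier n x).re with hφ
      have e : ∀ x, (c * fourier n x).re • (f x - F₀ x - m) =
          circleDeriv φ x • f x - circleDeriv φ x • F₀ x - circleDeriv φ x • m := fun x => by
        rw [hder, smul_sub, smul_sub]
      simp only [e]
      obtain ⟨C, hC⟩ := isCompact_univ.exists_bound_of_continuousOn
        hs.continuous_circleDeriv.continuousOn
      have bdd : ∀ {f : UnitAddCircle → E}, Integrable f →
          Integrable fun x => circleDeriv φ x • f x := fun hf =>
        hf.bdd_smul C hs.continuous_circleDeriv.aestronglyMeasurable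
          (Eventually.of_forall fun x => hC x (mem_univ x))
      have hi : Integrable (fun x => circleDeriv φ x • f x - circleDeriv φ x • F₀ x) :=
        (bdd hfi).sub (bdd hF₀i)
      rw [integral_sub hi (bdd (integrable_const m)),
        integral_sub (bdd hfi) (bdd hF₀i), integral_smul_const, h φ hs,
        hF₀.integral_circleDeriv_smul hgi hs, hs.isPrimitive.integral_eq_zero]
      simp
  refine ⟨fun x => F₀ x + m, hF₀c.add continuous_const, ?_, fun a b => ?_⟩
  · filter_upwards [hzero] with x hx
    have : f x - F₀ x - m = 0 := hx
    rw [sub_sub, sub_eq_zero] at this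
    exact this
  · rw [← hF₀ a b, add_sub_add_right_eq_sub]

/-- Weak derivatives are unique. -/
theorem HasWeakDeriv.unique {E : Type*} [NormedAddCommGroup E] [NormedSpace ℝ E]
    [CompleteSpace E] {f g g' : L2T E} (h : HasWeakDeriv f g) (h' : HasWeakDeriv f g') :
    g = g' := by
  refine Lp.ext ?_
  have hi := (integrable_L2T g).sub (integrable_L2T g')
  have hz : (fun x => g x - g' x) =ᵐ[volume] 0 := by
    refine ae_eq_zero_of_forall_integral_fourier hi fun n c => ?_
    have hs := (smooth_fourier n c).1
    have := (h _ hs).symm.trans (h' _ hs)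
    simp only [smul_sub]
    rw [integral_sub (integrable_continuous_smul hs.continuous g)
      (integrable_continuous_smul hs.continuous g'), neg_inj.1 this, sub_self]
  filter_upwards [hz] with x hx
  exact sub_eq_zero.1 hx

/-! ### The Sobolev embedding and Leibniz' rule -/

instance isProbabilityMeasure_unitAddCircle :
    IsProbabilityMeasure (volume : Measure UnitAddCircle) :=
  ⟨UnitAddCircle.measure_univ⟩

theorem integral_norm_le_norm {E : Type*} [NormedAddCommGroup E] (f : L2T E) :
    ∫ x, ‖f x‖ ≤ ‖f‖ := by
  rw [integral_norm_eq_lintegral_enorm (Lp.aestronglyMeasurable f), Lp.norm_def,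
    ← eLpNorm_one_eq_lintegral_enorm]
  exact ENNReal.toReal_mono (Lp.eLpNorm_ne_top f)
    (eLpNorm_le_eLpNorm_of_exponent_le (by norm_num) (Lp.aestronglyMeasurable f))

theorem IsPrimitive.norm_le {E : Type*} [NormedAddCommGroup E] [NormedSpace ℝ E]
    {F g : UnitAddCircle → E} (h : IsPrimitive F g) (hg : Integrable g) (x : UnitAddCircle) :
    ‖F x‖ ≤ (∫ y, ‖F y‖) + ∫ y, ‖g y‖ := by
  have hF : Integrable F := (h.continuous hg).integrable_of_hasCompactSupport
    (HasCompactSupport.of_compactSpace F)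
  induction x using QuotientAddGroup.induction_on with
  | H a =>
    have hle : ∀ t ∈ Icc a (a + 1), ‖F (a : UnitAddCircle)‖ ≤
        ‖F (t : UnitAddCircle)‖ + ∫ y, ‖g y‖ := by
      intro t ht
      have e : F (a : UnitAddCircle) = F t - ∫ r in a..t, g (r : UnitAddCircle) := by
        rw [← h a t]; abel
      rw [e]
      refine (norm_sub_le _ _).trans ?_
      gcongr
      refine (intervalIntegral.norm_integral_le_integral_norm ht.1).trans ?_
      rw [← UnitAddCircle.intervalIntegral_preimage a fun y => ‖g y‖]
      exact intervalIntegral.integral_mono_interval le_rfl ht.1 ht.2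
        (Eventually.of_forall fun _ => norm_nonneg _) (intervalIntegrable_coe hg.norm _ _)
    have h1 : ∫ _ in a..(a + 1), ‖F (a : UnitAddCircle)‖ ≤
        ∫ t in a..(a + 1), (‖F (t : UnitAddCircle)‖ + ∫ y, ‖g y‖) :=
      intervalIntegral.integral_mono_on (by linarith) (by simp)
        ((intervalIntegrable_coe hF.norm _ _).add (by simp)) hle
    rw [intervalIntegral.integral_add (intervalIntegrable_coe hF.norm _ _) (by simp),
      UnitAddCircle.intervalIntegral_preimage a fun y => ‖F y‖] at h1
    simpa using h1

/-- The embedding of `H¹` into the bounded functions. -/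
theorem HasWeakDeriv.ae_norm_le {E : Type*} [NormedAddCommGroup E] [NormedSpace ℝ E]
    [CompleteSpace E] {f g : L2T E} (h : HasWeakDeriv f g) :
    ∀ᵐ x, ‖f x‖ ≤ (∫ y, ‖f y‖) + ∫ y, ‖g y‖ := by
  obtain ⟨F, -, hfF, hF⟩ := h.exists_isPrimitive
  have e : ∫ y, ‖f y‖ = ∫ y, ‖F y‖ := by
    refine integral_congr_ae ?_
    filter_upwards [hfF] with y hy
    rw [hy]
  filter_upwards [hfF] with x hx
  rw [hx, e]
  exact hF.norm_le (integrable_L2T g) x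

/-- Leibniz' rule for weak derivatives. -/
theorem HasWeakDeriv.bilin {E F G : Type*} [NormedAddCommGroup E] [NormedSpace ℝ E]
    [CompleteSpace E] [NormedAddCommGroup F] [NormedSpace ℝ F] [CompleteSpace F]
    [NormedAddCommGroup G] [NormedSpace ℝ G] [CompleteSpace G] (B : E →L[ℝ] F →L[ℝ] G)
    {f f' : L2T E} {g g' : L2T F} {k k' : L2T G} (hf : HasWeakDeriv f f')
    (hg : HasWeakDeriv g g') (hk : ∀ᵐ x, k x = B (f x) (g x))
    (hk' : ∀ᵐ x, k' x = B (f' x) (g x) + B (f x) (g' x)) : HasWeakDeriv k k' := by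
  obtain ⟨f₀, -, hff, hf₀⟩ := hf.exists_isPrimitive
  obtain ⟨g₀, -, hgg, hg₀⟩ := hg.exists_isPrimitive
  refine hasWeakDeriv_of_isPrimitive (F := fun x => B (f₀ x) (g₀ x))
    (G := fun x => B (f' x) (g₀ x) + B (f₀ x) (g' x)) ?_ ?_
    (hf₀.bilin B hg₀ (integrable_L2T f') (integrable_L2T g'))
  · filter_upwards [hk, hff, hgg] with x h1 h2 h3
    rw [h1, h2, h3]
  · filter_upwards [hk', hff, hgg] with x h1 h2 h3
    rw [h1, h2, h3]

/-! ### Sobolev spaces as Banach spaces -/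

/-- The `j`-th derivative as a continuous linear map. -/
def sobDeriv {k : ℕ} (E : Type*) [NormedAddCommGroup E] [NormedSpace ℝ E] (j : Fin (k + 1)) :
    SobolevH k E →L[ℝ] L2T E :=
  (PiLp.proj 2 (fun _ : Fin (k + 1) => L2T E) j : _ →L[ℝ] _).comp (SobolevH k E).subtypeL

theorem norm_sobDeriv_le {k : ℕ} {E : Type*} [NormedAddCommGroup E] [NormedSpace ℝ E]
    (f : SobolevH k E) (j : Fin (k + 1)) : ‖f.1 j‖ ≤ ‖f‖ :=
  PiLp.norm_apply_le f.1 j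

theorem sobolev_ae_norm_le {k : ℕ} {E : Type*} [NormedAddCommGroup E] [NormedSpace ℝ E]
    [CompleteSpace E] (f : SobolevH k E) (j : Fin k) : ∀ᵐ x, ‖f.1 j.castSucc x‖ ≤ 2 * ‖f‖ := by
  filter_upwards [(f.2 j).ae_norm_le] with x hx
  have h1 := (integral_norm_le_norm (f.1 j.castSucc)).trans (norm_sobDeriv_le f _)
  have h2 := (integral_norm_le_norm (f.1 j.succ)).trans (norm_sobDeriv_le f _)
  linarith

theorem sobolev_memLp_top {k : ℕ} {E : Type*} [NormedAddCommGroup E] [NormedSpace ℝ E]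
    [CompleteSpace E] (f : SobolevH k E) (j : Fin k) :
    MemLp (f.1 j.castSucc : UnitAddCircle → E) ∞ volume :=
  memLp_top_of_bound (Lp.aestronglyMeasurable _) _ (sobolev_ae_norm_le f j)

/-- The derivatives of order less than `k` of an element of `H^k`, as bounded functions. -/
def sobSup {k : ℕ} (E : Type*) [NormedAddCommGroup E] [NormedSpace ℝ E] [CompleteSpace E]
    (j : Fin k) : SobolevH k E →L[ℝ] Lp E ∞ (volume : Measure UnitAddCircle) :=
  LinearMap.mkContinuous
    { toFun := fun f => (sobolev_memLp_top f j).toLp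
      map_add' := fun f g => by
        rw [← MemLp.toLp_add]
        refine MemLp.toLp_congr _ _ ?_
        exact Lp.coeFn_add (f.1 j.castSucc) (g.1 j.castSucc)
      map_smul' := fun c f => by
        rw [RingHom.id_apply, ← MemLp.toLp_const_smul]
        refine MemLp.toLp_congr _ _ ?_
        exact Lp.coeFn_smul c (f.1 j.castSucc) }
    2 (fun f => by
      change ‖(sobolev_memLp_top f j).toLp‖ ≤ _
      rw [Lp.norm_toLp]
      refine ENNReal.toReal_le_of_le_ofReal (by positivity) ?_
      rw [eLpNorm_exponent_top]
      exact eLpNormEssSup_le_of_ae_bound (sobolev_ae_norm_le f j))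

theorem sobSup_coe {k : ℕ} {E : Type*} [NormedAddCommGroup E] [NormedSpace ℝ E] [CompleteSpace E]
    (j : Fin k) (f : SobolevH k E) : sobSup E j f =ᵐ[volume] f.1 j.castSucc :=
  (sobolev_memLp_top f j).coeFn_toLp

theorem norm_sobSup_le {k : ℕ} {E : Type*} [NormedAddCommGroup E] [NormedSpace ℝ E]
    [CompleteSpace E] (f : SobolevH k E) (j : Fin k) : ‖sobSup E j f‖ ≤ 2 * ‖f‖ :=
  ((sobSup E j).le_opNorm f).trans (mul_le_mul_of_nonneg_right
    (LinearMap.mkContinuous_norm_le _ (by norm_num) _) (norm_nonneg _))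

/-- An element of a Sobolev space is determined by its function, since weak derivatives are unique. -/
theorem sobolev_ext {k : ℕ} {E : Type*} [NormedAddCommGroup E] [NormedSpace ℝ E]
    [CompleteSpace E] {f g : SobolevH k E} (h : sobolevFn f = sobolevFn g) : f = g := by
  have key : ∀ j : ℕ, ∀ hj : j < k + 1, f.1 ⟨j, hj⟩ = g.1 ⟨j, hj⟩ := by
    intro j
    induction j with
    | zero => intro _; exact h
    | succ j ih =>
      intro hj
      have h1 := f.2 ⟨j, by omega⟩
      have h2 := g.2 ⟨j, by omega⟩
      have e : f.1 (Fin.castSucc ⟨j, by omega⟩) = g.1 (Fin.castSucc ⟨j, by omega⟩) :=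
        ih (by omega)
      rw [e] at h1
      exact h1.unique h2
  refine Subtype.ext (PiLp.ext fun j => key j.1 j.2)

/-- Integration against a continuous function. -/
def integralSmulL {φ : UnitAddCircle → ℝ} (hφ : Continuous φ) (E : Type*) [NormedAddCommGroup E]
    [NormedSpace ℝ E] : L2T E →L[ℝ] E :=
  LinearMap.mkContinuousOfExistsBound
    { toFun := fun f => ∫ x, φ x • f x
      map_add' := integral_smul_add hφ
      map_smul' := fun c f => integral_smul_const_smul φ c f }
    (by
      obtain ⟨C, hC⟩ := isCompact_univ.exists_bound_of_continuousOn hφ.continuousOn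
      have hC0 : 0 ≤ C := (norm_nonneg _).trans (hC 0 (mem_univ _))
      refine ⟨C, fun f => ?_⟩
      calc ‖∫ x, φ x • f x‖ ≤ ∫ x, C * ‖f x‖ := by
            refine norm_integral_le_of_norm_le ((integrable_L2T f).norm.const_mul C) ?_
            refine Eventually.of_forall fun x => ?_
            rw [norm_smul]
            gcongr
            exact hC x (mem_univ x)
        _ ≤ C * ‖f‖ := by
            rw [integral_const_mul]
            gcongr
            exact integral_norm_le_norm f)

/-- Weak differentiability is a family of closed conditions, one for each test function. -/
theorem isClosed_sobolevH (k : ℕ) (E : Type*) [NormedAddCommGroup E] [NormedSpace ℝ E] :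
    IsClosed (SobolevH k E : Set (PiLp 2 (fun _ : Fin (k + 1) => L2T E))) := by
  have : (SobolevH k E : Set (PiLp 2 (fun _ : Fin (k + 1) => L2T E))) =
      ⋂ (j : Fin k) (φ : UnitAddCircle → ℝ) (hφ : IsSmoothOnCircle φ),
        {f | integralSmulL hφ.continuous_circleDeriv E (f j.castSucc) =
          -integralSmulL hφ.continuous E (f j.succ)} := by
    ext f
    simp only [mem_iInter]
    rfl
  rw [this]
  refine isClosed_iInter fun j => isClosed_iInter fun φ => isClosed_iInter fun hφ => ?_
  refine isClosed_eq ?_ ?_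
  · exact (integralSmulL _ E).continuous.comp (PiLp.continuous_apply 2 _ _)
  · exact ((integralSmulL _ E).continuous.comp (PiLp.continuous_apply 2 _ _)).neg

instance completeSpace_sobolevH (k : ℕ) (E : Type*) [NormedAddCommGroup E] [NormedSpace ℝ E]
    [CompleteSpace E] : CompleteSpace (SobolevH k E) :=
  (isClosed_sobolevH k E).completeSpace_coe

/-- Weak derivatives of a strongly convergent family which are bounded by `M` give a weak derivative
of the limit that is bounded by `M`. -/
theorem exists_hasWeakDeriv_of_tendsto {ι : Type*} {l : Filter ι} [l.NeBot] {f g : ι → L2T R3}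
    {f₀ : L2T R3} {M : ℝ} (hf : Tendsto f l (𝓝 f₀)) (h : ∀ᶠ i in l, HasWeakDeriv (f i) (g i))
    (hM : ∀ᶠ i in l, ‖g i‖ ≤ M) : ∃ g₀, HasWeakDeriv f₀ g₀ ∧ ‖g₀‖ ≤ M := by
  let 𝒰 := Ultrafilter.of l
  have hle : (𝒰 : Filter ι) ≤ l := Ultrafilter.of_le l
  obtain ⟨g₀, hg₀, hlim⟩ := exists_weak_limit_of_bounded 𝒰 g (hle hM)
  refine ⟨g₀, fun φ hφ => ?_, hg₀⟩
  change integralSmulL hφ.continuous_circleDeriv R3 f₀ = -integralSmulL hφ.continuous R3 g₀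
  refine ext_inner_right ℝ fun v => ?_
  have h1 : Tendsto (fun i => inner ℝ (integralSmulL hφ.continuous_circleDeriv R3 (f i)) v) 𝒰
      (𝓝 (inner ℝ (integralSmulL hφ.continuous_circleDeriv R3 f₀) v)) :=
    ((((integralSmulL hφ.continuous_circleDeriv R3).continuous.tendsto f₀).comp
      (hf.mono_left hle)).inner tendsto_const_nhds)
  have h2 := (hlim (ContinuousLinearMap.adjoint (integralSmulL hφ.continuous R3) v)).neg
  simp only [ContinuousLinearMap.adjoint_inner_right] at h2
  rw [inner_neg_left]
  refine tendsto_nhds_unique h1 (h2.congr' ?_)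
  filter_upwards [hle h] with i hi
  have : integralSmulL hφ.continuous_circleDeriv R3 (f i) =
      -integralSmulL hφ.continuous R3 (g i) := hi φ hφ
  rw [this, inner_neg_left]

section Product

variable {E F G : Type*} [NormedAddCommGroup E] [NormedSpace ℝ E] [CompleteSpace E]
  [NormedAddCommGroup F] [NormedSpace ℝ F]
  [NormedAddCommGroup G] [NormedSpace ℝ G] (B : E →L[ℝ] F →L[ℝ] G)

/-- The product of a bounded derivative of the first factor with a derivative of the second. -/
def sobPair {k l : ℕ} (i : Fin k) (j : Fin (l + 1)) (f : SobolevH k E) (g : SobolevH l F) : L2T G :=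
  B.holderL volume ∞ 2 2 (sobSup E i f) (sobDeriv F j g)

theorem sobPair_coe {k l : ℕ} (i : Fin k) (j : Fin (l + 1)) (f : SobolevH k E)
    (g : SobolevH l F) :
    sobPair B i j f g =ᵐ[volume] fun x => B (f.1 i.castSucc x) (g.1 j x) := by
  filter_upwards [sobSup_coe i f, B.coeFn_holder (r := 2) (sobSup E i f) (sobDeriv F j g)]
    with x h1 h2
  refine h2.trans ?_
  rw [h1]; rfl

theorem norm_sobPair_le {k l : ℕ} (i : Fin k) (j : Fin (l + 1)) (f : SobolevH k E)
    (g : SobolevH l F) : ‖sobPair B i j f g‖ ≤ 2 * ‖B‖ * ‖f‖ * ‖g‖ := by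
  have h1 := norm_sobSup_le f i
  calc ‖sobPair B i j f g‖ ≤ ‖B‖ * ‖sobSup E i f‖ * ‖sobDeriv F j g‖ :=
        B.norm_holder_apply_apply_le _ _
    _ ≤ ‖B‖ * (2 * ‖f‖) * ‖g‖ := by gcongr; exact norm_sobDeriv_le g j
    _ = _ := by ring

theorem sobPair_add_left {k l : ℕ} (i : Fin k) (j : Fin (l + 1)) (f f' : SobolevH k E)
    (g : SobolevH l F) : sobPair B i j (f + f') g = sobPair B i j f g + sobPair B i j f' g := by
  simp [sobPair]

theorem sobPair_smul_left {k l : ℕ} (i : Fin k) (j : Fin (l + 1)) (c : ℝ) (f : SobolevH k E)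
    (g : SobolevH l F) : sobPair B i j (c • f) g = c • sobPair B i j f g := by
  simp [sobPair]

theorem sobPair_add_right {k l : ℕ} (i : Fin k) (j : Fin (l + 1)) (f : SobolevH k E)
    (g g' : SobolevH l F) : sobPair B i j f (g + g') = sobPair B i j f g + sobPair B i j f g' := by
  simp only [sobPair, map_add]

theorem sobPair_smul_right {k l : ℕ} (i : Fin k) (j : Fin (l + 1)) (c : ℝ) (f : SobolevH k E)
    (g : SobolevH l F) : sobPair B i j f (c • g) = c • sobPair B i j f g := by
  simp only [sobPair, map_smul]

/-- The pairing of an element of `H^k`, `k ≥ 1`, with a square integrable function. -/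
def sobPairL {k : ℕ} (i : Fin k) : SobolevH k E →L[ℝ] L2T F →L[ℝ] L2T G :=
  (B.holderL volume ∞ 2 2).comp (sobSup E i)

theorem sobPairL_coe {k : ℕ} (i : Fin k) (f : SobolevH k E) (g : L2T F) :
    sobPairL B i f g =ᵐ[volume] fun x => B (f.1 i.castSucc x) (g x) := by
  filter_upwards [sobSup_coe i f, B.coeFn_holder (r := 2) (sobSup E i f) g] with x h1 h2
  refine h2.trans ?_
  rw [h1]

theorem norm_sobPairL_apply_le {k : ℕ} (i : Fin k) (f : SobolevH k E) (g : L2T F) :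
    ‖sobPairL B i f g‖ ≤ 2 * ‖B‖ * ‖f‖ * ‖g‖ := by
  have h1 := norm_sobSup_le f i
  calc ‖sobPairL B i f g‖ ≤ ‖B‖ * ‖sobSup E i f‖ * ‖g‖ := B.norm_holder_apply_apply_le _ _
    _ ≤ ‖B‖ * (2 * ‖f‖) * ‖g‖ := by gcongr
    _ = _ := by ring

variable [CompleteSpace F] [CompleteSpace G]

/-- Leibniz' rule for `B(∂ⁱf, ∂ʲg)`, if the next derivative of `f` is still bounded. -/
theorem hasWeakDeriv_sobPair {k l : ℕ} (i : Fin k) (i' : Fin k) (j : Fin l)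
    (hi : i'.castSucc = i.succ) (f : SobolevH k E) (g : SobolevH l F) :
    HasWeakDeriv (sobPair B i j.castSucc f g)
      (sobPair B i' j.castSucc f g + sobPair B i j.succ f g) := by
  refine (f.2 i).bilin B (g.2 j) (sobPair_coe B i _ f g) ?_
  filter_upwards [sobPair_coe B i' j.castSucc f g, sobPair_coe B i j.succ f g,
    Lp.coeFn_add (sobPair B i' j.castSucc f g) (sobPair B i j.succ f g)] with x h1 h2 h3
  rw [h3, Pi.add_apply, h1, h2, hi]

/-- Leibniz' rule for `B(∂f, g)` with `f, g ∈ H²`: in the term `B(∂²f, g)` only the second factor is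
bounded, so that the pairing is taken in the other order. -/
theorem hasWeakDeriv_sobPair_two (f : SobolevH 2 E) (g : SobolevH 2 F) :
    HasWeakDeriv (sobPair B (1 : Fin 2) (0 : Fin 3) f g)
      (sobPair B.flip (0 : Fin 2) (2 : Fin 3) g f + sobPair B (1 : Fin 2) (1 : Fin 3) f g) := by
  refine (f.2 1).bilin B (g.2 0) (sobPair_coe B 1 0 f g) ?_
  filter_upwards [sobPair_coe B.flip (0 : Fin 2) (2 : Fin 3) g f,
    sobPair_coe B (1 : Fin 2) (1 : Fin 3) f g,
    Lp.coeFn_add (sobPair B.flip (0 : Fin 2) (2 : Fin 3) g f)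
      (sobPair B (1 : Fin 2) (1 : Fin 3) f g)] with x h1 h2 h3
  rw [h3, Pi.add_apply, h1, h2]
  rfl

/-- The product of two elements of `H²` under a bilinear map, with its two derivatives. The term
`B(∂²f, g)` of the second derivative is written with `B.flip`, because `sobPair` needs a bounded first
factor. -/
def sobMulFun (f : SobolevH 2 E) (g : SobolevH 2 F) : SobolevH 2 G :=
  ⟨WithLp.toLp 2 ![sobPair B (0 : Fin 2) (0 : Fin 3) f g,
    sobPair B (1 : Fin 2) (0 : Fin 3) f g + sobPair B (0 : Fin 2) (1 : Fin 3) f g,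
    sobPair B.flip (0 : Fin 2) (2 : Fin 3) g f + sobPair B (1 : Fin 2) (1 : Fin 3) f g +
      (sobPair B (1 : Fin 2) (1 : Fin 3) f g + sobPair B (0 : Fin 2) (2 : Fin 3) f g)], by
    intro j
    fin_cases j
    · exact hasWeakDeriv_sobPair B (0 : Fin 2) 1 (0 : Fin 2) rfl f g
    · exact (hasWeakDeriv_sobPair_two B f g).add
        (hasWeakDeriv_sobPair B (0 : Fin 2) 1 (1 : Fin 2) rfl f g)⟩

theorem norm_sobMulFun_le (f : SobolevH 2 E) (g : SobolevH 2 F) :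
    ‖sobMulFun B f g‖ ≤ 20 * ‖B‖ * ‖f‖ * ‖g‖ := by
  set N := 2 * ‖B‖ * ‖f‖ * ‖g‖ with hN
  have hN0 : 0 ≤ N := by positivity
  have b : ∀ (i : Fin 2) (j : Fin 3), ‖sobPair B i j f g‖ ≤ N := fun i j =>
    norm_sobPair_le B i j f g
  have b' : ‖sobPair B.flip (0 : Fin 2) (2 : Fin 3) g f‖ ≤ N := by
    refine (norm_sobPair_le B.flip _ _ g f).trans (le_of_eq ?_)
    rw [B.opNorm_flip, hN]; ring
  have h0 : ‖(sobMulFun B f g).1 0‖ ≤ N := b 0 0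
  have h1 : ‖(sobMulFun B f g).1 1‖ ≤ 2 * N :=
    (norm_add_le _ _).trans (by linarith [b 1 0, b 0 1])
  have h2 : ‖(sobMulFun B f g).1 2‖ ≤ 4 * N := by
    refine (norm_add_le _ _).trans ?_
    have e1 := norm_add_le (sobPair B.flip (0 : Fin 2) (2 : Fin 3) g f)
      (sobPair B (1 : Fin 2) (1 : Fin 3) f g)
    have e2 := norm_add_le (sobPair B (1 : Fin 2) (1 : Fin 3) f g)
      (sobPair B (0 : Fin 2) (2 : Fin 3) f g)
    linarith [b 1 1, b 0 2]
  have hsq : ‖sobMulFun B f g‖ ^ 2 = ‖(sobMulFun B f g).1 0‖ ^ 2 + ‖(sobMulFun B f g).1 1‖ ^ 2 +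
      ‖(sobMulFun B f g).1 2‖ ^ 2 := by
    change ‖(sobMulFun B f g).1‖ ^ 2 = _
    rw [PiLp.norm_sq_eq_of_L2, Fin.sum_univ_three]
  have : ‖sobMulFun B f g‖ ≤ 10 * N := by
    refine abs_le_of_sq_le_sq' ?_ (by positivity) |>.2
    rw [hsq]
    nlinarith [norm_nonneg ((sobMulFun B f g).1 0), norm_nonneg ((sobMulFun B f g).1 1),
      norm_nonneg ((sobMulFun B f g).1 2)]
  calc _ ≤ 10 * N := this
    _ = _ := by rw [hN]; ring

/-- Multiplication of elements of `H²` as a continuous bilinear map. -/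
def sobMul : SobolevH 2 E →L[ℝ] SobolevH 2 F →L[ℝ] SobolevH 2 G :=
  LinearMap.mkContinuous₂ (LinearMap.mk₂ ℝ (sobMulFun B)
    (fun f f' g => sobolev_ext (sobPair_add_left B _ _ f f' g))
    (fun c f g => sobolev_ext (sobPair_smul_left B _ _ c f g))
    (fun f g g' => sobolev_ext (sobPair_add_right B _ _ f g g'))
    (fun c f g => sobolev_ext (sobPair_smul_right B _ _ c f g))) (20 * ‖B‖) (norm_sobMulFun_le B)

theorem norm_sobMul_apply_le (f : SobolevH 2 E) : ‖sobMul B f‖ ≤ 20 * ‖B‖ * ‖f‖ :=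
  ContinuousLinearMap.opNorm_le_bound _ (by positivity) (norm_sobMulFun_le B f)

end Product

/-! ### Fourier coefficients and the energy identity -/

theorem norm_fourier_apply (n : ℤ) (x : UnitAddCircle) : ‖(fourier n x : ℂ)‖ = 1 := by
  rw [fourier_apply]; exact Circle.norm_coe _

/-- The Fourier coefficients of a real square integrable function. -/
def fourierL (n : ℤ) : L2T ℝ →L[ℝ] ℂ :=
  LinearMap.mkContinuous
    { toFun := fun w => ∫ x, w x • fourier (-n) x
      map_add' := fun f g => by
        have hi : ∀ f : L2T ℝ, Integrable fun x => f x • (fourier (-n) x : ℂ) := fun f =>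
          (integrable_L2T f).smul_bdd 1 (fourier (-n)).continuous.aestronglyMeasurable
            (Eventually.of_forall fun x => (norm_fourier_apply _ x).le)
        rw [← integral_add (hi f) (hi g)]
        refine integral_congr_ae ?_
        filter_upwards [Lp.coeFn_add f g] with x hx
        rw [hx, Pi.add_apply, add_smul]
      map_smul' := fun c f => by
        rw [RingHom.id_apply, ← integral_smul]
        refine integral_congr_ae ?_
        filter_upwards [Lp.coeFn_smul c f] with x hx
        rw [hx, Pi.smul_apply, smul_assoc] }
    1 (fun w => by
      change ‖∫ x, w x • fourier (-n) x‖ ≤ _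
      rw [one_mul]
      refine le_trans ?_ (integral_norm_le_norm w)
      refine norm_integral_le_of_norm_le (integrable_L2T w).norm (Eventually.of_forall fun x => ?_)
      rw [norm_smul, norm_fourier_apply, mul_one])

theorem fourierL_apply (n : ℤ) (w : L2T ℝ) : fourierL n w = ∫ x, w x • fourier (-n) x := rfl

theorem re_mul_fourierL (n : ℤ) (c : ℂ) (w : L2T ℝ) :
    (c * fourierL n w).re = ∫ x, (c * fourier (-n) x).re • w x := by
  have hi : Integrable fun x => c * (w x • (fourier (-n) x : ℂ)) :=
    ((integrable_L2T w).smul_bdd 1 (fourier (-n)).continuous.aestronglyMeasurable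
      (Eventually.of_forall fun x => (norm_fourier_apply _ x).le)).const_mul c
  rw [fourierL_apply, ← integral_const_mul]
  have := integral_re hi
  refine Eq.trans this.symm (integral_congr_ae (Eventually.of_forall fun x => ?_))
  simp only [RCLike.re_to_complex, Complex.real_smul, smul_eq_mul]
  rw [mul_left_comm, Complex.re_ofReal_mul, mul_comm]

/-- Weak differentiation multiplies the `n`-th Fourier coefficient by `2πin`. -/
theorem HasWeakDeriv.fourierL {w v : L2T ℝ} (h : HasWeakDeriv w v) (n : ℤ) :
    fourierL n v = 2 * Real.pi * Complex.I * n * fourierL n w := by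
  have key : ∀ c : ℂ, (c * _root_.fourierL n v).re =
      (c * (2 * Real.pi * Complex.I * n * _root_.fourierL n w)).re := by
    intro c
    obtain ⟨hs, hd⟩ := smooth_fourier (-n) c
    have h1 := h _ hs
    simp only [hd] at h1
    rw [← re_mul_fourierL, ← re_mul_fourierL] at h1
    have h2 := neg_eq_iff_eq_neg.2 h1
    rw [← neg_eq_iff_eq_neg.2 h1, ← Complex.neg_re]
    congr 1
    push_cast
    ring
  refine Complex.ext (by simpa using key 1) ?_
  have := key (-Complex.I)
  simpa using this

/-- Parseval's identity for real functions on the circle. -/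
theorem hasSum_fourierL_sq (w : L2T ℝ) : HasSum (fun n => ‖fourierL n w‖ ^ 2) (‖w‖ ^ 2) := by
  have hvol : (volume : Measure UnitAddCircle) = AddCircle.haarAddCircle := by
    rw [AddCircle.volume_eq_smul_haarAddCircle]; simp
  have hm : MemLp (fun x => (w x : ℂ)) 2 (AddCircle.haarAddCircle (T := 1)) := by
    rw [← hvol]; exact (Lp.memLp w).ofReal
  have h := hasSum_sq_fourierCoeff (T := 1) hm.toLp
  have e1 : ∀ n, fourierCoeff (hm.toLp) n = fourierL n w := by
    intro n
    rw [fourierCoeff_congr_ae hm.coeFn_toLp, fourierCoeff, fourierL_apply, ← hvol]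
    refine integral_congr_ae (Eventually.of_forall fun x => ?_)
    simp [mul_comm]
  have e2 : ∫ t, ‖(hm.toLp : AddCircle (1 : ℝ) → ℂ) t‖ ^ 2 ∂AddCircle.haarAddCircle = ‖w‖ ^ 2 := by
    have e3 : ∫ t, ‖(hm.toLp : AddCircle (1 : ℝ) → ℂ) t‖ ^ 2 ∂AddCircle.haarAddCircle =
        ∫ t, ‖(w t : ℂ)‖ ^ 2 ∂AddCircle.haarAddCircle := by
      refine integral_congr_ae ?_
      filter_upwards [hm.coeFn_toLp] with x hx
      rw [hx]
    rw [e3, ← hvol, ← real_inner_self_eq_norm_sq, L2.inner_def]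
    refine integral_congr_ae (Eventually.of_forall fun x => ?_)
    simp [pow_two]
  simp only [e1] at h
  rwa [e2] at h

theorem inner_eq_polarization {V : Type*} [NormedAddCommGroup V] [InnerProductSpace ℝ V] (v w : V) :
    inner ℝ v w = (‖v + w‖ ^ 2 - ‖v - w‖ ^ 2) / 4 := by
  rw [norm_add_sq_real, norm_sub_sq_real]; ring

/-- Parseval's identity for inner products. -/
theorem hasSum_inner_fourierL (v w : L2T ℝ) :
    HasSum (fun n => inner ℝ (fourierL n v) (fourierL n w)) (inner ℝ v w) := by
  have h := ((hasSum_fourierL_sq (v + w)).sub (hasSum_fourierL_sq (v - w))).div_const 4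
  simp only [map_add, map_sub, ← inner_eq_polarization] at h
  exact h

/-- The energy identity: if `w` is a primitive in time of `g ∈ L²(L²)` and `z ∈ L²(L²)` is the second
derivative of `w` in space, then `‖∂ₓw‖²` is absolutely continuous with derivative `-2⟨g, z⟩`. Each
Fourier coefficient obeys the product rule, and the sum over the modes is Parseval's identity. -/
theorem norm_sq_sub_eq_integral {a b : ℝ} (hab : a ≤ b) {w g z : ℝ → L2T ℝ} {va vb : L2T ℝ}
    (hg : MemLp g 2 (volume.restrict (Icc a b))) (hz : MemLp z 2 (volume.restrict (Icc a b)))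
    (hw : ∀ t ∈ Icc a b, w t = w a + ∫ r in a..t, g r)
    (hwz : ∀ᵐ r ∂(volume.restrict (Icc a b)), ∃ v, HasWeakDeriv (w r) v ∧ HasWeakDeriv v (z r))
    (hva : HasWeakDeriv (w a) va) (hvb : HasWeakDeriv (w b) vb) :
    ‖vb‖ ^ 2 - ‖va‖ ^ 2 = -2 * ∫ r in Icc a b, inner ℝ (g r) (z r) := by
  have hgi : IntervalIntegrable g volume a b := by
    rw [intervalIntegrable_iff_integrableOn_Icc_of_le hab]
    exact hg.integrable (by norm_num)
  have hmode : ∀ n : ℤ, ‖fourierL n vb‖ ^ 2 - ‖fourierL n va‖ ^ 2 =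
      ∫ r in Icc a b, -2 * inner ℝ (fourierL n (g r)) (fourierL n (z r)) := by
    intro n
    obtain ⟨q, hqdef⟩ : ∃ q : ℂ, q = 2 * Real.pi * Complex.I * n := ⟨_, rfl⟩
    have hq : q * q = ((-(‖q‖ ^ 2) : ℝ) : ℂ) := by
      have e : ‖q‖ = 2 * Real.pi * |(n : ℝ)| := by
        rw [hqdef]; simp [abs_of_pos Real.pi_pos]
      rw [e, mul_pow, sq_abs, hqdef]
      push_cast
      linear_combination (4 * (Real.pi : ℂ) ^ 2 * (n : ℂ) ^ 2) * Complex.I_mul_I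
    have hP : ∀ t ∈ Icc a b, fourierL n (w t) = fourierL n (w a) +
        ∫ r in a..t, fourierL n (g r) := by
      intro t ht
      rw [hw t ht, map_add, ← (fourierL n).intervalIntegral_comp_comm
        (intervalIntegrable_sub_Icc hgi le_rfl ht.1 ht.2)]
    have hi : IntervalIntegrable (fun r => fourierL n (g r)) volume a b := by
      rw [intervalIntegrable_iff_integrableOn_Icc_of_le hab] at hgi ⊢
      exact (fourierL n).integrable_comp hgi
    have h1 := bilin_sub_eq_integral (innerSL ℝ (E := ℂ)) hab hi hi hP hP
    simp only [innerSL_apply_apply ℝ] at h1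
    rw [real_inner_self_eq_norm_sq, real_inner_self_eq_norm_sq] at h1
    rw [hva.fourierL, hvb.fourierL, ← hqdef, norm_mul, norm_mul, mul_pow, mul_pow, ← mul_sub, h1,
      intervalIntegral.integral_of_le hab, ← integral_Icc_eq_integral_Ioc, ← integral_const_mul]
    refine integral_congr_ae ?_
    filter_upwards [hwz] with r hr
    obtain ⟨v, hv1, hv2⟩ := hr
    rw [hv2.fourierL, hv1.fourierL, ← hqdef, ← mul_assoc, hq, ← Complex.real_smul,
      inner_smul_right, real_inner_comm (fourierL n (g r))]
    ring
  have hsum := (hasSum_fourierL_sq vb).sub (hasSum_fourierL_sq va)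
  simp only [hmode] at hsum
  refine hsum.unique ?_
  rw [← integral_const_mul]
  have hmeas : ∀ n (f : ℝ → L2T ℝ), AEStronglyMeasurable f (volume.restrict (Icc a b)) →
      AEStronglyMeasurable (fun r => fourierL n (f r)) (volume.restrict (Icc a b)) :=
    fun n f hf => (fourierL n).continuous.comp_aestronglyMeasurable hf
  have hbs : ∀ r, HasSum (fun n => ‖fourierL n (g r)‖ ^ 2 + ‖fourierL n (z r)‖ ^ 2)
      (‖g r‖ ^ 2 + ‖z r‖ ^ 2) := fun r => (hasSum_fourierL_sq _).add (hasSum_fourierL_sq _)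
  refine hasSum_integral_of_dominated_convergence
    (fun n r => ‖fourierL n (g r)‖ ^ 2 + ‖fourierL n (z r)‖ ^ 2) (fun n => ?_) (fun n => ?_) ?_ ?_ ?_
  · exact ((hmeas n g hg.1).inner (hmeas n z hz.1)).const_mul _
  · refine Eventually.of_forall fun r => ?_
    rw [norm_mul]
    have h1 := norm_inner_le_norm (𝕜 := ℝ) (fourierL n (g r)) (fourierL n (z r))
    have h2 := two_mul_le_add_sq ‖fourierL n (g r)‖ ‖fourierL n (z r)‖
    have h3 : ‖(-2 : ℝ)‖ = 2 := by norm_num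
    rw [h3]
    linarith
  · exact Eventually.of_forall fun r => (hbs r).summable
  · simp only [fun r => (hbs r).tsum_eq]
    exact hg.norm.integrable_sq.add hz.norm.integrable_sq
  · exact Eventually.of_forall fun r => (hasSum_inner_fourierL _ _).mul_left _

/-! ### Variation seminorms -/

section Variation

variable {E : Type*} [NormedAddCommGroup E]

theorem enorm_rpow_le_variationPow (q : ℝ) {s t : ℝ} (hst : s ≤ t) (G : ℝ → ℝ → E) :
    ‖G s t‖ₑ ^ q ≤ variationPow q s t G := by
  let τ : ℕ → ℝ := fun i => if i = 0 then s else t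
  have hτ : Monotone τ := by
    intro i j hij
    by_cases hi : i = 0
    · by_cases hj : j = 0 <;> simp [τ, hi, hj, hst]
    · have hj : j ≠ 0 := by omega
      simp [τ, hi, hj]
  have h : ∑ i ∈ Finset.range 1, ‖G (τ i) (τ (i + 1))‖ₑ ^ q ≤ variationPow q s t G :=
    le_iSup_of_le 1 (le_iSup_of_le τ (le_iSup_of_le hτ (le_iSup_of_le (by simp [τ])
      (le_iSup_of_le (by simp [τ]) le_rfl))))
  simpa [τ] using h

/-- The supremum over partitions as a single bounded supremum. -/
theorem variationPow_eq_biSup (q s t : ℝ) (G : ℝ → ℝ → E) :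
    variationPow q s t G = ⨆ (x : ℕ × (ℕ → ℝ)) (_ : Monotone x.2 ∧ x.2 0 = s ∧ x.2 x.1 = t),
      ∑ i ∈ Finset.range x.1, ‖G (x.2 i) (x.2 (i + 1))‖ₑ ^ q := by
  unfold variationPow
  rw [iSup_prod]
  simp only [iSup_and]

theorem exists_partition {s t : ℝ} (hst : s ≤ t) :
    ∃ x : ℕ × (ℕ → ℝ), Monotone x.2 ∧ x.2 0 = s ∧ x.2 x.1 = t := by
  refine ⟨(1, fun i => if i = 0 then s else t), fun i j hij => ?_, by simp, by simp⟩
  by_cases hi : i = 0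
  · by_cases hj : j = 0 <;> simp [hi, hj, hst]
  · have hj : j ≠ 0 := by omega
    simp [hi, hj]

/-- The `q`-th power of the `q`-variation is superadditive: partitions are concatenated. -/
theorem variationPow_add_le (q : ℝ) {s r t : ℝ} (hsr : s ≤ r) (hrt : r ≤ t) (G : ℝ → ℝ → E) :
    variationPow q s r G + variationPow q r t G ≤ variationPow q s t G := by
  rw [variationPow_eq_biSup q s r, variationPow_eq_biSup q r t]
  refine ENNReal.biSup_add_biSup_le' (exists_partition hsr) (exists_partition hrt) ?_
  rintro ⟨n, σ⟩ ⟨hσ, hσ0, hσn⟩ ⟨m, τ⟩ ⟨hτ, hτ0, hτm⟩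
  simp only at hσ hσ0 hσn hτ hτ0 hτm
  let ρ : ℕ → ℝ := fun i => if i ≤ n then σ i else τ (i - n)
  have hρ : Monotone ρ := by
    refine monotone_nat_of_le_succ fun i => ?_
    by_cases h1 : i + 1 ≤ n
    · have h2 : i ≤ n := by omega
      simp only [ρ, h1, h2, if_true]
      exact hσ (by omega)
    · by_cases h2 : i ≤ n
      · have : i = n := by omega
        subst this
        simp only [ρ, le_refl, if_true, h1, if_false, hσn, ← hτ0]
        exact hτ (by omega)
      · simp only [ρ, h1, h2, if_false]
        exact hτ (by omega)
  have hsum : ∑ i ∈ Finset.range (n + m), ‖G (ρ i) (ρ (i + 1))‖ₑ ^ q =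
      ∑ i ∈ Finset.range n, ‖G (σ i) (σ (i + 1))‖ₑ ^ q +
        ∑ i ∈ Finset.range m, ‖G (τ i) (τ (i + 1))‖ₑ ^ q := by
    rw [Finset.sum_range_add]
    congr 1
    · refine Finset.sum_congr rfl fun i hi => ?_
      rw [Finset.mem_range] at hi
      simp only [ρ, hi.le, show i + 1 ≤ n by omega, if_true]
    · refine Finset.sum_congr rfl fun i _ => ?_
      have e2 : ρ (n + i + 1) = τ (i + 1) := by
        simp only [ρ, show ¬ n + i + 1 ≤ n by omega, if_false]
        congr 1; omega
      have e1 : ρ (n + i) = τ i := by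
        by_cases hi : i = 0
        · subst hi; simp [ρ, hσn, hτ0]
        · simp only [ρ, show ¬ n + i ≤ n by omega, if_false]
          congr 1; omega
      rw [e1, e2]
  simp only
  rw [← hsum]
  refine le_iSup_of_le (n + m) (le_iSup_of_le ρ (le_iSup_of_le hρ (le_iSup_of_le ?_
      (le_iSup_of_le ?_ le_rfl))))
  · simp [ρ, hσ0]
  · by_cases hm : m = 0
    · subst hm; simp only [ρ, add_zero, le_refl, if_true]; rw [hσn, ← hτ0, hτm]
    · simp only [ρ, show ¬ n + m ≤ n by omega, if_false]
      rw [← hτm]; congr 1; omega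

theorem variationPow_le_of_sum_le {q s t : ℝ} {G : ℝ → ℝ → E} {M : ℝ≥0∞}
    (h : ∀ (n : ℕ) (τ : ℕ → ℝ), Monotone τ → τ 0 = s → τ n = t →
      ∑ i ∈ Finset.range n, ‖G (τ i) (τ (i + 1))‖ₑ ^ q ≤ M) : variationPow q s t G ≤ M :=
  iSup_le fun n => iSup_le fun τ => iSup_le fun hτ => iSup_le fun h0 => iSup_le fun hn =>
    h n τ hτ h0 hn

theorem sum_le_of_superadditive {a b : ℝ} {w : ℝ → ℝ → ℝ} (hw : IsSuperadditive a b w) {n : ℕ}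
    {τ : ℕ → ℝ} (hτ : Monotone τ) (ha : a ≤ τ 0) (hb : τ n ≤ b) :
    ∑ i ∈ Finset.range n, w (τ i) (τ (i + 1)) ≤ w (τ 0) (τ n) := by
  induction n with
  | zero => simpa using hw.nonneg _ _ ha le_rfl hb
  | succ n ih =>
    rw [Finset.sum_range_succ]
    have h1 := ih ((hτ n.le_succ).trans hb)
    have h2 := hw.add_le (τ 0) (τ n) (τ (n + 1)) ha (hτ (Nat.zero_le _)) (hτ n.le_succ) hb
    linarith

/-- A bound by a superadditive function controls the variation seminorm. -/
theorem variationPow_le_of_norm_le {q a b s t : ℝ} (hq : 0 < q) {w : ℝ → ℝ → ℝ}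
    (hw : IsSuperadditive a b w) {G : ℝ → ℝ → E}
    (hG : ∀ s t, a ≤ s → s ≤ t → t ≤ b → ‖G s t‖ ≤ w s t ^ (1 / q)) (has : a ≤ s)
    (htb : t ≤ b) : variationPow q s t G ≤ ENNReal.ofReal (w s t) := by
  refine variationPow_le_of_sum_le fun n τ hτ h0 hn => ?_
  have hle : ∀ i ∈ Finset.range n, ‖G (τ i) (τ (i + 1))‖ₑ ^ q ≤
      ENNReal.ofReal (w (τ i) (τ (i + 1))) := by
    intro i hi
    rw [Finset.mem_range] at hi
    have h1 : a ≤ τ i := by rw [← h0] at has; exact has.trans (hτ (Nat.zero_le _))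
    have h2 : τ (i + 1) ≤ b := by rw [← hn] at htb; exact (hτ (by omega)).trans htb
    have h3 := hw.nonneg _ _ h1 (hτ i.le_succ) h2
    rw [← ofReal_norm, ENNReal.ofReal_rpow_of_nonneg (norm_nonneg _) hq.le]
    refine ENNReal.ofReal_le_ofReal ?_
    calc ‖G (τ i) (τ (i + 1))‖ ^ q ≤ (w (τ i) (τ (i + 1)) ^ (1 / q)) ^ q :=
          Real.rpow_le_rpow (norm_nonneg _) (hG _ _ h1 (hτ i.le_succ) h2) hq.le
      _ = _ := by rw [← Real.rpow_mul h3, one_div_mul_cancel hq.ne', Real.rpow_one]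
  refine (Finset.sum_le_sum hle).trans ?_
  have hnn : ∀ i ∈ Finset.range n, 0 ≤ w (τ i) (τ (i + 1)) := by
    intro i hi
    rw [Finset.mem_range] at hi
    refine hw.nonneg _ _ ?_ (hτ i.le_succ) ?_
    · rw [← h0] at has; exact has.trans (hτ (Nat.zero_le _))
    · rw [← hn] at htb; exact (hτ (by omega)).trans htb
  rw [← ENNReal.ofReal_sum_of_nonneg hnn]
  refine ENNReal.ofReal_le_ofReal ?_
  have := sum_le_of_superadditive hw hτ (h0.symm ▸ has) (hn.symm ▸ htb)
  rwa [h0, hn] at this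

theorem IsControl.isSuperadditive {a b : ℝ} {w : ℝ → ℝ → ℝ} (h : IsControl a b w) :
    IsSuperadditive a b w := ⟨h.nonneg, h.superadditive⟩

/-- A control is uniformly small on short intervals: it is continuous on a compact set and vanishes on
the diagonal. -/
theorem IsControl.exists_small {a b : ℝ} {w : ℝ → ℝ → ℝ} (h : IsControl a b w) {ε : ℝ}
    (hε : 0 < ε) : ∃ δ > 0, ∀ s t, a ≤ s → s ≤ t → t ≤ b → t - s < δ → w s t ≤ ε := by
  have hcl : IsClosed (simplex2 a b) :=
    (isClosed_le continuous_const continuous_fst).inter ((isClosed_le continuous_fst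
      continuous_snd).inter (isClosed_le continuous_snd continuous_const))
  have hK : IsCompact (simplex2 a b) := by
    refine (isCompact_Icc.prod isCompact_Icc : IsCompact (Icc a b ×ˢ Icc a b)).of_isClosed_subset
      hcl fun z hz => ⟨⟨hz.1, hz.2.1.trans hz.2.2⟩, hz.1.trans hz.2.1, hz.2.2⟩
  have hu := hK.uniformContinuousOn_of_continuous h.continuousOn
  rw [Metric.uniformContinuousOn_iff] at hu
  obtain ⟨δ, hδ, hu⟩ := hu ε hε
  refine ⟨δ, hδ, fun s t has hst htb hd => ?_⟩
  have hd' : dist ((s, t) : ℝ × ℝ) (s, s) < δ := by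
    rw [Prod.dist_eq, dist_self, Real.dist_eq, abs_of_nonneg (by linarith)]
    exact max_lt hδ hd
  have := hu (s, t) ⟨has, hst, htb⟩ (s, s) ⟨has, le_rfl, hst.trans htb⟩ hd'
  rw [Real.dist_eq] at this
  simp only [h.diag s ⟨has, hst.trans htb⟩, sub_zero] at this
  exact (le_abs_self _).trans this.le

end Variation

/-! ### The control of a rough driver -/

section Driver

variable {p T : ℝ} {k : ℕ} {G GG : ℝ → ℝ → SobolevH k LR3}

/-- There is a continuous control dominating the control of the driver. -/
theorem exists_control_ge_driverControl (hp : 2 ≤ p) (hG : MemV2 p 0 T G)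
    (hGG : MemV2 (p / 2) 0 T GG) : ∃ w, IsControl 0 T w ∧ ∀ s t, 0 ≤ s → s ≤ t → t ≤ T →
      driverControl p G GG s t ≤ ENNReal.ofReal (w s t) := by
  obtain ⟨-, -, w₁, hw₁, h₁⟩ := hG
  obtain ⟨-, -, w₂, hw₂, h₂⟩ := hGG
  refine ⟨fun s t => w₁ s t + w₂ s t + w₁ s t ^ 2, ⟨?_, ?_, ?_, ?_⟩, ?_⟩
  · exact (hw₁.continuousOn.add hw₂.continuousOn).add (hw₁.continuousOn.pow 2)
  · intro s t h1 h2 h3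
    have := hw₁.nonneg s t h1 h2 h3
    have := hw₂.nonneg s t h1 h2 h3
    positivity
  · intro t ht
    simp [hw₁.diag t ht, hw₂.diag t ht]
  · intro s r t h1 h2 h3 h4
    have e1 := hw₁.superadditive s r t h1 h2 h3 h4
    have e2 := hw₂.superadditive s r t h1 h2 h3 h4
    have n1 := hw₁.nonneg s r h1 h2 (h3.trans h4)
    have n2 := hw₁.nonneg r t (h1.trans h2) h3 h4
    nlinarith [mul_nonneg n1 n2]
  · intro s t h1 h2 h3
    have n1 := hw₁.nonneg s t h1 h2 h3
    have n2 := hw₂.nonneg s t h1 h2 h3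
    have e1 := variationPow_le_of_norm_le (by linarith) hw₁.isSuperadditive h₁ h1 h3
    have e2 := variationPow_le_of_norm_le (by linarith) hw₂.isSuperadditive h₂ h1 h3
    rw [ENNReal.ofReal_add (by positivity) (by positivity), ENNReal.ofReal_add n1 n2,
      ENNReal.ofReal_pow n1]
    unfold driverControl
    gcongr

/-- The control of the driver as a real function. The control is finite on the intervals in `[0, T]`
by `driverControl_ne_top`, so that no information is lost there. -/
def driverSize (p : ℝ) {k : ℕ} (G GG : ℝ → ℝ → SobolevH k LR3) (s t : ℝ) : ℝ :=
  (driverControl p G GG s t).toReal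

/-- The control of a driver is finite. -/
theorem driverControl_ne_top (hp : 2 ≤ p) (hG : MemV2 p 0 T G) (hGG : MemV2 (p / 2) 0 T GG)
    {s t : ℝ} (h1 : 0 ≤ s) (h2 : s ≤ t) (h3 : t ≤ T) : driverControl p G GG s t ≠ ⊤ := by
  obtain ⟨w, -, hw⟩ := exists_control_ge_driverControl hp hG hGG
  exact ((hw s t h1 h2 h3).trans_lt ENNReal.ofReal_lt_top).ne

theorem driverControl_add_le {s r t : ℝ} (hsr : s ≤ r) (hrt : r ≤ t) :
    driverControl p G GG s r + driverControl p G GG r t ≤ driverControl p G GG s t := by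
  unfold driverControl
  have h1 := variationPow_add_le p hsr hrt G
  have h2 := variationPow_add_le (p / 2) hsr hrt GG
  calc _ = (variationPow p s r G + variationPow p r t G) +
        (variationPow (p / 2) s r GG + variationPow (p / 2) r t GG) +
        (variationPow p s r G ^ 2 + variationPow p r t G ^ 2) := by ring
    _ ≤ (variationPow p s r G + variationPow p r t G) +
        (variationPow (p / 2) s r GG + variationPow (p / 2) r t GG) +
        (variationPow p s r G + variationPow p r t G) ^ 2 := by
        gcongr
        calc _ ≤ variationPow p s r G ^ 2 + variationPow p r t G ^ 2 +
              2 * variationPow p s r G * variationPow p r t G := le_self_add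
          _ = _ := by ring
    _ ≤ _ := by gcongr

theorem isSuperadditive_driverSize (hp : 2 ≤ p) (hG : MemV2 p 0 T G)
    (hGG : MemV2 (p / 2) 0 T GG) : IsSuperadditive 0 T (driverSize p G GG) := by
  refine ⟨fun s t _ _ _ => ENNReal.toReal_nonneg, fun s r t h1 h2 h3 h4 => ?_⟩
  unfold driverSize
  rw [← ENNReal.toReal_add (driverControl_ne_top hp hG hGG h1 h2 (h3.trans h4))
    (driverControl_ne_top hp hG hGG (h1.trans h2) h3 h4)]
  exact ENNReal.toReal_mono (driverControl_ne_top hp hG hGG h1 (h2.trans h3) h4)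
    (driverControl_add_le h2 h3)

theorem exists_driverSize_small (hp : 2 ≤ p) (hG : MemV2 p 0 T G) (hGG : MemV2 (p / 2) 0 T GG)
    {ε : ℝ} (hε : 0 < ε) :
    ∃ δ > 0, ∀ s t, 0 ≤ s → s ≤ t → t ≤ T → t - s < δ → driverSize p G GG s t ≤ ε := by
  obtain ⟨w, hwc, hw⟩ := exists_control_ge_driverControl hp hG hGG
  obtain ⟨δ, hδ, h⟩ := hwc.exists_small hε
  refine ⟨δ, hδ, fun s t h1 h2 h3 h4 => ?_⟩
  exact (ENNReal.toReal_le_of_le_ofReal (hwc.nonneg s t h1 h2 h3) (hw s t h1 h2 h3)).trans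
    (h s t h1 h2 h3 h4)

theorem norm_le_rpow_of_enorm_rpow_le {E : Type*} [NormedAddCommGroup E] {x : E} {q : ℝ}
    (hq : 0 < q) {M : ℝ≥0∞} (hM : M ≠ ⊤) (h : ‖x‖ₑ ^ q ≤ M) : ‖x‖ ≤ M.toReal ^ (1 / q) := by
  have h1 := ENNReal.toReal_mono hM h
  rw [← ENNReal.toReal_rpow, toReal_enorm] at h1
  calc ‖x‖ = (‖x‖ ^ q) ^ (1 / q) := by
        rw [← Real.rpow_mul (norm_nonneg _), mul_one_div_cancel hq.ne', Real.rpow_one]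
    _ ≤ _ := Real.rpow_le_rpow (by positivity) h1 (by positivity)

theorem norm_fst_le_driverSize (hp : 2 ≤ p) (hG : MemV2 p 0 T G) (hGG : MemV2 (p / 2) 0 T GG)
    {s t : ℝ} (h1 : 0 ≤ s) (h2 : s ≤ t) (h3 : t ≤ T) :
    ‖G s t‖ ≤ driverSize p G GG s t ^ (1 / p) :=
  norm_le_rpow_of_enorm_rpow_le (by linarith) (driverControl_ne_top hp hG hGG h1 h2 h3)
    ((enorm_rpow_le_variationPow p h2 G).trans (le_self_add.trans le_self_add))

theorem norm_snd_le_driverSize (hp : 2 ≤ p) (hG : MemV2 p 0 T G) (hGG : MemV2 (p / 2) 0 T GG)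
    {s t : ℝ} (h1 : 0 ≤ s) (h2 : s ≤ t) (h3 : t ≤ T) :
    ‖GG s t‖ ≤ driverSize p G GG s t ^ (2 / p) := by
  have := norm_le_rpow_of_enorm_rpow_le (x := GG s t) (q := p / 2) (by linarith)
    (driverControl_ne_top hp hG hGG h1 h2 h3)
    ((enorm_rpow_le_variationPow (p / 2) h2 GG).trans (le_add_self.trans le_self_add))
  rwa [one_div_div] at this

/-! ### Geometricity -/

/-- A continuous relation which holds almost everywhere for each pair of vectors holds almost everywhere
for all pairs: it suffices to check a countable dense set. -/
theorem ae_forall_of_continuous {q : UnitAddCircle → R3 → R3 → ℝ}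
    (hq : ∀ x, Continuous fun z : R3 × R3 => q x z.1 z.2) (h : ∀ a b, ∀ᵐ x, q x a b = 0) :
    ∀ᵐ x, ∀ a b, q x a b = 0 := by
  have h1 : ∀ᵐ x, ∀ i j : ℕ, q x (TopologicalSpace.denseSeq R3 i) (TopologicalSpace.denseSeq R3 j) = 0 :=
    ae_all_iff.2 fun i => ae_all_iff.2 fun j => h _ _
  filter_upwards [h1] with x hx a b
  have hd := (TopologicalSpace.denseRange_denseSeq R3).prodMap (TopologicalSpace.denseRange_denseSeq R3)
  have := (hq x).ext_on hd (continuous_const (y := (0 : ℝ))) (by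
    rintro _ ⟨⟨i, j⟩, rfl⟩; exact hx i j)
  exact congrFun this (a, b)

/-- Evaluation of matrix fields at a vector. -/
def evalLp (a : R3) : L2T LR3 →L[ℝ] L2T R3 :=
  (ContinuousLinearMap.apply ℝ R3 a).compLpL 2 (volume : Measure UnitAddCircle)

theorem evalLp_coe (a : R3) (f : L2T LR3) : evalLp a f =ᵐ[volume] fun x => f x a :=
  ContinuousLinearMap.coeFn_compLp _ f

/-- The functional `M ↦ ⟨M a, b⟩ + ⟨a, M b⟩`. -/
def symForm (a b : R3) : LR3 →L[ℝ] ℝ :=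
  (innerSL ℝ b).comp (ContinuousLinearMap.apply ℝ R3 a) +
    (innerSL ℝ a).comp (ContinuousLinearMap.apply ℝ R3 b)

theorem symForm_apply (a b : R3) (M : LR3) :
    symForm a b M = inner ℝ (M a) b + inner ℝ a (M b) := by
  rw [real_inner_comm]; rfl

/-- The pointwise inner product of square integrable vector fields, an integrable function. -/
def innerL1 : L2T R3 →L[ℝ] L2T R3 →L[ℝ] Lp ℝ 1 (volume : Measure UnitAddCircle) :=
  (innerSL ℝ (E := R3)).holderL (volume : Measure UnitAddCircle) 2 2 1

theorem innerL1_coe (f g : L2T R3) : innerL1 f g =ᵐ[volume] fun x => inner ℝ (f x) (g x) :=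
  (innerSL ℝ (E := R3)).coeFn_holder (r := 1) f g

/-- The pointwise composition of square integrable matrix fields, an integrable function. -/
def compL1 : L2T LR3 →L[ℝ] L2T LR3 →L[ℝ] Lp LR3 1 (volume : Measure UnitAddCircle) :=
  (ContinuousLinearMap.compL ℝ R3 R3 R3).holderL (volume : Measure UnitAddCircle) 2 2 1

theorem compL1_coe (f g : L2T LR3) : compL1 f g =ᵐ[volume] fun x => (f x).comp (g x) :=
  (ContinuousLinearMap.compL ℝ R3 R3 R3).coeFn_holder (r := 1) f g

/-- For anti-symmetric `γ`, the symmetric part of `γ δ` is a product-rule expression in `γ` and `δ`. -/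
theorem symForm_compL1 (a b : R3) {γ δ : L2T LR3} (hγ : ∀ᵐ x, IsSkewMap (γ x)) :
    (symForm a b).compLpL 1 (volume : Measure UnitAddCircle) (compL1 γ δ) =
      -(innerL1 (evalLp a γ) (evalLp b δ) + innerL1 (evalLp a δ) (evalLp b γ)) := by
  refine Lp.ext ?_
  have k1 := (symForm a b).coeFn_compLpL (p := 1) (compL1 γ δ)
  have k2 := compL1_coe γ δ
  have k3 := Lp.coeFn_neg (innerL1 (evalLp a γ) (evalLp b δ) + innerL1 (evalLp a δ) (evalLp b γ))
  have k4 := Lp.coeFn_add (innerL1 (evalLp a γ) (evalLp b δ)) (innerL1 (evalLp a δ) (evalLp b γ))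
  have k5 := innerL1_coe (evalLp a γ) (evalLp b δ)
  have k6 := innerL1_coe (evalLp a δ) (evalLp b γ)
  filter_upwards [k1, k2, k3, k4, k5, k6, evalLp_coe a γ, evalLp_coe b γ, evalLp_coe a δ,
    evalLp_coe b δ, hγ] with x h1 h2 h3 h4 h5 h6 h7 h8 h9 h10 h11
  rw [h3, Pi.neg_apply, h4, Pi.add_apply, h5, h6, h7, h8, h9, h10, h1, h2, symForm_apply]
  have e1 := h11 (δ x a) b
  have e2 := h11 a (δ x b)
  simp only [ContinuousLinearMap.comp_apply]
  rw [e1, e2]; ring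

/-- The derivative of a smooth anti-symmetric path is anti-symmetric. -/
theorem isSkewMap_derivWithin {T : ℝ} (hT : 0 < T) {Γ : ℝ → L2T LR3}
    (hΓ : ContDiffOn ℝ ∞ Γ (Icc 0 T)) (hskew : ∀ t ∈ Icc 0 T, ∀ᵐ x, IsSkewMap (Γ t x)) {r : ℝ}
    (hr : r ∈ Icc 0 T) : ∀ᵐ x, IsSkewMap (derivWithin Γ (Icc 0 T) r x) := by
  have key : ∀ a b : R3, ∀ᵐ x, inner ℝ (derivWithin Γ (Icc 0 T) r x a) b +
      inner ℝ a (derivWithin Γ (Icc 0 T) r x b) = 0 := by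
    intro a b
    let ℓ := symForm a b
    have hℓ := symForm_apply a b
    let S := ℓ.compLpL 2 (volume : Measure UnitAddCircle)
    have hS : ∀ t ∈ Icc 0 T, S (Γ t) = 0 := by
      intro t ht
      refine Lp.ext ?_
      filter_upwards [ℓ.coeFn_compLpL (p := 2) (Γ t), hskew t ht,
        Lp.coeFn_zero ℝ 2 (volume : Measure UnitAddCircle)] with x h1 h2 h3
      rw [h1, h3, hℓ, h2 a b]; simp
    have hd : HasDerivWithinAt Γ (derivWithin Γ (Icc 0 T) r) (Icc 0 T) r :=
      ((hΓ.differentiableOn (by simp)) r hr).hasDerivWithinAt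
    have h1 : HasDerivWithinAt (fun t => S (Γ t)) (S (derivWithin Γ (Icc 0 T) r)) (Icc 0 T) r :=
      S.hasFDerivAt.comp_hasDerivWithinAt r hd
    have h2 : HasDerivWithinAt (fun t => S (Γ t)) 0 (Icc 0 T) r :=
      (hasDerivWithinAt_const r (Icc 0 T) (0 : L2T ℝ)).congr hS (hS r hr)
    have h3 := (uniqueDiffOn_Icc hT r hr).eq_deriv _ h1 h2
    filter_upwards [ℓ.coeFn_compLpL (p := 2) (derivWithin Γ (Icc 0 T) r),
      Lp.coeFn_zero ℝ 2 (volume : Measure UnitAddCircle)] with x h4 h5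
    rw [← hℓ, ← h4]
    change S (derivWithin Γ (Icc 0 T) r) x = 0
    rw [h3, h5]; rfl
  have := ae_forall_of_continuous (q := fun x a b => inner ℝ (derivWithin Γ (Icc 0 T) r x a) b +
      inner ℝ a (derivWithin Γ (Icc 0 T) r x b)) (fun x => by fun_prop) key
  filter_upwards [this] with x hx a b
  exact eq_neg_of_add_eq_zero_left (hx a b)

/-- The product formula for the paths `(Γ - Γ s) a` and `(Γ - Γ s) b`. -/
theorem innerL1_increment_eq_integral {s t : ℝ} (hst : s ≤ t) {Δ γ : ℝ → L2T LR3}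
    (hγi : IntervalIntegrable γ volume s t) (hΔ : ∀ r ∈ Icc s t, Δ r = Δ s + ∫ ρ in s..r, γ ρ)
    (hΔs : Δ s = 0) (a b : R3) : innerL1 (evalLp a (Δ t)) (evalLp b (Δ t)) =
      ∫ r in s..t, (innerL1 (evalLp a (γ r)) (evalLp b (Δ r)) +
        innerL1 (evalLp a (Δ r)) (evalLp b (γ r))) := by
  have hi : ∀ a : R3, IntervalIntegrable (fun r => evalLp a (γ r)) volume s t := by
    intro a
    rw [intervalIntegrable_iff_integrableOn_Icc_of_le hst] at hγi ⊢
    exact (evalLp a).integrable_comp hγi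
  have hP : ∀ a : R3, ∀ r ∈ Icc s t, evalLp a (Δ r) = evalLp a (Δ s) +
      ∫ ρ in s..r, evalLp a (γ ρ) := by
    intro a r hr
    rw [hΔ r hr, map_add, ← (evalLp a).intervalIntegral_comp_comm
        (intervalIntegrable_sub_Icc hγi le_rfl hr.1 hr.2)]
  have h := bilin_sub_eq_integral innerL1 hst (hi a) (hi b) (hP a) (hP b)
  rw [hΔs, map_zero (evalLp a), map_zero (evalLp b), map_zero (innerL1 0), sub_zero] at h
  exact h

/-- The symmetric part of the iterated integral `∫ dΔ Δ` is given by the square of the increment. -/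
theorem symForm_integral_compL1 {s t : ℝ} (hst : s ≤ t) {Δ γ : ℝ → L2T LR3}
    (hγc : ContinuousOn γ (Icc s t)) (hΔ : ∀ r ∈ Icc s t, Δ r = Δ s + ∫ ρ in s..r, γ ρ)
    (hΔs : Δ s = 0) (hskew : ∀ r ∈ Icc s t, ∀ᵐ x, IsSkewMap (γ r x)) (a b : R3) :
    (symForm a b).compLpL 1 volume (∫ r in s..t, compL1 (γ r) (Δ r)) =
      -innerL1 (evalLp a (Δ t)) (evalLp b (Δ t)) := by
  have hγi : IntervalIntegrable γ volume s t := hγc.intervalIntegrable_of_Icc hst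
  have hΔc := continuousOn_of_integral_form hst hγi hΔ
  have hHc : ContinuousOn (fun r => compL1 (γ r) (Δ r)) (Icc s t) :=
    (compL1.continuous.comp_continuousOn hγc).clm_apply hΔc
  rw [innerL1_increment_eq_integral hst hγi hΔ hΔs,
    ← ((symForm a b).compLpL 1 volume).intervalIntegral_comp_comm
    (hHc.intervalIntegrable_of_Icc hst), ← intervalIntegral.integral_neg]
  refine intervalIntegral.integral_congr fun r hr => ?_
  rw [uIcc_of_le hst] at hr
  exact symForm_compL1 a b (hskew r hr)

/-- For the lift of a smooth anti-symmetric path, the symmetric part of the second level is half the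
square of the first level, by the product formula in time. -/
theorem IsSmoothRoughDriver.symmetric_part {T p : ℝ} (hT : 0 < T) {Γ : ℝ → L2T LR3}
    {Λ : ℝ → ℝ → L2T LR3} (h : IsSmoothRoughDriver T p Γ Λ)
    (hskew : ∀ t ∈ Icc 0 T, ∀ᵐ x, IsSkewMap (Γ t x)) {s t : ℝ} (hs : 0 ≤ s) (hst : s ≤ t)
    (ht : t ≤ T) : ∀ᵐ x, ∀ a b : R3, inner ℝ (Λ s t x a) b + inner ℝ a (Λ s t x b) +
      inner ℝ (increment Γ s t x a) (increment Γ s t x b) = 0 := by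
  have hsub : Icc s t ⊆ Icc 0 T := Icc_subset_Icc hs ht
  have hγc : ContinuousOn (derivWithin Γ (Icc 0 T)) (Icc s t) :=
    (h.smooth.continuousOn_derivWithin (uniqueDiffOn_Icc hT) (by simp)).mono hsub
  have hγi := hγc.intervalIntegrable_of_Icc (μ := volume) hst
  have hΓc : ContinuousOn Γ (Icc s t) := h.smooth.continuousOn.mono hsub
  have hftc : ∀ r ∈ Icc s t, Γ r - Γ s = (Γ s - Γ s) +
      ∫ ρ in s..r, derivWithin Γ (Icc 0 T) ρ := by
    intro r hr
    rw [sub_self, zero_add]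
    symm
    refine intervalIntegral.integral_eq_sub_of_hasDerivAt_of_le hr.1
      (hΓc.mono (Icc_subset_Icc le_rfl hr.2)) (fun ρ hρ => ?_)
      (intervalIntegrable_sub_Icc hγi le_rfl hr.1 hr.2)
    have hρ' : Icc 0 T ∈ 𝓝 ρ := Icc_mem_nhds (hs.trans_lt hρ.1) (hρ.2.trans_le (hr.2.trans ht))
    have hmem : ρ ∈ Icc 0 T := mem_of_mem_nhds hρ'
    exact (((h.smooth.differentiableOn (by simp)) ρ hmem).hasDerivWithinAt).hasDerivAt hρ'
  have hlift : Λ s t =ᵐ[volume] (∫ r in s..t, compL1 (derivWithin Γ (Icc 0 T) r) (Γ r - Γ s) :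
      Lp LR3 1 (volume : Measure UnitAddCircle)) := h.lift s t hs hst ht
  refine ae_forall_of_continuous (q := fun x a b => inner ℝ (Λ s t x a) b +
      inner ℝ a (Λ s t x b) + inner ℝ (increment Γ s t x a) (increment Γ s t x b))
      (fun x => ?_) fun a b => ?_
  · have c : ∀ M : LR3, Continuous fun z : R3 × R3 => M z.1 := fun M =>
      M.continuous.comp continuous_fst
    have c' : ∀ M : LR3, Continuous fun z : R3 × R3 => M z.2 := fun M =>
      M.continuous.comp continuous_snd
    exact (((c _).inner continuous_snd).add (continuous_fst.inner (c' _))).add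
      ((c _).inner (c' _))
  have hSint := symForm_integral_compL1 hst (Δ := fun r => Γ r - Γ s) hγc hftc (sub_self _)
    (fun r hr => isSkewMap_derivWithin hT h.smooth hskew (hsub hr)) a b
  have k2 := (symForm a b).coeFn_compLpL (p := 1)
    (∫ r in s..t, compL1 (derivWithin Γ (Icc 0 T) r) (Γ r - Γ s))
  rw [hSint] at k2
  have k3 := Lp.coeFn_neg (innerL1 (evalLp a (Γ t - Γ s)) (evalLp b (Γ t - Γ s)))
  filter_upwards [hlift, k2, k3, innerL1_coe (evalLp a (Γ t - Γ s)) (evalLp b (Γ t - Γ s)),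
    evalLp_coe a (Γ t - Γ s), evalLp_coe b (Γ t - Γ s)] with x h1 h2 h3 h4 h5 h6
  rw [h3, Pi.neg_apply, h4, h5, h6, symForm_apply] at h2
  rw [h1, ← h2]
  exact neg_add_cancel _

/-- Convergence in the variation seminorm implies convergence at every pair of times. -/
theorem tendsto_of_variationNorm {E : Type*} [NormedAddCommGroup E] {q T : ℝ} (hq : 0 < q)
    {H : ℕ → ℝ → ℝ → E} (h : Tendsto (fun n => variationNorm q 0 T (H n)) atTop (𝓝 0)) {s t : ℝ}
    (hs : 0 ≤ s) (hst : s ≤ t) (ht : t ≤ T) : Tendsto (fun n => H n s t) atTop (𝓝 0) := by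
  rw [tendsto_zero_iff_norm_tendsto_zero]
  have h1 : Tendsto (fun n => ‖H n s t‖ₑ) atTop (𝓝 0) := by
    refine tendsto_of_tendsto_of_tendsto_of_le_of_le tendsto_const_nhds h (fun _ => zero_le) ?_
    intro n
    unfold variationNorm
    have h2 : ‖H n s t‖ₑ ^ q ≤ variationPow q 0 T (H n) :=
      calc _ ≤ variationPow q s t (H n) := enorm_rpow_le_variationPow q hst (H n)
        _ ≤ variationPow q 0 s (H n) + variationPow q s t (H n) := le_add_self
        _ ≤ variationPow q 0 t (H n) := variationPow_add_le _ hs hst _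
        _ ≤ variationPow q 0 t (H n) + variationPow q t T (H n) := le_self_add
        _ ≤ _ := variationPow_add_le _ (hs.trans hst) ht _
    calc ‖H n s t‖ₑ = (‖H n s t‖ₑ ^ q) ^ (1 / q) := by
          rw [← ENNReal.rpow_mul, mul_one_div_cancel hq.ne', ENNReal.rpow_one]
      _ ≤ _ := ENNReal.rpow_le_rpow h2 (by positivity)
  have h2 := (ENNReal.tendsto_toReal ENNReal.zero_ne_top).comp h1
  refine h2.congr fun n => ?_
  simp

/-- In a geometric anti-symmetric rough driver the symmetric part of the second level is half the
square of the first level. -/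
theorem IsAntisymmRoughDriver.symmetric_part (hp : 2 ≤ p) (hT : 0 < T)
    (h : IsAntisymmRoughDriver T p k G GG) {s t : ℝ} (hs : 0 ≤ s) (hst : s ≤ t) (ht : t ≤ T) :
    ∀ᵐ x, ∀ a b : R3, inner ℝ (sobolevFn (GG s t) x a) b + inner ℝ a (sobolevFn (GG s t) x b) +
      inner ℝ (sobolevFn (G s t) x a) (sobolevFn (G s t) x b) = 0 := by
  obtain ⟨Γ, Λ, hΓ, hskew, h1, h2⟩ := h.geometric
  have l1 := (tendsto_of_variationNorm (by linarith) h1 hs hst ht).add_const (sobolevFn (G s t))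
  have l2 := (tendsto_of_variationNorm (by linarith) h2 hs hst ht).add_const (sobolevFn (GG s t))
  simp only [sub_add_cancel, zero_add] at l1 l2
  have m1 := tendstoInMeasure_of_tendsto_Lp l1
  obtain ⟨ns, hns, hae1⟩ := m1.exists_seq_tendsto_ae
  have m2 := tendstoInMeasure_of_tendsto_Lp (l2.comp hns.tendsto_atTop)
  obtain ⟨ms, hms, hae2⟩ := m2.exists_seq_tendsto_ae
  have hall : ∀ᵐ x, ∀ n, ∀ a b : R3, inner ℝ (Λ n s t x a) b + inner ℝ a (Λ n s t x b) +
      inner ℝ (increment (Γ n) s t x a) (increment (Γ n) s t x b) = 0 :=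
    ae_all_iff.2 fun n => (hΓ n).symmetric_part hT (hskew n) hs hst ht
  filter_upwards [hall, hae1, hae2] with x hx t1 t2 a b
  have t1' := t1.comp hms.tendsto_atTop
  have c1 : ∀ v : R3, Tendsto (fun n => increment (Γ (ns (ms n))) s t x v) atTop
      (𝓝 (sobolevFn (G s t) x v)) := fun v =>
    ((ContinuousLinearMap.apply ℝ R3 v).continuous.tendsto _).comp t1'
  have c2 : ∀ v : R3, Tendsto (fun n => Λ (ns (ms n)) s t x v) atTop
      (𝓝 (sobolevFn (GG s t) x v)) := fun v =>
    ((ContinuousLinearMap.apply ℝ R3 v).continuous.tendsto _).comp t2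
  have := (((c2 a).inner (𝕜 := ℝ) (tendsto_const_nhds (x := b))).add
    ((tendsto_const_nhds (x := a)).inner (𝕜 := ℝ) (c2 b))).add ((c1 a).inner (𝕜 := ℝ) (c1 b))
  refine tendsto_nhds_unique this ?_
  exact tendsto_const_nhds.congr fun n => (hx _ a b).symm

end Driver

/-! ### The gauge -/

/-- Evaluation of linear maps as a bilinear map. -/
abbrev evalB : LR3 →L[ℝ] R3 →L[ℝ] R3 := ContinuousLinearMap.id ℝ LR3

/-- The space `H²(𝕋; ℝ³)` as a type with its own normed space structure, which keeps instance
unification away from its construction as a submodule. -/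
def H2Field : Type := SobolevH 2 R3

instance : NormedAddCommGroup H2Field := inferInstanceAs (NormedAddCommGroup (SobolevH 2 R3))

instance : InnerProductSpace ℝ H2Field := inferInstanceAs (InnerProductSpace ℝ (SobolevH 2 R3))

instance : CompleteSpace H2Field := completeSpace_sobolevH (k := 2) (E := R3)

/-- An element of `H²(𝕋; ℝ³)` as an element of the Sobolev space. -/
def H2Field.toSob (φ : H2Field) : SobolevH 2 R3 := φ

/-- The vector field underlying an element of `H²(𝕋; ℝ³)`. -/
def H2Field.fn (φ : H2Field) : L2T R3 := sobolevFn φ.toSob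

theorem H2Field.norm_toSob (φ : H2Field) : ‖φ.toSob‖ = ‖φ‖ := rfl

theorem H2Field.ext_fn {φ ψ : H2Field} (h : φ.fn = ψ.fn) : φ = ψ :=
  sobolev_ext (f := φ.toSob) (g := ψ.toSob) h

theorem H2Field.fn_add (φ ψ : H2Field) : (φ + ψ).fn = φ.fn + ψ.fn := rfl

/-- Multiplication by an element of `H²(𝕋; ℒ(ℝ³))` as an operator on `H²`. -/
@[irreducible]
def mulH (f : SobolevH 2 LR3) : H2Field →L[ℝ] H2Field := sobMul evalB f

/-- Multiplication by an element of `H²(𝕋; ℒ(ℝ³))` as an operator on `L²`. -/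
@[irreducible]
def mulL (f : SobolevH 2 LR3) : L2T R3 →L[ℝ] L2T R3 := sobPairL evalB (0 : Fin 2) f

/-- The pointwise inner product of an element of `H²` with a square integrable vector field. -/
@[irreducible]
def sobDot : H2Field →L[ℝ] L2T R3 →L[ℝ] L2T ℝ :=
  (sobPairL (innerSL ℝ) (0 : Fin 2) : SobolevH 2 R3 →L[ℝ] L2T R3 →L[ℝ] L2T ℝ)

/-- One step `1 + G + GG` of the flow of the driver, acting on `H²`. -/
def driverStep (G GG : ℝ → ℝ → SobolevH 2 LR3) (s t : ℝ) : H2Field →L[ℝ] H2Field :=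
  1 + mulH (G s t) + mulH (GG s t)

/-- One step `1 + G + GG` of the flow of the driver, acting on `L²`. -/
def driverAct (G GG : ℝ → ℝ → SobolevH 2 LR3) (s t : ℝ) : L2T R3 →L[ℝ] L2T R3 :=
  1 + mulL (G s t) + mulL (GG s t)

theorem norm_evalB_le : ‖evalB‖ ≤ 1 := ContinuousLinearMap.norm_id_le

theorem mulH_add (f g : SobolevH 2 LR3) : mulH (f + g) = mulH f + mulH g := by
  unfold mulH
  exact map_add (sobMul evalB) f g

theorem mulH_zero : mulH 0 = 0 := by
  have := mulH_add 0 0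
  rwa [add_zero, left_eq_add] at this

theorem norm_mulH_le (f : SobolevH 2 LR3) : ‖mulH f‖ ≤ 20 * ‖f‖ := by
  have h1 := norm_sobMul_apply_le evalB f
  have h2 : 20 * ‖evalB‖ * ‖f‖ ≤ 20 * ‖f‖ := by
    have := norm_evalB_le
    gcongr
    linarith
  unfold mulH
  exact h1.trans h2

theorem norm_mulL_le (f : SobolevH 2 LR3) (v : L2T R3) : ‖mulL f v‖ ≤ 2 * ‖f‖ * ‖v‖ := by
  unfold mulL
  refine (norm_sobPairL_apply_le evalB (0 : Fin 2) f v).trans ?_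
  have := norm_evalB_le
  gcongr
  linarith

theorem norm_sobDot_le (φ : H2Field) (v : L2T R3) : ‖sobDot φ v‖ ≤ 2 * ‖φ‖ * ‖v‖ := by
  unfold sobDot
  refine (norm_sobPairL_apply_le (innerSL ℝ) (0 : Fin 2) φ.toSob v).trans ?_
  have : ‖(innerSL ℝ : R3 →L[ℝ] R3 →L[ℝ] ℝ)‖ ≤ 1 := norm_innerSL_le ℝ
  rw [H2Field.norm_toSob]
  gcongr
  linarith

theorem sobDot_coe (φ : H2Field) (v : L2T R3) :
    sobDot φ v =ᵐ[volume] fun x => inner ℝ (φ.fn x) (v x) := by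
  unfold sobDot
  exact sobPairL_coe (innerSL ℝ) (0 : Fin 2) φ.toSob v

theorem mulL_coe (f : SobolevH 2 LR3) (v : L2T R3) :
    mulL f v =ᵐ[volume] fun x => sobolevFn f x (v x) := by
  unfold mulL
  exact sobPairL_coe evalB (0 : Fin 2) f v

theorem fn_mulH (f : SobolevH 2 LR3) (φ : H2Field) : (mulH f φ).fn = mulL f φ.fn := by
  unfold mulH mulL
  rfl

theorem driverStep_apply (G GG : ℝ → ℝ → SobolevH 2 LR3) (s t : ℝ) (φ : H2Field) :
    driverStep G GG s t φ = φ + mulH (G s t) φ + mulH (GG s t) φ := rfl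

theorem driverAct_apply (G GG : ℝ → ℝ → SobolevH 2 LR3) (s t : ℝ) (v : L2T R3) :
    driverAct G GG s t v = v + mulL (G s t) v + mulL (GG s t) v := rfl

theorem fn_driverStep (G GG : ℝ → ℝ → SobolevH 2 LR3) (s t : ℝ) (φ : H2Field) :
    (driverStep G GG s t φ).fn = driverAct G GG s t φ.fn := by
  rw [driverStep_apply, driverAct_apply, H2Field.fn_add, H2Field.fn_add, fn_mulH, fn_mulH]

section Gauge

variable {p T : ℝ} {G GG : ℝ → ℝ → SobolevH 2 LR3}

/-- Pointwise Chen relations are relations of multiplication operators. -/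
theorem mulL_eq_of_chen {f f₁ f₂ g₁ g₂ : SobolevH 2 LR3}
    (h : ∀ᵐ x, sobolevFn f x - sobolevFn f₁ x - sobolevFn f₂ x =
      (sobolevFn g₂ x).comp (sobolevFn g₁ x)) (v : L2T R3) :
    mulL f v = mulL f₁ v + mulL f₂ v + mulL g₂ (mulL g₁ v) := by
  have e1 := mulL_coe f v
  have e2 := mulL_coe f₁ v
  have e3 := mulL_coe f₂ v
  have e4 := mulL_coe g₁ v
  have e5 := mulL_coe g₂ (mulL g₁ v)
  generalize mulL f v = y at e1 ⊢
  generalize mulL f₁ v = y₁ at e2 ⊢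
  generalize mulL f₂ v = y₂ at e3 ⊢
  generalize mulL g₁ v = z at e4 e5 ⊢
  generalize mulL g₂ z = z' at e5 ⊢
  refine Lp.ext ?_
  filter_upwards [e1, e2, e3, e4, e5, Lp.coeFn_add (y₁ + y₂) z', Lp.coeFn_add y₁ y₂, h]
    with x k1 k2 k3 k4 k5 k6 k7 k8
  have k9 := congrArg (fun A : LR3 => A (v x)) k8
  rw [sub_apply, sub_apply, ContinuousLinearMap.comp_apply] at k9
  rw [k6, Pi.add_apply, k7, Pi.add_apply, k1, k2, k3, k5, k4, ← k9]
  abel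

/-- Chen's relation for the multiplication operators on `H²`. -/
theorem IsAntisymmRoughDriver.chen_mulH (h : IsAntisymmRoughDriver T p 2 G GG) {s r t : ℝ}
    (h1 : 0 ≤ s) (h2 : s ≤ r) (h3 : r ≤ t) (h4 : t ≤ T) :
    mulH (GG s t) = mulH (GG s r) + mulH (GG r t) + mulH (G r t) * mulH (G s r) := by
  ext1 φ
  refine H2Field.ext_fn ?_
  have e : (mulH (GG s r) + mulH (GG r t) + mulH (G r t) * mulH (G s r)) φ =
      mulH (GG s r) φ + mulH (GG r t) φ + mulH (G r t) (mulH (G s r) φ) := rfl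
  rw [e, H2Field.fn_add, H2Field.fn_add, fn_mulH, fn_mulH, fn_mulH, fn_mulH, fn_mulH]
  exact mulL_eq_of_chen (h.driver.chen s r t h1 h2 h3 h4) _

theorem IsAntisymmRoughDriver.fst_add (h : IsAntisymmRoughDriver T p 2 G GG) {s r t : ℝ}
    (h1 : 0 ≤ s) (h2 : s ≤ r) (h3 : r ≤ t) (h4 : t ≤ T) : G s t = G s r + G r t := by
  have e := h.driver.additive s r t h1 h2 h3 h4
  have e' : sobolevFn (G s t) = sobolevFn (G s r) + sobolevFn (G r t) := by
    rw [sub_sub, sub_eq_zero] at e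
    exact e
  exact sobolev_ext e'

/-- The constants of the sewing lemma exist for every exponent greater than one. -/
theorem exists_sewing_constants {θ C : ℝ} (hθ : 1 < θ) (hC : 0 ≤ C) :
    ∃ η L : ℝ, 0 < η ∧ η ≤ 1 ∧ 0 ≤ L ∧
      2 * (1 / 2) ^ θ * (1 + 2 * η) ^ 2 * L + C * (2 + η) ≤ L := by
  set l : ℝ := 2 * (1 / 2) ^ θ with hl
  have hl1 : l < 1 := by
    have : (1 / 2 : ℝ) ^ θ < (1 / 2) ^ (1 : ℝ) :=
      Real.rpow_lt_rpow_of_exponent_gt (by norm_num) (by norm_num) hθ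
    rw [Real.rpow_one] at this
    rw [hl]; linarith
  have hl0 : 0 < l := by positivity
  have hη0 : 0 < (1 - l) / 16 := by linarith
  have hη1 : (1 - l) / 16 ≤ 1 := by linarith
  have hL0 : 0 ≤ 6 * C / (1 - l) := div_nonneg (by linarith) (by linarith)
  refine ⟨(1 - l) / 16, 6 * C / (1 - l), hη0, hη1, hL0, ?_⟩
  set η := (1 - l) / 16 with hη
  set L := 6 * C / (1 - l) with hL
  have h1 : l * (1 + 2 * η) ^ 2 ≤ (1 + l) / 2 := by
    have : l * (1 + 2 * η) ^ 2 ≤ l + 8 * η := by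
      have i1 : (1 + 2 * η) ^ 2 ≤ 1 + 8 * η := by nlinarith
      have i2 : l * (1 + 2 * η) ^ 2 ≤ l * (1 + 8 * η) := by gcongr
      nlinarith
    rw [hη] at this ⊢; linarith
  have h2 : (1 - l) / 2 * L = 3 * C := by
    rw [hL]; field_simp [show (1 - l) ≠ 0 by linarith]; ring
  nlinarith [mul_le_mul_of_nonneg_right h1 hL0]

/-- The comparisons of powers of a number `w ≤ 1` that are needed for a driver of size `w`. -/
theorem rpow_bounds (hp : 2 ≤ p) {w : ℝ} (h0 : 0 ≤ w) (h1 : w ≤ 1) :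
    w ^ (2 / p) ≤ w ^ (1 / p) ∧ w ^ (3 / p) ≤ w ^ (1 / p) ∧
      w ^ (1 / p) * w ^ (2 / p) = w ^ (3 / p) ∧ w ^ (2 / p) * w ^ (2 / p) ≤ w ^ (3 / p) ∧
      w ^ (1 / p) ≤ 1 := by
  have hp0 : 0 < p := by linarith
  have i1 : (0 : ℝ) ≤ 1 / p := by positivity
  have key : ∀ x y : ℝ, 0 ≤ x → x ≤ y → w ^ y ≤ w ^ x := by
    intro x y hx hxy
    rcases h0.eq_or_lt with rfl | hw
    · rcases hx.eq_or_lt with rfl | hx'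
      · rw [Real.rpow_zero]; exact Real.zero_rpow_le_one y
      · rw [Real.zero_rpow (by linarith), Real.zero_rpow (by linarith)]
    · exact Real.rpow_le_rpow_of_exponent_ge hw h1 hxy
  refine ⟨key _ _ i1 (by gcongr; norm_num), key _ _ i1 (by gcongr; norm_num), ?_, ?_,
    Real.rpow_le_one h0 h1 i1⟩
  · rw [← Real.rpow_add_of_nonneg h0 (by positivity) (by positivity)]; congr 1; ring
  · rw [← Real.rpow_add_of_nonneg h0 (by positivity) (by positivity)]
    refine key _ _ (by positivity) ?_
    rw [← add_div]; gcongr; norm_num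

/-- One step of the flow is close to the identity. -/
theorem norm_driverStep_sub_one_le (hp : 2 ≤ p) (h : IsAntisymmRoughDriver T p 2 G GG) {s t : ℝ}
    (h1 : 0 ≤ s) (h2 : s ≤ t) (h3 : t ≤ T) (hw : driverSize p G GG s t ≤ 1) :
    ‖driverStep G GG s t - 1‖ ≤ 40 * driverSize p G GG s t ^ (1 / p) := by
  have hG := norm_fst_le_driverSize hp h.memV_fst h.memV_snd h1 h2 h3
  have hGG := norm_snd_le_driverSize hp h.memV_fst h.memV_snd h1 h2 h3
  obtain ⟨b1, -⟩ := rpow_bounds hp ((isSuperadditive_driverSize hp h.memV_fst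
    h.memV_snd).nonneg s t h1 h2 h3) hw
  have e : driverStep G GG s t - 1 = mulH (G s t) + mulH (GG s t) := by
    unfold driverStep; rw [add_assoc, add_sub_cancel_left]
  rw [e]
  have := norm_add_le (mulH (G s t)) (mulH (GG s t))
  have := norm_mulH_le (G s t)
  have := norm_mulH_le (GG s t)
  linarith

/-- The defect of multiplicativity of `1 + g + a` under Chen's relation. -/
theorem step_defect_eq {R : Type*} [Ring R] (g₁ g₂ a₁ a₂ : R) :
    (1 + g₂ + a₂) * (1 + g₁ + a₁) - (1 + (g₁ + g₂) + (a₁ + a₂ + g₂ * g₁)) =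
      g₂ * a₁ + a₂ * g₁ + a₂ * a₁ := by
  noncomm_ring

/-- By Chen's relation, the steps of the flow are multiplicative up to an error of order `ω^{3/p}`, and
`3 / p > 1`. -/
theorem norm_driverStep_defect_le (hp : 2 ≤ p) (h : IsAntisymmRoughDriver T p 2 G GG) {s r t : ℝ}
    (h1 : 0 ≤ s) (h2 : s ≤ r) (h3 : r ≤ t) (h4 : t ≤ T) (hw : driverSize p G GG s t ≤ 1) :
    ‖driverStep G GG r t * driverStep G GG s r - driverStep G GG s t‖ ≤
      1200 * driverSize p G GG s t ^ (3 / p) := by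
  have hsup := isSuperadditive_driverSize hp h.memV_fst h.memV_snd
  have hw0 := hsup.nonneg s t h1 (h2.trans h3) h4
  have m1 := hsup.mono h1 le_rfl h2 h3 h4
  have m2 := hsup.mono h1 h2 h3 le_rfl h4
  have n1 := hsup.nonneg s r h1 h2 (h3.trans h4)
  have n2 := hsup.nonneg r t (h1.trans h2) h3 h4
  obtain ⟨-, -, b3, b4, -⟩ := rpow_bounds hp hw0 hw
  set W := driverSize p G GG s t
  have p0 : 0 ≤ W ^ (1 / p) := Real.rpow_nonneg hw0 _
  have q0 : 0 ≤ W ^ (2 / p) := Real.rpow_nonneg hw0 _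
  have i1 : (0 : ℝ) ≤ 1 / p := by positivity
  have i2 : (0 : ℝ) ≤ 2 / p := by positivity
  have g1 : ‖G s r‖ ≤ W ^ (1 / p) := (norm_fst_le_driverSize hp h.memV_fst h.memV_snd h1 h2
    (h3.trans h4)).trans (Real.rpow_le_rpow n1 m1 i1)
  have g2 : ‖G r t‖ ≤ W ^ (1 / p) := (norm_fst_le_driverSize hp h.memV_fst h.memV_snd
    (h1.trans h2) h3 h4).trans (Real.rpow_le_rpow n2 m2 i1)
  have gg1 : ‖GG s r‖ ≤ W ^ (2 / p) := (norm_snd_le_driverSize hp h.memV_fst h.memV_snd h1 h2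
    (h3.trans h4)).trans (Real.rpow_le_rpow n1 m1 i2)
  have gg2 : ‖GG r t‖ ≤ W ^ (2 / p) := (norm_snd_le_driverSize hp h.memV_fst h.memV_snd
    (h1.trans h2) h3 h4).trans (Real.rpow_le_rpow n2 m2 i2)
  have e : driverStep G GG r t * driverStep G GG s r - driverStep G GG s t =
      mulH (G r t) * mulH (GG s r) + mulH (GG r t) * mulH (G s r) +
        mulH (GG r t) * mulH (GG s r) := by
    unfold driverStep
    rw [h.chen_mulH h1 h2 h3 h4, h.fst_add h1 h2 h3 h4, mulH_add]
    exact step_defect_eq _ _ _ _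
  have hmul : ∀ {f g : SobolevH 2 LR3} {x y : ℝ}, 0 ≤ x → ‖f‖ ≤ x → ‖g‖ ≤ y →
      ‖mulH f * mulH g‖ ≤ 400 * (x * y) := by
    intro f g x y hx hf hg
    calc _ ≤ ‖mulH f‖ * ‖mulH g‖ := norm_mul_le _ _
      _ ≤ (20 * x) * (20 * y) := by
          gcongr
          · exact (norm_mulH_le f).trans (by linarith)
          · exact (norm_mulH_le g).trans (by linarith)
      _ = _ := by ring
  rw [e]
  have t1 := hmul p0 g2 gg1
  have t2 := hmul q0 gg2 g1
  have t3 := hmul q0 gg2 gg1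
  have := norm_add₃_le (a := mulH (G r t) * mulH (GG s r))
    (b := mulH (GG r t) * mulH (G s r))
    (c := mulH (GG r t) * mulH (GG s r))
  rw [mul_comm (W ^ (2 / p)) (W ^ (1 / p))] at t2
  linarith

/-- Orbits of the flow of the driver in `H²` exist on intervals where the driver is small, with
constants depending only on `p`. -/
theorem exists_driver_orbit (hp2 : 2 ≤ p) (hp3 : p < 3) :
    ∃ ε L : ℝ, 0 < ε ∧ ε ≤ 1 ∧ 0 ≤ L ∧ ∀ (T : ℝ) (G GG : ℝ → ℝ → SobolevH 2 LR3),
      IsAntisymmRoughDriver T p 2 G GG → ∀ a b, 0 ≤ a → a ≤ b → b ≤ T →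
      driverSize p G GG a b ≤ ε → ∀ x₀ : H2Field, ‖x₀‖ ≤ 1 →
      ∃ φ : ℝ → H2Field, φ a = x₀ ∧ (∀ t ∈ Icc a b, ‖φ t‖ ≤ 3) ∧
        ∀ s t, a ≤ s → s ≤ t → t ≤ b →
          ‖φ t - driverStep G GG s t (φ s)‖ ≤ L * driverSize p G GG s t ^ (3 / p) ∧
          ‖φ t - φ s‖ ≤ L * driverSize p G GG s t ^ (1 / p) := by
  have hp0 : 0 < p := by linarith
  have hθ : 1 < 3 / p := by rw [lt_div_iff₀ hp0]; linarith
  obtain ⟨η, L, hη0, hη1, hL, hcoup⟩ := exists_sewing_constants hθ (C := 1200) (by norm_num)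
  set β : ℝ := η / (40 + L) with hβ
  have hβ0 : 0 < β := by positivity
  have hβ1 : β ≤ 1 := by rw [hβ, div_le_one (by positivity)]; linarith
  have hβη : β * (40 + L) = η := by rw [hβ]; field_simp
  have hε1 : β ^ p ≤ 1 := Real.rpow_le_one hβ0.le hβ1 hp0.le
  have hroot : (β ^ p) ^ (1 / p) = β := by
    rw [← Real.rpow_mul hβ0.le, mul_one_div_cancel hp0.ne', Real.rpow_one]
  refine ⟨β ^ p, 3 * L + 120, by positivity, hε1, by positivity, ?_⟩
  intro T G GG h a b ha hab hb hsmall x₀ hx₀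
  have hsup := isSuperadditive_driverSize hp2 h.memV_fst h.memV_snd
  have hle : ∀ s t, a ≤ s → s ≤ t → t ≤ b → driverSize p G GG s t ≤ β ^ p :=
    fun s t h1 h2 h3 => (hsup.mono ha h1 h2 h3 hb).trans hsmall
  have hpow : ∀ s t, a ≤ s → s ≤ t → t ≤ b → driverSize p G GG s t ^ (1 / p) ≤ β := by
    intro s t h1 h2 h3
    rw [← hroot]
    exact Real.rpow_le_rpow (hsup.nonneg s t (ha.trans h1) h2 (h3.trans hb)) (hle s t h1 h2 h3)
      (by positivity)
  have hflow : IsAlmostFlow a b (3 / p) 1200 η L (driverSize p G GG) (driverStep G GG) := by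
    refine ⟨hsup.restrict ha hb, hθ, hη0.le, by norm_num, hL, hcoup, ?_, ?_, ?_, ?_⟩
    · obtain ⟨-, b2, -⟩ := rpow_bounds hp2 (hsup.nonneg a b ha hab hb) (hsmall.trans hε1)
      calc L * driverSize p G GG a b ^ (3 / p) ≤ L * β := by
            gcongr; exact b2.trans (hpow a b le_rfl hab le_rfl)
        _ ≤ η := by rw [← hβη]; nlinarith
    · intro t h1 h2
      have e1 : G t t = 0 := h.memV_fst.2.1 t ⟨ha.trans h1, h2.trans hb⟩
      have e2 : GG t t = 0 := h.memV_snd.2.1 t ⟨ha.trans h1, h2.trans hb⟩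
      unfold driverStep
      rw [e1, e2, mulH_zero, add_zero, add_zero]
    · intro s t h1 h2 h3
      refine (norm_driverStep_sub_one_le hp2 h (ha.trans h1) h2 (h3.trans hb)
        ((hle s t h1 h2 h3).trans hε1)).trans ?_
      have := hpow s t h1 h2 h3
      nlinarith
    · intro s r t h1 h2 h3 h4
      exact norm_driverStep_defect_le hp2 h (ha.trans h1) h2 h3 (h4.trans hb)
        ((hle s t h1 (h2.trans h3) h4).trans hε1)
  obtain ⟨φ, hφa, hφb, hφ⟩ := hflow.exists_orbit hab x₀
  have hx3 : (1 + 2 * η) * ‖x₀‖ ≤ 3 := by nlinarith [norm_nonneg x₀]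
  have hbd : ∀ t ∈ Icc a b, ‖φ t‖ ≤ 3 := fun t ht => (hφb t ht).trans hx3
  refine ⟨φ, hφa, hbd, fun s t h1 h2 h3 => ?_⟩
  have hw0 := hsup.nonneg s t (ha.trans h1) h2 (h3.trans hb)
  have hw1 := (hle s t h1 h2 h3).trans hε1
  obtain ⟨-, b2, -⟩ := rpow_bounds hp2 hw0 hw1
  have d1 : ‖φ t - driverStep G GG s t (φ s)‖ ≤ 3 * L * driverSize p G GG s t ^ (3 / p) := by
    refine (hφ s t h1 h2 h3).trans ?_
    have : 0 ≤ L * driverSize p G GG s t ^ (3 / p) := by positivity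
    nlinarith
  have d2 : ‖driverStep G GG s t (φ s) - φ s‖ ≤ 120 * driverSize p G GG s t ^ (1 / p) := by
    have e : driverStep G GG s t (φ s) - φ s = (driverStep G GG s t - 1) (φ s) := by simp
    rw [e]
    calc _ ≤ ‖driverStep G GG s t - 1‖ * ‖φ s‖ := ContinuousLinearMap.le_opNorm _ _
      _ ≤ (40 * driverSize p G GG s t ^ (1 / p)) * 3 := by
          gcongr
          · exact norm_driverStep_sub_one_le hp2 h (ha.trans h1) h2 (h3.trans hb) hw1
          · exact hbd s ⟨h1, h2.trans h3⟩
      _ = _ := by ring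
  constructor
  · refine d1.trans ?_
    gcongr; linarith
  · have e : φ t - φ s = (φ t - driverStep G GG s t (φ s)) + (driverStep G GG s t (φ s) - φ s) := by
      abel
    rw [e]
    refine (norm_add_le _ _).trans ?_
    have : 3 * L * driverSize p G GG s t ^ (3 / p) ≤ 3 * L * driverSize p G GG s t ^ (1 / p) := by
      gcongr
    linarith

/-- The terms of order less than three in `⟨(1 + g + f) φ, (1 + g + f) v⟩ - ⟨φ, v⟩` vanish if `g` is
anti-symmetric and the symmetric part of `f` is `g² / 2`. -/
theorem sobDot_first_orders_eq_zero {g f : SobolevH 2 LR3}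
    (hg : ∀ᵐ x, IsSkewMap (sobolevFn g x))
    (hf : ∀ᵐ x, ∀ a b : R3, inner ℝ (sobolevFn f x a) b + inner ℝ a (sobolevFn f x b) +
      inner ℝ (sobolevFn g x a) (sobolevFn g x b) = 0) (φ : H2Field) (v : L2T R3) :
    sobDot φ (mulL g v) + sobDot (mulH g φ) v +
      (sobDot φ (mulL f v) + sobDot (mulH f φ) v + sobDot (mulH g φ) (mulL g v)) = 0 := by
  have m1 := mulL_coe g φ.fn
  have m2 := mulL_coe f φ.fn
  rw [← fn_mulH] at m1 m2
  have m3 := mulL_coe g v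
  have m4 := mulL_coe f v
  generalize mulH g φ = a at m1 ⊢
  generalize mulH f φ = A at m2 ⊢
  generalize mulL g v = b at m3 ⊢
  generalize mulL f v = B at m4 ⊢
  have l1 := sobDot_coe φ b
  have l2 := sobDot_coe a v
  have l3 := sobDot_coe φ B
  have l4 := sobDot_coe A v
  have l5 := sobDot_coe a b
  generalize sobDot φ b = y₁ at l1 ⊢
  generalize sobDot a v = y₂ at l2 ⊢
  generalize sobDot φ B = y₃ at l3 ⊢
  generalize sobDot A v = y₄ at l4 ⊢
  generalize sobDot a b = y₅ at l5 ⊢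
  have c1 := Lp.coeFn_add (y₁ + y₂) (y₃ + y₄ + y₅)
  have c2 := Lp.coeFn_add y₁ y₂
  have c3 := Lp.coeFn_add (y₃ + y₄) y₅
  have c4 := Lp.coeFn_add y₃ y₄
  have c5 := Lp.coeFn_zero ℝ 2 (volume : Measure UnitAddCircle)
  refine Lp.ext ?_
  filter_upwards [c1, c2, c3, c4, c5, l1, l2, l3, l4, l5, m1, m2, m3, m4, hg, hf]
    with x c1 c2 c3 c4 c5 l1 l2 l3 l4 l5 m1 m2 m3 m4 hg hf
  rw [c1, Pi.add_apply, c2, Pi.add_apply, c3, Pi.add_apply, c4, Pi.add_apply, c5, l1, l2, l3, l4,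
    l5, m1, m2, m3, m4, Pi.zero_apply]
  have r1 := hg (φ.fn x) (v x)
  have r2 := hf (φ.fn x) (v x)
  linarith

/-- Expansion of a bilinear form at `(φ + a + A, v + b + B)`. -/
theorem bilin_expand {E F H : Type*} [AddCommGroup E] [AddCommGroup F] [AddCommGroup H]
    (D : E → F → H) (hl : ∀ x y z, D (x + y) z = D x z + D y z)
    (hr : ∀ x y z, D x (y + z) = D x y + D x z) (φ a A : E) (v b B : F)
    (key : D φ b + D a v + (D φ B + D A v + D a b) = 0) :
    D (φ + a + A) (v + b + B) - D φ v = D a B + D A b + D A B := by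
  simp only [hl, hr]
  have e : D a B + D A b + D A B = D a B + D A b + D A B +
      (D φ b + D a v + (D φ B + D A v + D a b)) := by rw [key, add_zero]
  rw [e]
  abel

/-- A step of the flow preserves pointwise inner products up to an error of order `ω^{3/p}`: the
first level is anti-symmetric and the second level is geometric. -/
theorem norm_sobDot_driverStep_sub_le (hp : 2 ≤ p) (hT : 0 < T)
    (h : IsAntisymmRoughDriver T p 2 G GG) {s t : ℝ} (h1 : 0 ≤ s) (h2 : s ≤ t) (h3 : t ≤ T)
    (hw : driverSize p G GG s t ≤ 1) (φ : H2Field) (v : L2T R3) :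
    ‖sobDot (driverStep G GG s t φ) (driverAct G GG s t v) - sobDot φ v‖ ≤
      240 * driverSize p G GG s t ^ (3 / p) * ‖φ‖ * ‖v‖ := by
  have hw0 := (isSuperadditive_driverSize hp h.memV_fst h.memV_snd).nonneg s t h1 h2 h3
  have hG := norm_fst_le_driverSize hp h.memV_fst h.memV_snd h1 h2 h3
  have hGG := norm_snd_le_driverSize hp h.memV_fst h.memV_snd h1 h2 h3
  obtain ⟨-, -, b3, b4, -⟩ := rpow_bounds hp hw0 hw
  set W := driverSize p G GG s t
  have p0 : 0 ≤ W ^ (1 / p) := Real.rpow_nonneg hw0 _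
  have q0 : 0 ≤ W ^ (2 / p) := Real.rpow_nonneg hw0 _
  set a := mulH (G s t) φ with ha
  set A := mulH (GG s t) φ with hA
  set b := mulL (G s t) v with hb
  set B := mulL (GG s t) v with hB
  have key : sobDot φ b + sobDot a v + (sobDot φ B + sobDot A v + sobDot a b) = 0 :=
    sobDot_first_orders_eq_zero (h.antisymm s t h1 h2 h3) (h.symmetric_part hp hT h1 h2 h3) φ v
  have e : sobDot (driverStep G GG s t φ) (driverAct G GG s t v) - sobDot φ v =
      sobDot a B + sobDot A b + sobDot A B := by
    rw [driverStep_apply, driverAct_apply]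
    exact bilin_expand (fun x y => sobDot x y) (fun x y z => by rw [map_add, add_apply])
      (fun x y z => map_add _ _ _) φ a A v b B key
  rw [e]
  have na : ‖a‖ ≤ 20 * W ^ (1 / p) * ‖φ‖ := ((mulH (G s t)).le_opNorm φ).trans (by
    gcongr; exact (norm_mulH_le _).trans (by linarith))
  have nA : ‖A‖ ≤ 20 * W ^ (2 / p) * ‖φ‖ := ((mulH (GG s t)).le_opNorm φ).trans (by
    gcongr; exact (norm_mulH_le _).trans (by linarith))
  have nb : ‖b‖ ≤ 2 * W ^ (1 / p) * ‖v‖ := (norm_mulL_le _ v).trans (by gcongr)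
  have nB : ‖B‖ ≤ 2 * W ^ (2 / p) * ‖v‖ := (norm_mulL_le _ v).trans (by gcongr)
  have f1 : ‖sobDot a B‖ ≤ 80 * (W ^ (1 / p) * W ^ (2 / p)) * ‖φ‖ * ‖v‖ :=
    (norm_sobDot_le a B).trans (by
      calc 2 * ‖a‖ * ‖B‖ ≤ 2 * (20 * W ^ (1 / p) * ‖φ‖) * (2 * W ^ (2 / p) * ‖v‖) := by gcongr
        _ = _ := by ring)
  have f2 : ‖sobDot A b‖ ≤ 80 * (W ^ (1 / p) * W ^ (2 / p)) * ‖φ‖ * ‖v‖ :=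
    (norm_sobDot_le A b).trans (by
      calc 2 * ‖A‖ * ‖b‖ ≤ 2 * (20 * W ^ (2 / p) * ‖φ‖) * (2 * W ^ (1 / p) * ‖v‖) := by gcongr
        _ = _ := by ring)
  have f3 : ‖sobDot A B‖ ≤ 80 * W ^ (3 / p) * ‖φ‖ * ‖v‖ :=
    (norm_sobDot_le A B).trans (by
      calc 2 * ‖A‖ * ‖B‖ ≤ 2 * (20 * W ^ (2 / p) * ‖φ‖) * (2 * W ^ (2 / p) * ‖v‖) := by gcongr
        _ = 80 * (W ^ (2 / p) * W ^ (2 / p)) * ‖φ‖ * ‖v‖ := by ring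
        _ ≤ _ := by gcongr)
  rw [b3] at f1 f2
  have := norm_add₃_le (a := sobDot a B) (b := sobDot A b) (c := sobDot A B)
  linarith

/-- The steps of the flow on `L²` are bounded, and close to the identity. -/
theorem norm_driverAct_le (hp : 2 ≤ p) (h : IsAntisymmRoughDriver T p 2 G GG) {s t : ℝ}
    (h1 : 0 ≤ s) (h2 : s ≤ t) (h3 : t ≤ T) (hw : driverSize p G GG s t ≤ 1) (v : L2T R3) :
    ‖driverAct G GG s t v‖ ≤ 5 * ‖v‖ ∧
      ‖driverAct G GG s t v - v‖ ≤ 4 * driverSize p G GG s t ^ (1 / p) * ‖v‖ := by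
  have hw0 := (isSuperadditive_driverSize hp h.memV_fst h.memV_snd).nonneg s t h1 h2 h3
  have hG := norm_fst_le_driverSize hp h.memV_fst h.memV_snd h1 h2 h3
  have hGG := norm_snd_le_driverSize hp h.memV_fst h.memV_snd h1 h2 h3
  obtain ⟨b1, -, -, -, b5⟩ := rpow_bounds hp hw0 hw
  have e : driverAct G GG s t v - v = mulL (G s t) v +
      mulL (GG s t) v := by
    have : driverAct G GG s t v = v + mulL (G s t) v +
      mulL (GG s t) v := rfl
    rw [this]; abel
  have hd : ‖driverAct G GG s t v - v‖ ≤ 4 * driverSize p G GG s t ^ (1 / p) * ‖v‖ := by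
    rw [e]
    refine (norm_add_le _ _).trans ?_
    have n1 := norm_mulL_le (G s t) v
    have n2 := norm_mulL_le (GG s t) v
    have n3 : 2 * ‖G s t‖ * ‖v‖ ≤ 2 * driverSize p G GG s t ^ (1 / p) * ‖v‖ := by gcongr
    have n4 : 2 * ‖GG s t‖ * ‖v‖ ≤ 2 * driverSize p G GG s t ^ (1 / p) * ‖v‖ := by
      gcongr; linarith
    linarith
  refine ⟨?_, hd⟩
  have e2 : driverAct G GG s t v = v + (driverAct G GG s t v - v) := by abel
  rw [e2]
  refine (norm_add_le _ _).trans ?_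
  have : 4 * driverSize p G GG s t ^ (1 / p) * ‖v‖ ≤ 4 * 1 * ‖v‖ := by gcongr
  linarith

/-- Transport along the flow: if `φ` is an orbit and `y` is moved by the flow up to `σ`, then the
pairing `φ · y` changes by `φ · σ` up to an error of order `ω^{3/p}`. -/
theorem norm_sobDot_increment_le (hp : 2 ≤ p) (hT : 0 < T) (h : IsAntisymmRoughDriver T p 2 G GG)
    {s t L : ℝ} (hL : 0 ≤ L) (h1 : 0 ≤ s) (h2 : s ≤ t) (h3 : t ≤ T)
    (hw : driverSize p G GG s t ≤ 1) {φs φt : H2Field} {ys yt : L2T R3} (hφs : ‖φs‖ ≤ 3)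
    (hφ : ‖φt - driverStep G GG s t φs‖ ≤ L * driverSize p G GG s t ^ (3 / p)) :
    ‖sobDot φt yt - sobDot φs ys - sobDot φt (yt - driverAct G GG s t ys)‖ ≤
      (720 + 10 * L) * driverSize p G GG s t ^ (3 / p) * ‖ys‖ := by
  have hw0 := (isSuperadditive_driverSize hp h.memV_fst h.memV_snd).nonneg s t h1 h2 h3
  set W := driverSize p G GG s t
  have r0 : 0 ≤ W ^ (3 / p) := Real.rpow_nonneg hw0 _
  have e : sobDot φt yt - sobDot φs ys - sobDot φt (yt - driverAct G GG s t ys) =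
      (sobDot (driverStep G GG s t φs) (driverAct G GG s t ys) - sobDot φs ys) +
        sobDot (φt - driverStep G GG s t φs) (driverAct G GG s t ys) := by
    simp only [map_sub, sub_apply]; abel
  rw [e]
  have f1 : ‖sobDot (driverStep G GG s t φs) (driverAct G GG s t ys) - sobDot φs ys‖ ≤
      240 * W ^ (3 / p) * 3 * ‖ys‖ :=
    (norm_sobDot_driverStep_sub_le hp hT h h1 h2 h3 hw φs ys).trans (by gcongr)
  have f2 : ‖sobDot (φt - driverStep G GG s t φs) (driverAct G GG s t ys)‖ ≤
      2 * (L * W ^ (3 / p)) * (5 * ‖ys‖) :=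
    (norm_sobDot_le _ _).trans (by
      gcongr
      exact (norm_driverAct_le hp h h1 h2 h3 hw ys).1)
  refine (norm_add_le _ _).trans ?_
  linarith

end Gauge

/-! ### Constant fields and moving frames -/

theorem fn_sub (φ ψ : H2Field) : (φ - ψ).fn = φ.fn - ψ.fn := rfl

theorem norm_fn_le (φ : H2Field) : ‖φ.fn‖ ≤ ‖φ‖ := norm_sobDeriv_le φ.toSob 0

/-- Constant functions have the weak derivative zero. -/
theorem hasWeakDeriv_const {E : Type*} [NormedAddCommGroup E] [NormedSpace ℝ E] [CompleteSpace E]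
    (v : E) : HasWeakDeriv (Lp.const 2 volume v : L2T E) 0 := by
  refine hasWeakDeriv_of_isPrimitive (F := fun _ => v) (G := fun _ => 0)
    (Lp.coeFn_const ..) (Lp.coeFn_zero ..) fun a b => ?_
  simp

/-- The constant field with value `v`. -/
def constField (v : R3) : H2Field :=
  (⟨WithLp.toLp 2 ![Lp.const 2 volume v, 0, 0], by
    intro j
    fin_cases j
    · exact hasWeakDeriv_const v
    · exact HasWeakDeriv.zero⟩ : SobolevH 2 R3)

theorem constField_toSob (v : R3) :
    (constField v).toSob.1 0 = Lp.const 2 volume v ∧ (constField v).toSob.1 1 = 0 ∧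
      (constField v).toSob.1 2 = 0 := ⟨rfl, rfl, rfl⟩

theorem norm_constField (v : R3) : ‖constField v‖ = ‖v‖ := by
  have h : ‖(constField v).toSob.1‖ ^ 2 = ‖v‖ ^ 2 := by
    have e : ‖(Lp.const 2 volume v : L2T R3)‖ = ‖v‖ := by
      refine (Lp.norm_const 2 volume v (by norm_num)).trans ?_
      simp
    rw [PiLp.norm_sq_eq_of_L2, Fin.sum_univ_three, (constField_toSob v).1, (constField_toSob v).2.1,
      (constField_toSob v).2.2, e]
    simp
  exact (pow_left_inj₀ (norm_nonneg _) (norm_nonneg _) two_ne_zero).1 h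

theorem constField_coe (v : R3) : (constField v).fn =ᵐ[volume] fun _ => v :=
  Lp.coeFn_const ..

section Frame

variable {p T : ℝ} {G GG : ℝ → ℝ → SobolevH 2 LR3}

/-- Pairs of orbits of the flow have constant pointwise inner products. -/
theorem sobDot_orbit_const (hp : 2 ≤ p) (hp3 : p < 3) (hT : 0 < T)
    (h : IsAntisymmRoughDriver T p 2 G GG) {a b L : ℝ} (ha : 0 ≤ a) (hb : b ≤ T) (hL : 0 ≤ L)
    (hw : ∀ s t, a ≤ s → s ≤ t → t ≤ b → driverSize p G GG s t ≤ 1) {φ ψ : ℝ → H2Field}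
    (hφ : ∀ t ∈ Icc a b, ‖φ t‖ ≤ 3) (hψ : ∀ t ∈ Icc a b, ‖ψ t‖ ≤ 3)
    (hφs : ∀ s t, a ≤ s → s ≤ t → t ≤ b →
      ‖φ t - driverStep G GG s t (φ s)‖ ≤ L * driverSize p G GG s t ^ (3 / p))
    (hψs : ∀ s t, a ≤ s → s ≤ t → t ≤ b →
      ‖ψ t - driverStep G GG s t (ψ s)‖ ≤ L * driverSize p G GG s t ^ (3 / p)) {t : ℝ}
    (ht : t ∈ Icc a b) : sobDot (φ t) (ψ t).fn = sobDot (φ a) (ψ a).fn := by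
  have hp0 : 0 < p := by linarith
  have hsup := isSuperadditive_driverSize hp h.memV_fst h.memV_snd
  refine sub_eq_zero.1 (additive_eq_zero_of_small ht.1
    (fun s t => sobDot (φ t) (ψ t).fn - sobDot (φ s) (ψ s).fn)
    (driverSize p G GG) (fun s r t _ _ _ _ => by abel)
    (fun s r t h1 h2 h3 h4 => hsup.add_le s r t (ha.trans h1) h2 h3 (h4.trans (ht.2.trans hb))) ?_)
  -- the increments are of order `W ^ (3 / p)`, where `3 / p > 1`
  set C : ℝ := (720 + 10 * L) * 3 + 6 * L with hC
  have hC0 : 0 < C := by positivity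
  have hθ : 0 < 3 / p - 1 := by rw [sub_pos, lt_div_iff₀ hp0]; linarith
  intro ε hε
  obtain ⟨δ, hδ, hsm⟩ := exists_driverSize_small hp h.memV_fst h.memV_snd
    (ε := (ε / C) ^ (1 / (3 / p - 1))) (by positivity)
  refine ⟨δ, hδ, fun s r h1 h2 h3 h4 => ?_⟩
  have h3' : r ≤ b := h3.trans ht.2
  have hw0 := hsup.nonneg s r (ha.trans h1) h2 (h3'.trans hb)
  have hs : s ∈ Icc a b := ⟨h1, h2.trans h3'⟩
  have hr : r ∈ Icc a b := ⟨h1.trans h2, h3'⟩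
  have e1 := norm_sobDot_increment_le hp hT h hL (ha.trans h1) h2 (h3'.trans hb)
    (hw s r h1 h2 h3') (ys := (ψ s).fn) (yt := (ψ r).fn) (hφ s hs) (hφs s r h1 h2 h3')
  have hW := hsm s r (ha.trans h1) h2 (h3'.trans hb) h4
  set W := driverSize p G GG s r
  have r0 : 0 ≤ W ^ (3 / p) := Real.rpow_nonneg hw0 _
  have e2 : ‖sobDot (φ r) ((ψ r).fn - driverAct G GG s r (ψ s).fn)‖ ≤ 6 * L * W ^ (3 / p) := by
    rw [← fn_driverStep, ← fn_sub]
    calc _ ≤ 2 * ‖φ r‖ * ‖(ψ r - driverStep G GG s r (ψ s)).fn‖ := norm_sobDot_le _ _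
      _ ≤ 2 * 3 * (L * W ^ (3 / p)) := by
          gcongr
          · exact hφ r hr
          · exact (norm_fn_le _).trans (hψs s r h1 h2 h3')
      _ = _ := by ring
  have e3 : ‖(ψ s).fn‖ ≤ 3 := (norm_fn_le _).trans (hψ s hs)
  have e4 : ‖sobDot (φ r) (ψ r).fn - sobDot (φ s) (ψ s).fn‖ ≤ C * W ^ (3 / p) := by
    have := norm_le_insert' (sobDot (φ r) (ψ r).fn - sobDot (φ s) (ψ s).fn)
      (sobDot (φ r) ((ψ r).fn - driverAct G GG s r (ψ s).fn))
    have e5 : (720 + 10 * L) * W ^ (3 / p) * ‖(ψ s).fn‖ ≤ (720 + 10 * L) * W ^ (3 / p) * 3 := by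
      gcongr
    rw [hC]
    linarith
  refine e4.trans ?_
  have e6 : W ^ (3 / p) = W ^ (3 / p - 1) * W := by
    rcases hw0.eq_or_lt with h0 | h0
    · rw [← h0, Real.zero_rpow (by positivity), mul_zero]
    · rw [← Real.rpow_add_one h0.ne']; congr 1; ring
  have e7 : W ^ (3 / p - 1) ≤ ε / C := by
    have := Real.rpow_le_rpow hw0 hW hθ.le
    rwa [← Real.rpow_mul (by positivity), one_div_mul_cancel hθ.ne', Real.rpow_one] at this
  rw [e6, ← mul_assoc]
  gcongr
  rw [le_div_iff₀ hC0] at e7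
  linarith

/-- A moving frame on `[a, b]`: three orbits of the flow of the driver in `H²` which start from the
standard basis and are orthonormal at almost every point. -/
structure IsMovingFrame (p : ℝ) (G GG : ℝ → ℝ → SobolevH 2 LR3) (a b L : ℝ)
    (φ : Fin 3 → ℝ → H2Field) : Prop where
  init : ∀ i, φ i a = constField (EuclideanSpace.single i 1)
  norm_le : ∀ i, ∀ t ∈ Icc a b, ‖φ i t‖ ≤ 3
  step : ∀ i s t, a ≤ s → s ≤ t → t ≤ b →
    ‖φ i t - driverStep G GG s t (φ i s)‖ ≤ L * driverSize p G GG s t ^ (3 / p)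
  increment : ∀ i s t, a ≤ s → s ≤ t → t ≤ b →
    ‖φ i t - φ i s‖ ≤ L * driverSize p G GG s t ^ (1 / p)
  orthonormal : ∀ t ∈ Icc a b, ∀ᵐ x, Orthonormal ℝ fun i => (φ i t).fn x

/-- On intervals where the driver is small there is a moving frame, with constants depending only
on `p`. The inner products of its vectors do not change along the flow. -/
theorem exists_moving_frame (hp2 : 2 ≤ p) (hp3 : p < 3) :
    ∃ ε L : ℝ, 0 < ε ∧ ε ≤ 1 ∧ 0 ≤ L ∧ ∀ (T : ℝ) (G GG : ℝ → ℝ → SobolevH 2 LR3), 0 < T →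
      IsAntisymmRoughDriver T p 2 G GG → ∀ a b, 0 ≤ a → a ≤ b → b ≤ T →
      driverSize p G GG a b ≤ ε → ∃ φ, IsMovingFrame p G GG a b L φ := by
  obtain ⟨ε, L, hε, hε1, hL, horb⟩ := exists_driver_orbit hp2 hp3
  refine ⟨ε, L, hε, hε1, hL, fun T G GG hT h a b ha hab hb hsm => ?_⟩
  have hsup := isSuperadditive_driverSize hp2 h.memV_fst h.memV_snd
  choose φ h1 h2 h3 using fun i : Fin 3 => horb T G GG h a b ha hab hb hsm
    (constField (EuclideanSpace.single i 1)) (by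
      rw [norm_constField]; simp)
  refine ⟨φ, h1, h2, fun i s t k1 k2 k3 => (h3 i s t k1 k2 k3).1,
    fun i s t k1 k2 k3 => (h3 i s t k1 k2 k3).2, fun t ht => ?_⟩
  have key : ∀ i j, ∀ᵐ x, inner ℝ ((φ i t).fn x) ((φ j t).fn x) = if i = j then (1 : ℝ) else 0 := by
    intro i j
    have e := sobDot_orbit_const hp2 hp3 hT h ha hb hL (fun s t k1 k2 k3 =>
      (hsup.mono ha k1 k2 k3 hb).trans (hsm.trans hε1)) (h2 i) (h2 j)
      (fun s t k1 k2 k3 => (h3 i s t k1 k2 k3).1) (fun s t k1 k2 k3 => (h3 j s t k1 k2 k3).1) ht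
    rw [h1 i, h1 j] at e
    have c1 := sobDot_coe (φ i t) (φ j t).fn
    rw [e] at c1
    filter_upwards [c1, sobDot_coe (constField (EuclideanSpace.single i 1))
      (constField (EuclideanSpace.single j 1)).fn, constField_coe (EuclideanSpace.single i 1),
      constField_coe (EuclideanSpace.single j 1)] with x k1 k2 k3 k4
    rw [← k1, k2, k3, k4]
    simp [EuclideanSpace.inner_single_left]
  have key' : ∀ᵐ x, ∀ i j, inner ℝ ((φ i t).fn x) ((φ j t).fn x) =
      if i = j then (1 : ℝ) else 0 := by
    rw [ae_all_iff]; intro i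
    rw [ae_all_iff]; exact key i
  filter_upwards [key'] with x hx
  exact orthonormal_iff_ite.2 hx

end Frame

/-! ### Rough equations in `L²` -/

/-- A continuous function on an interval which is constant on each of finitely many sets covering
the interval is constant. -/
theorem eq_of_finite_cover {E ι : Type*} [TopologicalSpace E] [T1Space E] [Finite ι] {a b : ℝ}
    {g : ℝ → E} (hg : ContinuousOn g (Icc a b)) (S : ι → Set ℝ) (hS : Icc a b ⊆ ⋃ k, S k)
    (hc : ∀ k, ∀ s ∈ S k, ∀ t ∈ S k, s ∈ Icc a b → t ∈ Icc a b → g s = g t) {s t : ℝ}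
    (hs : s ∈ Icc a b) (ht : t ∈ Icc a b) : g s = g t := by
  have hpre : IsPreconnected (g '' Icc a b) := isPreconnected_Icc.image g hg
  have hfin : (g '' Icc a b).Finite := by
    have : g '' Icc a b ⊆ ⋃ k, g '' (S k ∩ Icc a b) := by
      rintro _ ⟨r, hr, rfl⟩
      obtain ⟨k, hk⟩ := mem_iUnion.1 (hS hr)
      exact mem_iUnion.2 ⟨k, r, ⟨hk, hr⟩, rfl⟩
    refine (finite_iUnion fun k => Subsingleton.finite ?_).subset this
    rintro _ ⟨r, hr, rfl⟩ _ ⟨r', hr', rfl⟩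
    exact hc k r hr.1 r' hr'.1 hr.2 hr'.2
  have hsub : (g '' Icc a b).Subsingleton := by
    rw [← Set.not_nontrivial_iff]
    exact fun hn => hpre.infinite_of_nontrivial hn hfin
  exact hsub (mem_image_of_mem g hs) (mem_image_of_mem g ht)

/-- The path `u` solves `δu = ∫ F dr + G u + GG u + R` in `L²`, with `F` square integrable in time
and `R` locally of finite `q`-variation for some `q < 1`. -/
structure IsRoughPath (T : ℝ) (G GG : ℝ → ℝ → SobolevH 2 LR3) (F : ℝ → L2T R3)
    (R : ℝ → ℝ → L2T R3) (u : ℝ → L2T R3) : Prop where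
  memLp : MemLp F 2 (volume.restrict (Icc 0 T))
  remainder : MemV2LocOneMinus 0 T R
  eq : ∀ s t, 0 ≤ s → s ≤ t → t ≤ T →
    u t = driverAct G GG s t (u s) + (∫ r in s..t, F r) + R s t

/-- The pointwise equation is an equation in `L²`. -/
theorem IsRoughLLGSolution.exists_isRoughPath {T : ℝ} {G GG : ℝ → ℝ → SobolevH 2 LR3}
    {u0 : SobolevH 1 R3} {u : ℝ → L2T R3} {U : ℝ → SobolevH 2 R3}
    (h : IsRoughLLGSolution T G GG u0 u U) : ∃ F R, IsRoughPath T G GG F R u ∧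
      ∀ᵐ r ∂(volume.restrict (Icc 0 T)), F r =ᵐ[volume] llgDrift (U r) := by
  obtain ⟨F, R, hF, hFU, hR, heq⟩ := h.equation
  refine ⟨F, R, ⟨hF, hR, fun s t h1 h2 h3 => ?_⟩, hFU⟩
  have e1 := heq s t h1 h2 h3
  have e2 := mulL_coe (G s t) (u s)
  have e3 := mulL_coe (GG s t) (u s)
  rw [driverAct_apply]
  generalize mulL (G s t) (u s) = y at e2 ⊢
  generalize mulL (GG s t) (u s) = z at e3 ⊢
  generalize (∫ r in s..t, F r) = I at e1 ⊢
  refine Lp.ext ?_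
  filter_upwards [e1, e2, e3, Lp.coeFn_add (u s + y + z + I) (R s t),
    Lp.coeFn_add (u s + y + z) I, Lp.coeFn_add (u s + y) z, Lp.coeFn_add (u s) y]
    with x k1 k2 k3 k4 k5 k6 k7
  rw [k4, Pi.add_apply, k5, Pi.add_apply, k6, Pi.add_apply, k7, Pi.add_apply, k2, k3]
  rw [sub_sub, sub_eq_iff_eq_add] at k1
  rw [k1]
  abel

section Equation

variable {p T : ℝ} {G GG : ℝ → ℝ → SobolevH 2 LR3} {F : ℝ → L2T R3} {R : ℝ → ℝ → L2T R3}
  {u : ℝ → L2T R3}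

theorem continuous_mulL (v : L2T R3) : Continuous fun f => mulL f v := by
  have h : ∀ f g, mulL (f - g) v = mulL f v - mulL g v := by
    intro f g
    unfold mulL
    rw [map_sub, sub_apply]
  refine (LipschitzWith.of_dist_le_mul (K := ⟨2 * ‖v‖, by positivity⟩) fun f g => ?_).continuous
  rw [dist_eq_norm, dist_eq_norm, ← h]
  refine (norm_mulL_le _ _).trans (le_of_eq ?_)
  change 2 * ‖f - g‖ * ‖v‖ = 2 * ‖v‖ * ‖f - g‖
  ring

theorem intervalIntegrable_of_memLp_two {E : Type*} [NormedAddCommGroup E] {F : ℝ → E} {a b : ℝ}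
    (ha : 0 ≤ a) (hab : a ≤ b) (hb : b ≤ T) (hF : MemLp F 2 (volume.restrict (Icc 0 T))) :
    IntervalIntegrable F volume a b := by
  rw [intervalIntegrable_iff_integrableOn_Icc_of_le hab]
  exact IntegrableOn.mono_set (hF.integrable (by norm_num)) (Icc_subset_Icc ha hb)

/-- Solutions are continuous in `L²`: on each interval of the covering, the equation started from the left
end point expresses the solution by continuous functions. -/
theorem IsRoughPath.continuousOn (h : IsRoughPath T G GG F R u)
    (hd : IsAntisymmRoughDriver T p 2 G GG) : ContinuousOn u (Icc 0 T) := by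
  obtain ⟨q, hq0, hq1, n, c, d, hcd, hcov, hR⟩ := h.remainder
  have key : ∀ k, ContinuousOn u (Icc (c k) (d k)) := by
    intro k
    obtain ⟨h1, h2, h3⟩ := hcd k
    have hmaps : MapsTo (fun t : ℝ => (c k, t)) (Icc (c k) (d k)) (simplex2 (c k) (d k)) :=
      fun t ht => ⟨le_rfl, ht.1, ht.2⟩
    have hmaps' : MapsTo (fun t : ℝ => (c k, t)) (Icc (c k) (d k)) (simplex2 0 T) :=
      fun t ht => ⟨h1, ht.1, ht.2.trans h3⟩
    have hcont : ContinuousOn (fun t : ℝ => (c k, t)) (Icc (c k) (d k)) :=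
      (continuous_const.prodMk continuous_id).continuousOn
    have c1 : ContinuousOn (fun t => R (c k) t) (Icc (c k) (d k)) :=
      (hR k).1.comp hcont hmaps
    have c2 : ContinuousOn (fun t => mulL (G (c k) t) (u (c k))) (Icc (c k) (d k)) :=
      (continuous_mulL _).comp_continuousOn (hd.memV_fst.1.comp hcont hmaps')
    have c3 : ContinuousOn (fun t => mulL (GG (c k) t) (u (c k))) (Icc (c k) (d k)) :=
      (continuous_mulL _).comp_continuousOn (hd.memV_snd.1.comp hcont hmaps')
    have c4 : ContinuousOn (fun t => ∫ r in c k..t, F r) (Icc (c k) (d k)) := by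
      have := intervalIntegral.continuousOn_primitive_interval'
        (intervalIntegrable_of_memLp_two h1 h2 h3 h.memLp) left_mem_uIcc
      rwa [uIcc_of_le h2] at this
    refine ((((continuousOn_const (c := u (c k))).add c2).add c3).add c4 |>.add c1).congr
      fun t ht => ?_
    exact h.eq (c k) t h1 ht.1 (ht.2.trans h3)
  refine (LocallyFinite.continuousOn_iUnion (locallyFinite_of_finite _) (fun k => isClosed_Icc)
    key).mono hcov

/-- Real powers above one are small multiples of the base near zero. -/
theorem exists_pos_rpow_le_mul {θ ε : ℝ} (hθ : 1 < θ) (hε : 0 < ε) :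
    ∃ δ > 0, ∀ x, 0 ≤ x → x ≤ δ → x ^ θ ≤ ε * x := by
  have h1 : 0 < θ - 1 := by linarith
  refine ⟨ε ^ (1 / (θ - 1)), by positivity, fun x hx hxδ => ?_⟩
  have e7 : x ^ (θ - 1) ≤ ε := by
    have := Real.rpow_le_rpow hx hxδ h1.le
    rwa [← Real.rpow_mul (by positivity), one_div_mul_cancel h1.ne', Real.rpow_one] at this
  rcases hx.eq_or_lt with h0 | h0
  · rw [← h0, Real.zero_rpow (by positivity), mul_zero]
  · have e6 : x ^ θ = x ^ (θ - 1) * x := by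
      rw [← Real.rpow_add_one h0.ne']; congr 1; ring
    rw [e6]
    gcongr

theorem exists_pos_rpow_le {θ ε : ℝ} (hθ : 0 < θ) (hε : 0 < ε) :
    ∃ δ > 0, ∀ x, 0 ≤ x → x ≤ δ → x ^ θ ≤ ε := by
  refine ⟨ε ^ (1 / θ), by positivity, fun x hx hxδ => ?_⟩
  have := Real.rpow_le_rpow hx hxδ hθ.le
  rwa [← Real.rpow_mul (by positivity), one_div_mul_cancel hθ.ne', Real.rpow_one] at this

/-- Orbits of the flow are continuous. -/
theorem continuousOn_orbit (hp : 2 ≤ p) (hd : IsAntisymmRoughDriver T p 2 G GG) {a b L : ℝ}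
    (ha : 0 ≤ a) (hb : b ≤ T) (hL : 0 ≤ L) {φ : ℝ → H2Field}
    (hφ : ∀ s t, a ≤ s → s ≤ t → t ≤ b → ‖φ t - φ s‖ ≤ L * driverSize p G GG s t ^ (1 / p)) :
    ContinuousOn φ (Icc a b) := by
  have hp0 : 0 < p := by linarith
  have hsup := isSuperadditive_driverSize hp hd.memV_fst hd.memV_snd
  refine (Metric.uniformContinuousOn_iff.2 fun ε hε => ?_).continuousOn
  obtain ⟨η, hη, hη'⟩ := exists_pos_rpow_le (θ := 1 / p) (ε := ε / (L + 1)) (by positivity)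
    (by positivity)
  obtain ⟨δ, hδ, hsm⟩ := exists_driverSize_small hp hd.memV_fst hd.memV_snd hη
  have key : ∀ s ∈ Icc a b, ∀ t ∈ Icc a b, s ≤ t → dist s t < δ → dist (φ s) (φ t) < ε := by
    intro s hs t ht hst hd
    rw [Real.dist_eq, abs_of_nonpos (by linarith)] at hd
    rw [dist_comm, dist_eq_norm]
    have := hη' _ (hsup.nonneg s t (ha.trans hs.1) hst (ht.2.trans hb))
      (hsm s t (ha.trans hs.1) hst (ht.2.trans hb) (by linarith))
    calc _ ≤ L * driverSize p G GG s t ^ (1 / p) := hφ s t hs.1 hst ht.2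
      _ ≤ L * (ε / (L + 1)) := by gcongr
      _ < ε := by rw [← mul_div_assoc, div_lt_iff₀ (by positivity)]; nlinarith
  refine ⟨δ, hδ, fun s hs t ht hd => ?_⟩
  rcases le_total s t with hst | hst
  · exact key s hs t ht hst hd
  · rw [dist_comm]
    exact key t ht s hs hst (by rwa [dist_comm])

/-- The product formula of `sobDot_sub_eq_integral` on the intervals where the remainder is
controlled. -/
theorem IsRoughPath.sobDot_sub_eq_integral_of_control (hp : 2 ≤ p) (hp3 : p < 3) (hT : 0 < T)
    (h : IsRoughPath T G GG F R u) (hd : IsAntisymmRoughDriver T p 2 G GG)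
    (hu : ∀ t ∈ Icc 0 T, ‖u t‖ ≤ 1) {a b L : ℝ} (ha : 0 ≤ a) (hb : b ≤ T) (hL : 0 ≤ L)
    (hw : ∀ s t, a ≤ s → s ≤ t → t ≤ b → driverSize p G GG s t ≤ 1) {φ : ℝ → H2Field}
    (hφ3 : ∀ t ∈ Icc a b, ‖φ t‖ ≤ 3)
    (hφ1 : ∀ s t, a ≤ s → s ≤ t → t ≤ b →
      ‖φ t - driverStep G GG s t (φ s)‖ ≤ L * driverSize p G GG s t ^ (3 / p))
    (hφ2 : ∀ s t, a ≤ s → s ≤ t → t ≤ b → ‖φ t - φ s‖ ≤ L * driverSize p G GG s t ^ (1 / p))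
    {c d q : ℝ} (hq0 : 0 < q) (hq1 : q < 1) {w : ℝ → ℝ → ℝ} (hw' : IsControl c d w)
    (hRw : ∀ s t, c ≤ s → s ≤ t → t ≤ d → ‖R s t‖ ≤ w s t ^ (1 / q)) {s t : ℝ} (h1 : a ≤ s)
    (h1' : c ≤ s) (h2 : s ≤ t) (h3 : t ≤ b) (h3' : t ≤ d) :
    sobDot (φ t) (u t) - sobDot (φ s) (u s) - ∫ r in s..t, sobDot (φ r) (F r) = 0 := by
  have hp0 : 0 < p := by linarith
  have hab : a ≤ b := h1.trans (h2.trans h3)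
  have hsup := isSuperadditive_driverSize hp hd.memV_fst hd.memV_snd
  have hφc := continuousOn_orbit hp hd ha hb hL hφ2
  have hFi : IntervalIntegrable F volume a b := intervalIntegrable_of_memLp_two ha hab hb h.memLp
  have hi : IntervalIntegrable (fun r => sobDot (φ r) (F r)) volume a b :=
    intervalIntegrable_bilin_right sobDot.flip hab hFi hφc
  refine additive_eq_zero_of_small h2
    (fun s t => sobDot (φ t) (u t) - sobDot (φ s) (u s) - ∫ r in s..t, sobDot (φ r) (F r))
    (fun s t => (∫ r in s..t, ‖F r‖) + w s t + driverSize p G GG s t) ?_ ?_ ?_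
  · intro s' r t' k1 k2 k3 k4
    have := intervalIntegral.integral_add_adjacent_intervals
      (intervalIntegrable_sub_Icc hi (h1.trans k1) k2 (k3.trans (k4.trans h3)))
      (intervalIntegrable_sub_Icc hi (h1.trans (k1.trans k2)) k3 (k4.trans h3))
    rw [← this]
    abel
  · intro s' r t' k1 k2 k3 k4
    have e1 := intervalIntegral.integral_add_adjacent_intervals
      (intervalIntegrable_sub_Icc hFi.norm (h1.trans k1) k2 (k3.trans (k4.trans h3)))
      (intervalIntegrable_sub_Icc hFi.norm (h1.trans (k1.trans k2)) k3 (k4.trans h3))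
    have e2 := hw'.superadditive s' r t' (h1'.trans k1) k2 k3 (k4.trans h3')
    have e3 := hsup.add_le s' r t' (ha.trans (h1.trans k1)) k2 k3 (k4.trans (h3.trans hb))
    linarith
  · intro ε hε
    set C : ℝ := 720 + 10 * L with hC
    have hC0 : 0 < C := by positivity
    obtain ⟨δ₁, hδ₁, b1⟩ := exists_pos_rpow_le (θ := 1 / p) (ε := ε / (2 * L + 1))
      (by positivity) (by positivity)
    obtain ⟨δ₂, hδ₂, b2⟩ := exists_pos_rpow_le_mul (θ := 1 / q) (ε := ε / 6)
      (by rw [lt_div_iff₀ hq0]; linarith) (by positivity)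
    obtain ⟨δ₃, hδ₃, b3⟩ := exists_pos_rpow_le_mul (θ := 3 / p) (ε := ε / C)
      (by rw [lt_div_iff₀ hp0]; linarith) (by positivity)
    obtain ⟨η, hη, g1⟩ := exists_driverSize_small hp hd.memV_fst hd.memV_snd (lt_min hδ₁ hδ₃)
    obtain ⟨η', hη', g2⟩ := hw'.exists_small hδ₂
    refine ⟨min η η', lt_min hη hη', fun s' t' k1 k2 k3 k4 => ?_⟩
    have as' : a ≤ s' := h1.trans k1
    have tb' : t' ≤ b := k3.trans h3
    have hW := g1 s' t' (ha.trans as') k2 (tb'.trans hb) (k4.trans_le (min_le_left _ _))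
    have hw1 := g2 s' t' (h1'.trans k1) k2 (k3.trans h3') (k4.trans_le (min_le_right _ _))
    have hW0 := hsup.nonneg s' t' (ha.trans as') k2 (tb'.trans hb)
    have hw0 := hw'.nonneg s' t' (h1'.trans k1) k2 (k3.trans h3')
    have hRn := hRw s' t' (h1'.trans k1) k2 (k3.trans h3')
    have inc := norm_sobDot_increment_le hp hT hd hL (ha.trans as') k2 (tb'.trans hb)
      (hw s' t' as' k2 tb') (ys := u s') (yt := u t') (hφ3 s' ⟨as', k2.trans tb'⟩)
      (hφ1 s' t' as' k2 tb')
    have e0 : u t' - driverAct G GG s' t' (u s') = (∫ r in s'..t', F r) + R s' t' := by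
      rw [h.eq s' t' (ha.trans as') k2 (tb'.trans hb)]; abel
    rw [e0] at inc
    have hFs := intervalIntegrable_sub_Icc hFi as' k2 tb'
    have hFn : IntervalIntegrable (fun r => ‖F r‖) volume s' t' := hFs.norm
    have e1 : sobDot (φ t') (∫ r in s'..t', F r) = ∫ r in s'..t', sobDot (φ t') (F r) :=
      ((sobDot (φ t')).intervalIntegral_comp_comm hFs).symm
    have hi1 : IntervalIntegrable (fun r => sobDot (φ t') (F r)) volume s' t' :=
      intervalIntegrable_bilin_right sobDot.flip k2 hFs continuousOn_const
    have n1 : ‖sobDot (φ t') (∫ r in s'..t', F r) - ∫ r in s'..t', sobDot (φ r) (F r)‖ ≤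
        ε * ∫ r in s'..t', ‖F r‖ := by
      rw [e1, ← intervalIntegral.integral_sub hi1 (intervalIntegrable_sub_Icc hi as' k2 tb'),
        ← intervalIntegral.integral_const_mul]
      refine intervalIntegral.norm_integral_le_of_norm_le k2 ?_ (hFn.const_mul _)
      refine Eventually.of_forall fun r hr => ?_
      have e2 : sobDot (φ t') (F r) - sobDot (φ r) (F r) = sobDot (φ t' - φ r) (F r) := by
        rw [map_sub, sub_apply]
      rw [e2]
      have m1 : driverSize p G GG r t' ≤ δ₁ :=
        (hsup.mono (ha.trans as') hr.1.le hr.2 le_rfl (tb'.trans hb)).trans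
          (hW.trans (min_le_left _ _))
      have m2 := b1 _ (hsup.nonneg r t' (ha.trans (as'.trans hr.1.le)) hr.2 (tb'.trans hb)) m1
      have m3 := hφ2 r t' (as'.trans hr.1.le) hr.2 tb'
      calc _ ≤ 2 * ‖φ t' - φ r‖ * ‖F r‖ := norm_sobDot_le _ _
        _ ≤ 2 * (L * (ε / (2 * L + 1))) * ‖F r‖ := by
            gcongr; exact m3.trans (by gcongr)
        _ ≤ ε * ‖F r‖ := by
            gcongr
            rw [← mul_div_assoc, ← mul_div_assoc, div_le_iff₀ (by positivity)]; nlinarith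
    have n2 : ‖sobDot (φ t') (R s' t')‖ ≤ ε * w s' t' := by
      have := b2 _ hw0 hw1
      have h3' := hφ3 t' ⟨as'.trans k2, tb'⟩
      calc _ ≤ 2 * ‖φ t'‖ * ‖R s' t'‖ := norm_sobDot_le _ _
        _ ≤ 2 * 3 * (ε / 6 * w s' t') := by gcongr; exact hRn.trans this
        _ = _ := by ring
    have n3 : C * driverSize p G GG s' t' ^ (3 / p) * ‖u s'‖ ≤ ε * driverSize p G GG s' t' := by
      have m1 := b3 _ hW0 (hW.trans (min_le_right _ _))
      have m2 := hu s' ⟨ha.trans as', (k2.trans tb').trans hb⟩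
      have m3 : 0 ≤ driverSize p G GG s' t' ^ (3 / p) := Real.rpow_nonneg hW0 _
      calc _ ≤ C * (ε / C * driverSize p G GG s' t') * 1 := by gcongr
        _ = _ := by field_simp
    rw [map_add] at inc
    have e3 : sobDot (φ t') (u t') - sobDot (φ s') (u s') - ∫ r in s'..t', sobDot (φ r) (F r) =
        (sobDot (φ t') (u t') - sobDot (φ s') (u s') -
          (sobDot (φ t') (∫ r in s'..t', F r) + sobDot (φ t') (R s' t'))) +
        (sobDot (φ t') (∫ r in s'..t', F r) - ∫ r in s'..t', sobDot (φ r) (F r)) +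
        sobDot (φ t') (R s' t') := by abel
    rw [e3]
    refine (norm_add₃_le ..).trans ?_
    linarith

/-- Along an orbit `φ` of the flow, the driver disappears from the equation: the pairing `φ · u`
has the time derivative `φ · F`. -/
theorem IsRoughPath.sobDot_sub_eq_integral (hp : 2 ≤ p) (hp3 : p < 3) (hT : 0 < T)
    (h : IsRoughPath T G GG F R u) (hd : IsAntisymmRoughDriver T p 2 G GG)
    (hu : ∀ t ∈ Icc 0 T, ‖u t‖ ≤ 1) {a b L : ℝ} (ha : 0 ≤ a) (hb : b ≤ T) (hL : 0 ≤ L)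
    (hw : ∀ s t, a ≤ s → s ≤ t → t ≤ b → driverSize p G GG s t ≤ 1) {φ : ℝ → H2Field}
    (hφ3 : ∀ t ∈ Icc a b, ‖φ t‖ ≤ 3)
    (hφ1 : ∀ s t, a ≤ s → s ≤ t → t ≤ b →
      ‖φ t - driverStep G GG s t (φ s)‖ ≤ L * driverSize p G GG s t ^ (3 / p))
    (hφ2 : ∀ s t, a ≤ s → s ≤ t → t ≤ b → ‖φ t - φ s‖ ≤ L * driverSize p G GG s t ^ (1 / p))
    {s t : ℝ} (hs : a ≤ s) (hst : s ≤ t) (ht : t ≤ b) :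
    sobDot (φ t) (u t) - sobDot (φ s) (u s) = ∫ r in s..t, sobDot (φ r) (F r) := by
  have hab : a ≤ b := hs.trans (hst.trans ht)
  have hφc := continuousOn_orbit hp hd ha hb hL hφ2
  have huc : ContinuousOn u (Icc a b) := (h.continuousOn hd).mono (Icc_subset_Icc ha hb)
  have hFi : IntervalIntegrable F volume a b := intervalIntegrable_of_memLp_two ha hab hb h.memLp
  have hi : IntervalIntegrable (fun r => sobDot (φ r) (F r)) volume a b :=
    intervalIntegrable_bilin_right sobDot.flip hab hFi hφc
  obtain ⟨q, hq0, hq1, n, c, d, hcd, hcov, hR⟩ := h.remainder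
  have hloc : ∀ k s t, a ≤ s → c k ≤ s → s ≤ t → t ≤ b → t ≤ d k →
      sobDot (φ t) (u t) - sobDot (φ s) (u s) - ∫ r in s..t, sobDot (φ r) (F r) = 0 := by
    intro k s t h1 h1' h2 h3 h3'
    obtain ⟨-, -, w, hw', hRw⟩ := hR k
    exact h.sobDot_sub_eq_integral_of_control hp hp3 hT hd hu ha hb hL hw hφ3 hφ1 hφ2 hq0 hq1 hw' hRw
      h1 h1' h2 h3 h3'
  -- on each interval of the covering, `φ · u` minus the integral is constant by `hloc`; being
  -- continuous, it is constant on the connected interval `[a, b]`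
  have hgc : ContinuousOn (fun t => sobDot (φ t) (u t) - ∫ r in a..t, sobDot (φ r) (F r))
      (Icc a b) := by
    refine ((sobDot.continuous.comp_continuousOn hφc).clm_apply huc).sub ?_
    have := intervalIntegral.continuousOn_primitive_interval' hi left_mem_uIcc
    rwa [uIcc_of_le hab] at this
  have hg := eq_of_finite_cover hgc (fun k => Icc (c k) (d k))
    ((Icc_subset_Icc ha hb).trans hcov) (fun k => by
      have main : ∀ s ∈ Icc (c k) (d k), ∀ t ∈ Icc (c k) (d k), s ∈ Icc a b → t ∈ Icc a b → s ≤ t →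
          sobDot (φ s) (u s) - (∫ r in a..s, sobDot (φ r) (F r)) =
            sobDot (φ t) (u t) - ∫ r in a..t, sobDot (φ r) (F r) := by
        intro s h1 t h2 h3 h4 h5
        have e1 := hloc k s t h3.1 h1.1 h5 h4.2 h2.2
        rw [← intervalIntegral.integral_interval_sub_left
          (intervalIntegrable_sub_Icc hi le_rfl h4.1 h4.2)
          (intervalIntegrable_sub_Icc hi le_rfl h3.1 h3.2)] at e1
        exact (sub_eq_sub_iff_sub_eq_sub.2 (sub_eq_zero.1 e1)).symm
      intro s h1 t h2 h3 h4
      rcases le_total s t with h5 | h5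
      · exact main s h1 t h2 h3 h4 h5
      · exact (main t h2 s h1 h4 h3 h5).symm) (s := t) (t := s) ⟨hs.trans hst, ht⟩
    ⟨hs, hst.trans ht⟩
  rw [← intervalIntegral.integral_interval_sub_left
    (intervalIntegrable_sub_Icc hi le_rfl (hs.trans hst) ht)
    (intervalIntegrable_sub_Icc hi le_rfl hs (hst.trans ht))]
  rw [sub_eq_sub_iff_sub_eq_sub]
  exact hg

end Equation

/-! ### Pointwise identities for unit vector fields -/

theorem inner_eq_coordinates (a b : R3) : inner ℝ a b = a 0 * b 0 + a 1 * b 1 + a 2 * b 2 := by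
  simp only [PiLp.inner_apply, Fin.sum_univ_three, RCLike.inner_apply, conj_trivial]
  ring

theorem cross3_coordinates (a b : R3) : cross3 a b 0 = a 1 * b 2 - a 2 * b 1 ∧
    cross3 a b 1 = a 2 * b 0 - a 0 * b 2 ∧ cross3 a b 2 = a 0 * b 1 - a 1 * b 0 := by
  simp [cross3, cross_apply]

theorem inner_cross3_right (a b : R3) : inner ℝ (cross3 a b) b = 0 := by
  obtain ⟨h0, h1, h2⟩ := cross3_coordinates a b
  rw [inner_eq_coordinates, h0, h1, h2]
  ring

theorem inner_cross3_left (a b : R3) : inner ℝ a (cross3 a b) = 0 := by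
  obtain ⟨h0, h1, h2⟩ := cross3_coordinates a b
  rw [inner_eq_coordinates, h0, h1, h2]
  ring

theorem cross3_cross3 (a b : R3) :
    cross3 a (cross3 a b) = inner ℝ a b • a - inner ℝ a a • b := by
  obtain ⟨h0, h1, h2⟩ := cross3_coordinates a b
  obtain ⟨k0, k1, k2⟩ := cross3_coordinates a (cross3 a b)
  rw [h1, h2] at k0
  rw [h0, h2] at k1
  rw [h0, h1] at k2
  ext i
  rw [PiLp.sub_apply, PiLp.smul_apply, PiLp.smul_apply, inner_eq_coordinates, inner_eq_coordinates,
    smul_eq_mul, smul_eq_mul]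
  fin_cases i
  · change cross3 a (cross3 a b) 0 = (a 0 * b 0 + a 1 * b 1 + a 2 * b 2) * a 0 -
      (a 0 * a 0 + a 1 * a 1 + a 2 * a 2) * b 0
    rw [k0]; ring
  · change cross3 a (cross3 a b) 1 = (a 0 * b 0 + a 1 * b 1 + a 2 * b 2) * a 1 -
      (a 0 * a 0 + a 1 * a 1 + a 2 * a 2) * b 1
    rw [k1]; ring
  · change cross3 a (cross3 a b) 2 = (a 0 * b 0 + a 1 * b 1 + a 2 * b 2) * a 2 -
      (a 0 * a 0 + a 1 * a 1 + a 2 * a 2) * b 2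
    rw [k2]; ring

theorem norm_sq_cross3 (a b : R3) :
    ‖cross3 a b‖ ^ 2 = inner ℝ a a * inner ℝ b b - inner ℝ a b ^ 2 := by
  obtain ⟨h0, h1, h2⟩ := cross3_coordinates a b
  rw [← real_inner_self_eq_norm_sq, inner_eq_coordinates, inner_eq_coordinates a a,
    inner_eq_coordinates b b, inner_eq_coordinates a b, h0, h1, h2]
  ring

/-- For a unit vector `a` and `c = ⟨a, b⟩`, the Landau-Lifshitz-Gilbert drift is the sum of two
orthogonal vectors of length `‖b - c a‖`. -/
theorem drift_identities {a b : R3} (ha : ‖a‖ = 1) :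
    inner ℝ (cross3 a b - cross3 a (cross3 a b)) b = ‖b - inner ℝ a b • a‖ ^ 2 ∧
      ‖cross3 a b - cross3 a (cross3 a b)‖ ^ 2 = 2 * ‖b - inner ℝ a b • a‖ ^ 2 ∧
      ‖b - inner ℝ a b • a‖ ^ 2 = ‖b‖ ^ 2 - inner ℝ a b ^ 2 := by
  have ha' : inner ℝ a a = 1 := by rw [real_inner_self_eq_norm_sq, ha, one_pow]
  have h0 : ‖b - inner ℝ a b • a‖ ^ 2 = ‖b‖ ^ 2 - inner ℝ a b ^ 2 := by
    rw [norm_sub_sq_real, norm_smul, ha, inner_smul_right, real_inner_comm, Real.norm_eq_abs,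
      mul_one, sq_abs]
    ring
  have hcc : cross3 a (cross3 a b) = -(b - inner ℝ a b • a) := by
    rw [cross3_cross3, ha', one_smul]; abel
  have hbb : inner ℝ b b = ‖b‖ ^ 2 := real_inner_self_eq_norm_sq b
  refine ⟨?_, ?_, h0⟩
  · rw [inner_sub_left, inner_cross3_right, hcc, inner_neg_left, inner_sub_left,
      inner_smul_left, h0, hbb]
    simp
    ring
  · have horth : inner ℝ (cross3 a b) (cross3 a (cross3 a b)) = 0 := by
      rw [cross3_cross3, inner_sub_right, inner_smul_right, inner_smul_right, inner_cross3_right,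
        real_inner_comm a (cross3 a b), inner_cross3_left]
      ring
    rw [norm_sub_sq_real, horth, norm_sq_cross3, hcc, norm_neg, h0, ha', hbb]
    ring

theorem H2Field.hasWeakDeriv_zero (φ : H2Field) : HasWeakDeriv φ.fn (φ.toSob.1 1) :=
  φ.toSob.2 0

theorem H2Field.hasWeakDeriv_one (φ : H2Field) : HasWeakDeriv (φ.toSob.1 1) (φ.toSob.1 2) :=
  φ.toSob.2 1

/-- A field of unit vectors is orthogonal to its derivative, and differentiating once more gives
`⟨V, ∂²V⟩ = -|∂V|²`. -/
theorem inner_second_deriv_of_unit {V : H2Field} (hV : ∀ᵐ x, ‖V.fn x‖ = 1) :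
    ∀ᵐ x, inner ℝ (V.fn x) (V.toSob.1 2 x) = -‖V.toSob.1 1 x‖ ^ 2 := by
  have h1 : HasWeakDeriv (Lp.const 2 volume (1 : ℝ) : L2T ℝ)
      ((2 : ℝ) • sobPair (innerSL ℝ) (0 : Fin 2) (1 : Fin 3) V.toSob V.toSob) := by
    refine HasWeakDeriv.bilin (innerSL ℝ) V.hasWeakDeriv_zero V.hasWeakDeriv_zero ?_ ?_
    · filter_upwards [hV, Lp.coeFn_const (p := 2) (μ := (volume : Measure UnitAddCircle)) (1 : ℝ)]
        with x k1 k2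
      rw [k2, innerSL_apply_apply ℝ, real_inner_self_eq_norm_sq, k1]
      simp
    · filter_upwards [sobPair_coe (innerSL ℝ) (0 : Fin 2) (1 : Fin 3) V.toSob V.toSob,
        Lp.coeFn_smul (2 : ℝ) (sobPair (innerSL ℝ) (0 : Fin 2) (1 : Fin 3) V.toSob V.toSob)]
        with x k1 k2
      rw [k2, Pi.smul_apply, k1, innerSL_apply_apply ℝ, innerSL_apply_apply ℝ,
        innerSL_apply_apply ℝ, real_inner_comm (V.fn x)]
      change (2 : ℝ) • inner ℝ (V.fn x) (V.toSob.1 1 x) = _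
      rw [smul_eq_mul]
      ring
  have h2 := h1.unique (hasWeakDeriv_const (1 : ℝ))
  have h3 : sobPair (innerSL ℝ) (0 : Fin 2) (1 : Fin 3) V.toSob V.toSob = 0 := by
    have := smul_eq_zero.1 h2
    simpa using this
  have h4 := hasWeakDeriv_sobPair (innerSL ℝ) (0 : Fin 2) (1 : Fin 2) (1 : Fin 2) rfl V.toSob V.toSob
  have h5 : HasWeakDeriv (0 : L2T ℝ)
      (sobPair (innerSL ℝ) (1 : Fin 2) (1 : Fin 3) V.toSob V.toSob +
        sobPair (innerSL ℝ) (0 : Fin 2) (2 : Fin 3) V.toSob V.toSob) := by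
    rw [← h3]; exact h4
  have h6 := h5.unique HasWeakDeriv.zero
  have h7 := Lp.coeFn_zero ℝ 2 (volume : Measure UnitAddCircle)
  rw [← h6] at h7
  filter_upwards [h7, sobPair_coe (innerSL ℝ) (1 : Fin 2) (1 : Fin 3) V.toSob V.toSob,
    sobPair_coe (innerSL ℝ) (0 : Fin 2) (2 : Fin 3) V.toSob V.toSob,
    Lp.coeFn_add (sobPair (innerSL ℝ) (1 : Fin 2) (1 : Fin 3) V.toSob V.toSob)
      (sobPair (innerSL ℝ) (0 : Fin 2) (2 : Fin 3) V.toSob V.toSob)] with x k1 k2 k3 k4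
  rw [k4, Pi.add_apply, k2, k3, innerSL_apply_apply ℝ, innerSL_apply_apply ℝ] at k1
  change inner ℝ (V.toSob.1 1 x) (V.toSob.1 1 x) + inner ℝ (V.fn x) (V.toSob.1 2 x) = 0 at k1
  rw [real_inner_self_eq_norm_sq] at k1
  linarith

/-- The pointwise relations between the tension, the drift and the second derivative. -/
theorem llgDrift_identities {V : H2Field} (hV : ∀ᵐ x, ‖V.fn x‖ = 1) :
    ∀ᵐ x, inner ℝ (llgDrift V.toSob x) (V.toSob.1 2 x) = ‖tension V.toSob x‖ ^ 2 ∧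
      ‖llgDrift V.toSob x‖ ^ 2 = 2 * ‖tension V.toSob x‖ ^ 2 ∧
      ‖V.toSob.1 2 x‖ ^ 2 = ‖tension V.toSob x‖ ^ 2 + (‖V.toSob.1 1 x‖ ^ 2) ^ 2 := by
  filter_upwards [hV, inner_second_deriv_of_unit hV] with x k1 k2
  obtain ⟨e1, e2, e3⟩ := drift_identities (b := V.toSob.1 2 x) k1
  have e : V.toSob.1 2 x - inner ℝ (V.fn x) (V.toSob.1 2 x) • V.fn x = tension V.toSob x := by
    rw [k2, neg_smul, sub_neg_eq_add]; rfl
  rw [e] at e1 e2 e3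
  refine ⟨e1, e2, ?_⟩
  rw [e3, k2]
  ring

/-! ### The second derivative of the pairing with a frame -/

/-- The second derivative of the pointwise inner product of two elements of `H²`. -/
def dotSecond (φ V : H2Field) : L2T ℝ := (sobMulFun (innerSL ℝ) φ.toSob V.toSob).1 2

theorem continuous_dotSecond : Continuous fun z : H2Field × H2Field => dotSecond z.1 z.2 := by
  have c1 : Continuous fun φ : H2Field => φ.toSob := continuous_id
  have hd : ∀ j : Fin 3, Continuous fun φ : H2Field => φ.toSob.1 j := fun j =>
    (sobDeriv R3 j).continuous.comp c1
  have hp : ∀ (B : R3 →L[ℝ] R3 →L[ℝ] ℝ) (i : Fin 2),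
      Continuous fun φ : H2Field => sobPairL B i φ.toSob := fun B i =>
    (sobPairL B i).continuous.comp c1
  have e1 := ((hp (innerSL ℝ).flip 0).comp continuous_snd).clm_apply ((hd 2).comp continuous_fst)
  have e2 := ((hp (innerSL ℝ) 1).comp continuous_fst).clm_apply ((hd 1).comp continuous_snd)
  have e3 := ((hp (innerSL ℝ) 0).comp continuous_fst).clm_apply ((hd 2).comp continuous_snd)
  exact (e1.add e2).add (e2.add e3)

theorem norm_dotSecond_le (φ V : H2Field) : ‖dotSecond φ V‖ ≤ 20 * ‖φ‖ * ‖V‖ := by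
  refine (norm_sobDeriv_le _ _).trans ((norm_sobMulFun_le (innerSL ℝ) φ.toSob V.toSob).trans ?_)
  have : ‖(innerSL ℝ : R3 →L[ℝ] R3 →L[ℝ] ℝ)‖ ≤ 1 := norm_innerSL_le ℝ
  rw [H2Field.norm_toSob, H2Field.norm_toSob]
  gcongr
  linarith

/-- `dotSecond φ V` is the second weak derivative of `φ · V`. -/
theorem exists_hasWeakDeriv_dotSecond (φ V : H2Field) :
    ∃ v, HasWeakDeriv (sobDot φ V.fn) v ∧ HasWeakDeriv v (dotSecond φ V) := by
  refine ⟨(sobMulFun (innerSL ℝ) φ.toSob V.toSob).1 1, ?_,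
    (sobMulFun (innerSL ℝ) φ.toSob V.toSob).2 1⟩
  have h := (sobMulFun (innerSL ℝ) φ.toSob V.toSob).2 0
  have e : sobDot φ V.fn = (sobMulFun (innerSL ℝ) φ.toSob V.toSob).1 0 := by
    unfold sobDot; rfl
  rw [e]
  exact h

/-- A bound for the terms of the second derivative of `φ · V` in which `V` is differentiated at most
once. Since `|V| = 1`, the term `∂²φ · V` costs no norm of `V`. -/
theorem norm_dotSecond_sub_le (φ V : H2Field) (hV : ∀ᵐ x, ‖V.fn x‖ = 1) :
    ‖dotSecond φ V - sobDot φ (V.toSob.1 2)‖ ≤ ‖φ‖ + 4 * ‖φ‖ * ‖V.toSob.1 1‖ := by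
  have hin : ‖(innerSL ℝ : R3 →L[ℝ] R3 →L[ℝ] ℝ)‖ ≤ 1 := norm_innerSL_le ℝ
  set X := sobPair (innerSL ℝ).flip (0 : Fin 2) (2 : Fin 3) V.toSob φ.toSob with hX
  set Y := sobPair (innerSL ℝ) (1 : Fin 2) (1 : Fin 3) φ.toSob V.toSob with hY
  have e : dotSecond φ V = X + Y + (Y + sobDot φ (V.toSob.1 2)) := by
    unfold sobDot; rfl
  have e' : dotSecond φ V - sobDot φ (V.toSob.1 2) = X + Y + Y := by
    rw [e]; abel
  have n1 : ‖X‖ ≤ ‖φ‖ := by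
    have : ‖X‖ ≤ ‖φ.toSob.1 2‖ := by
      refine Lp.norm_le_norm_of_ae_le ?_
      filter_upwards [sobPair_coe (innerSL ℝ).flip (0 : Fin 2) (2 : Fin 3) V.toSob φ.toSob, hV]
        with x k1 k2
      rw [k1, ContinuousLinearMap.flip_apply, innerSL_apply_apply ℝ]
      refine (norm_inner_le_norm _ _).trans (le_of_eq ?_)
      change ‖φ.toSob.1 2 x‖ * ‖V.fn x‖ = _
      rw [k2, mul_one]
    exact this.trans (norm_sobDeriv_le φ.toSob 2)
  have n2 : ‖Y‖ ≤ 2 * ‖φ‖ * ‖V.toSob.1 1‖ := by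
    have := norm_sobPairL_apply_le (innerSL ℝ) (1 : Fin 2) φ.toSob (V.toSob.1 1)
    refine (show ‖Y‖ ≤ _ from this).trans ?_
    rw [H2Field.norm_toSob]
    gcongr
    linarith
  rw [e']
  refine (norm_add₃_le ..).trans ?_
  linarith

/-- Parseval's identity in an orthonormal frame of `ℝ³`. -/
theorem sum_inner_mul_inner {f : Fin 3 → R3} (hf : Orthonormal ℝ f) (y z : R3) :
    ∑ i, inner ℝ (f i) y * inner ℝ (f i) z = inner ℝ y z := by
  have hcard : Fintype.card (Fin 3) = Module.finrank ℝ R3 := by simp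
  let b := (basisOfOrthonormalOfCardEqFinrank hf hcard).toOrthonormalBasis (by
    rw [coe_basisOfOrthonormalOfCardEqFinrank]; exact hf)
  have hb : ∀ i, b i = f i := fun i => by
    simp [b]
  have := b.sum_inner_mul_inner y z
  rw [← this]
  refine Finset.sum_congr rfl fun i _ => ?_
  rw [hb, real_inner_comm y]

theorem norm_sobDot_le_of_unit {φ : H2Field} (hφ : ∀ᵐ x, ‖φ.fn x‖ = 1) (v : L2T R3) :
    ‖sobDot φ v‖ ≤ ‖v‖ := by
  refine Lp.norm_le_norm_of_ae_le ?_
  filter_upwards [sobDot_coe φ v, hφ] with x k1 k2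
  rw [k1]
  refine (norm_inner_le_norm _ _).trans (le_of_eq ?_)
  rw [k2, one_mul]

/-- Parseval's identity in `L²` for a frame which is orthonormal at almost every point. -/
theorem sum_inner_sobDot {φ : Fin 3 → H2Field} (hφ : ∀ᵐ x, Orthonormal ℝ fun i => (φ i).fn x)
    (y z : L2T R3) : ∑ i, inner ℝ (sobDot (φ i) y) (sobDot (φ i) z) = inner ℝ y z := by
  have h1 : ∀ i, inner ℝ (sobDot (φ i) y) (sobDot (φ i) z) =
      ∫ x, inner ℝ (sobDot (φ i) y x) (sobDot (φ i) z x) := fun i => L2.inner_def _ _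
  simp_rw [h1]
  rw [← integral_finsetSum _ fun i _ => L2.integrable_inner _ _, L2.inner_def]
  refine integral_congr_ae ?_
  have h2 : ∀ᵐ x, ∀ i, sobDot (φ i) y x = inner ℝ ((φ i).fn x) (y x) ∧
      sobDot (φ i) z x = inner ℝ ((φ i).fn x) (z x) := by
    rw [ae_all_iff]
    exact fun i => (sobDot_coe (φ i) y).and (sobDot_coe (φ i) z)
  filter_upwards [h2, hφ] with x k1 k2
  rw [← sum_inner_mul_inner k2]
  refine Finset.sum_congr rfl fun i _ => ?_
  rw [(k1 i).1, (k1 i).2]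
  simp [mul_comm]

/-- The dissipation of the energy: pairing the drift with the second derivatives of the
coordinates of `V` in an orthonormal frame gives `⟨F, ∂²V⟩`, which is the squared norm of the tension
and half of `‖F‖²`, up to terms which the first derivative of `V` controls. -/
theorem sum_inner_dotSecond_ge {φ : Fin 3 → H2Field} {V : H2Field} {F : L2T R3}
    (hφ : ∀ᵐ x, Orthonormal ℝ fun i => (φ i).fn x) (hφ3 : ∀ i, ‖φ i‖ ≤ 3)
    (hV : ∀ᵐ x, ‖V.fn x‖ = 1) (hF : F =ᵐ[volume] llgDrift V.toSob) :
    ‖F‖ ^ 2 / 4 - 3000 * (1 + ‖V.toSob.1 1‖ ^ 2) ≤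
      ∑ i, inner ℝ (sobDot (φ i) F) (dotSecond (φ i) V) := by
  have h1 : inner ℝ F (V.toSob.1 2) = ‖F‖ ^ 2 / 2 := by
    rw [← real_inner_self_eq_norm_sq, L2.inner_def, L2.inner_def, ← integral_div]
    refine integral_congr_ae ?_
    filter_upwards [hF, llgDrift_identities hV] with x k1 k2
    rw [k1, k2.1, real_inner_self_eq_norm_sq, k2.2.1]
    ring
  have h2 : ∀ i, inner ℝ (sobDot (φ i) F) (sobDot (φ i) (V.toSob.1 2)) -
      ‖F‖ * (3 + 12 * ‖V.toSob.1 1‖) ≤ inner ℝ (sobDot (φ i) F) (dotSecond (φ i) V) := by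
    intro i
    have hu : ∀ᵐ x, ‖(φ i).fn x‖ = 1 := hφ.mono fun x hx => hx.1 i
    have e1 := norm_dotSecond_sub_le (φ i) V hV
    have e2 := norm_sobDot_le_of_unit hu F
    have e3 := abs_le.1 (abs_real_inner_le_norm (sobDot (φ i) F)
      (dotSecond (φ i) V - sobDot (φ i) (V.toSob.1 2)))
    rw [inner_sub_right] at e3
    have e4 : ‖sobDot (φ i) F‖ * ‖dotSecond (φ i) V - sobDot (φ i) (V.toSob.1 2)‖ ≤
        ‖F‖ * (3 + 12 * ‖V.toSob.1 1‖) := by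
      refine mul_le_mul e2 (e1.trans ?_) (norm_nonneg _) (norm_nonneg _)
      have := hφ3 i
      have h0 := norm_nonneg (V.toSob.1 1)
      nlinarith
    linarith [e3.1]
  have h3 := Finset.sum_le_sum fun i (_ : i ∈ Finset.univ) => h2 i
  rw [Finset.sum_sub_distrib, sum_inner_sobDot hφ, h1] at h3
  simp only [Finset.sum_const, Finset.card_univ, Fintype.card_fin, nsmul_eq_mul] at h3
  push_cast at h3
  -- Young's inequality for the error `3 ‖F‖ (3 + 12 ‖∂V‖)` uses up half of `‖F‖ ^ 2 / 2`
  nlinarith [sq_nonneg (‖F‖ / 2 - 3 * (3 + 12 * ‖V.toSob.1 1‖)), norm_nonneg (V.toSob.1 1),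
    sq_nonneg (‖V.toSob.1 1‖ - 1)]

/-! ### Regularity of solutions at every time -/

/-- A solution of the rough Landau-Lifshitz-Gilbert equation with values in the sphere, together
with its drift `F`, its remainder `R`, the representative `U` of `u` in `H²`, and its derivative `D`,
which exists at every time. The condition `|u| = 1` enters at all times only through the norm in `L²`,
and pointwise at almost every time. -/
structure IsSphereSolution (T : ℝ) (G GG : ℝ → ℝ → SobolevH 2 LR3) (F : ℝ → L2T R3)
    (R : ℝ → ℝ → L2T R3) (u : ℝ → L2T R3) (U : ℝ → H2Field) (D : ℝ → L2T R3) : Prop where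
  path : IsRoughPath T G GG F R u
  continuousOn : ContinuousOn u (Icc 0 T)
  norm_one : ∀ t ∈ Icc 0 T, ‖u t‖ = 1
  memLp : MemLp U 2 (volume.restrict (Icc 0 T))
  good : ∀ᵐ r ∂(volume.restrict (Icc 0 T)), (U r).fn = u r ∧ (∀ᵐ x, ‖(U r).fn x‖ = 1) ∧
    F r =ᵐ[volume] llgDrift (U r).toSob
  deriv : ∀ t ∈ Icc 0 T, HasWeakDeriv (u t) (D t)
  bounded : ∃ M, ∀ t ∈ Icc 0 T, ‖D t‖ ≤ M

theorem norm_eq_one_of_ae {E : Type*} [NormedAddCommGroup E] {f : L2T E}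
    (h : ∀ᵐ x, ‖f x‖ = 1) : ‖f‖ = 1 := by
  have e : ‖f‖ = ‖(Lp.const 2 volume (1 : ℝ) : L2T ℝ)‖ := by
    have h' : ∀ᵐ x, ‖f x‖ = ‖(Lp.const 2 volume (1 : ℝ) : L2T ℝ) x‖ := by
      filter_upwards [h, Lp.coeFn_const (p := 2) (μ := (volume : Measure UnitAddCircle)) (1 : ℝ)]
        with x k1 k2
      rw [k1, k2]; simp
    exact le_antisymm (Lp.norm_le_norm_of_ae_le (h'.mono fun x hx => hx.le))
      (Lp.norm_le_norm_of_ae_le (h'.mono fun x hx => hx.ge))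
  rw [e]
  refine (Lp.norm_const 2 volume (1 : ℝ) (by norm_num)).trans ?_
  simp

section Solution

variable {p T : ℝ} {G GG : ℝ → ℝ → SobolevH 2 LR3} {F : ℝ → L2T R3} {R : ℝ → ℝ → L2T R3}
  {u : ℝ → L2T R3}

/-- Solutions are continuous in `L²`, so that properties which hold at almost every time pass to every
time: the values have norm one, the initial value is attained, and the bound in `L^∞(H¹)` holds
everywhere, by weak compactness. -/
theorem IsRoughLLGSolution.exists_isSphereSolution (hT : 0 < T)
    (hd : IsAntisymmRoughDriver T p 2 G GG) {u0 : SobolevH 1 R3} {U : ℝ → SobolevH 2 R3}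
    (h : IsRoughLLGSolution T G GG u0 u U)
    (hunit : ∀ᵐ t ∂(volume.restrict (Icc 0 T)), ∀ᵐ x, ‖u t x‖ = 1) :
    ∃ F R D, IsSphereSolution T G GG F R u U D ∧ u 0 = sobolevFn u0 := by
  obtain ⟨F, R, hpath, hFU⟩ := h.exists_isRoughPath
  have hc := hpath.continuousOn hd
  have hone : ∀ t ∈ Icc 0 T, ‖u t‖ = 1 :=
    Measure.eqOn_Icc_of_ae_eq volume hT.ne (hunit.mono fun t ht => norm_eq_one_of_ae ht)
      hc.norm continuousOn_const
  have h0 : u 0 = sobolevFn u0 := by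
    refine ext_inner_right ℝ fun φ => ?_
    have hc0 : Tendsto u (𝓝[>] 0) (𝓝 (u 0)) := by
      have := (hc 0 ⟨le_rfl, hT.le⟩).mono_left (nhdsWithin_mono 0 Ioc_subset_Icc_self)
      rwa [nhdsWithin_Ioc_eq_nhdsGT hT] at this
    exact tendsto_nhds_unique (hc0.inner tendsto_const_nhds) (h.initial φ)
  have hD : ∃ M, ∀ t ∈ Icc 0 T, ∃ D, HasWeakDeriv (u t) D ∧ ‖D‖ ≤ M := by
    obtain ⟨V, hV, hVu⟩ := h.mem_H1
    set M := (eLpNorm V ⊤ (volume.restrict (Icc 0 T))).toReal with hM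
    have hVM : ∀ᵐ t ∂(volume.restrict (Icc 0 T)), ‖V t‖ ≤ M := by
      have hne := hV.eLpNorm_ne_top
      filter_upwards [ae_le_eLpNormEssSup (f := V) (μ := volume.restrict (Icc 0 T))] with t ht
      rw [← eLpNorm_exponent_top] at ht
      rw [hM, ← toReal_enorm]
      exact ENNReal.toReal_mono hne ht
    have hS : ∀ᵐ t ∂(volume : Measure ℝ), t ∈ Icc 0 T →
        ∃ D, HasWeakDeriv (u t) D ∧ ‖D‖ ≤ M := by
      refine (ae_restrict_iff' measurableSet_Icc).1 ?_
      filter_upwards [hVu, hVM] with t k1 k2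
      refine ⟨(V t).1 1, ?_, (norm_sobDeriv_le (V t) 1).trans k2⟩
      rw [← k1]
      exact (V t).2 0
    refine ⟨M, fun t ht => ?_⟩
    -- almost every time is good, and good times accumulate at every time of `[0, T]`
    set S := {t : ℝ | t ∈ Icc 0 T → ∃ D, HasWeakDeriv (u t) D ∧ ‖D‖ ≤ M} with hSdef
    have hdense : Dense S := Measure.dense_of_ae hS
    have hcl : t ∈ closure (Ioo 0 T ∩ S) := by
      have := closure_mono (hdense.open_subset_closure_inter (isOpen_Ioo (a := (0 : ℝ)) (b := T)))
      rw [closure_closure, closure_Ioo hT.ne] at this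
      exact this ht
    have hne : (𝓝[Ioo 0 T ∩ S] t).NeBot := mem_closure_iff_nhdsWithin_neBot.1 hcl
    have htend : Tendsto u (𝓝[Ioo 0 T ∩ S] t) (𝓝 (u t)) :=
      (hc t ht).mono_left (nhdsWithin_mono t fun s hs => Ioo_subset_Icc_self hs.1)
    have hex : ∀ s : ℝ, ∃ D : L2T R3, s ∈ Ioo 0 T ∩ S → HasWeakDeriv (u s) D ∧ ‖D‖ ≤ M := by
      intro s
      by_cases hs : s ∈ Ioo 0 T ∩ S
      · obtain ⟨D, hD⟩ := hs.2 (Ioo_subset_Icc_self hs.1)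
        exact ⟨D, fun _ => hD⟩
      · exact ⟨0, fun hs' => absurd hs' hs⟩
    choose D hD using hex
    exact exists_hasWeakDeriv_of_tendsto htend
      (eventually_nhdsWithin_of_forall fun s hs => (hD s hs).1)
      (eventually_nhdsWithin_of_forall fun s hs => (hD s hs).2)
  obtain ⟨M, hM⟩ := hD
  have hex : ∀ s : ℝ, ∃ D : L2T R3, s ∈ Icc 0 T → HasWeakDeriv (u s) D ∧ ‖D‖ ≤ M := by
    intro s
    by_cases hs : s ∈ Icc 0 T
    · obtain ⟨D, hD⟩ := hM s hs
      exact ⟨D, fun _ => hD⟩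
    · exact ⟨0, fun hs' => absurd hs' hs⟩
  choose D hD using hex
  refine ⟨F, R, D, ⟨hpath, hc, hone, h.mem_H2, ?_, fun t ht => (hD t ht).1, M,
    fun t ht => (hD t ht).2⟩, h0⟩
  filter_upwards [h.eq_H2, hunit, hFU] with t k1 k2 k3
  refine ⟨k1, ?_, k3⟩
  change ∀ᵐ x, ‖sobolevFn (U t) x‖ = 1
  rw [k1]
  exact k2

/-! ### The energy estimate on short intervals -/

/-- The derivative of `φ · v` for `φ ∈ H²` and `v ∈ H¹`. -/
theorem exists_hasWeakDeriv_sobDot (φ : H2Field) {v v' : L2T R3} (hv : HasWeakDeriv v v') :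
    ∃ e, HasWeakDeriv (sobDot φ v) (sobDot φ v' + e) ∧ ‖e‖ ≤ 2 * ‖φ‖ * ‖v‖ := by
  refine ⟨sobPairL (innerSL ℝ) (1 : Fin 2) φ.toSob v, ?_, ?_⟩
  · refine HasWeakDeriv.bilin (innerSL ℝ) φ.hasWeakDeriv_zero hv (sobDot_coe φ v) ?_
    filter_upwards [sobDot_coe φ v', sobPairL_coe (innerSL ℝ) (1 : Fin 2) φ.toSob v,
      Lp.coeFn_add (sobDot φ v') (sobPairL (innerSL ℝ) (1 : Fin 2) φ.toSob v)] with x k1 k2 k3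
    rw [k3, Pi.add_apply, k1, k2, add_comm]
    rfl
  · refine (norm_sobPairL_apply_le (innerSL ℝ) (1 : Fin 2) φ.toSob v).trans ?_
    have : ‖(innerSL ℝ : R3 →L[ℝ] R3 →L[ℝ] ℝ)‖ ≤ 1 := norm_innerSL_le ℝ
    rw [H2Field.norm_toSob]
    gcongr
    linarith

variable {U : ℝ → H2Field} {D : ℝ → L2T R3}

/-- The coordinates of the solution in a moving frame are primitives in time of the coordinates of the
drift. -/
theorem IsSphereSolution.sobDot_sub_eq_integral (hp : 2 ≤ p) (hp3 : p < 3) (hT : 0 < T)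
    (h : IsSphereSolution T G GG F R u U D) (hd : IsAntisymmRoughDriver T p 2 G GG) {a b L : ℝ}
    (ha : 0 ≤ a) (hb : b ≤ T) (hL : 0 ≤ L) (hw : driverSize p G GG a b ≤ 1)
    {φ : Fin 3 → ℝ → H2Field} (hφ : IsMovingFrame p G GG a b L φ) (i : Fin 3) {t : ℝ} (hat : a ≤ t)
    (htb : t ≤ b) :
    sobDot (φ i t) (u t) - sobDot (φ i a) (u a) = ∫ r in a..t, sobDot (φ i r) (F r) :=
  h.path.sobDot_sub_eq_integral hp hp3 hT hd (fun t ht => (h.norm_one t ht).le) ha hb hL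
    (fun _ _ k1 k2 k3 => ((isSuperadditive_driverSize hp hd.memV_fst hd.memV_snd).mono ha k1 k2 k3
      hb).trans hw) (hφ.norm_le i) (hφ.step i) (hφ.increment i) le_rfl hat htb

/-- The derivative of a field and the derivatives of its coordinates in an orthonormal frame have
comparable norms: the derivative `e i` of the frame contributes at most `6` to each coordinate, and
`216 = 3 * 2 * 6 ^ 2`. -/
theorem sum_norm_sq_frame_le {φ : Fin 3 → H2Field}
    (hφ : ∀ᵐ x, Orthonormal ℝ fun i => (φ i).fn x) (hφ3 : ∀ i, ‖φ i‖ ≤ 3) {v v' : L2T R3}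
    (hv : HasWeakDeriv v v') (hv1 : ‖v‖ = 1) :
    ∃ d : Fin 3 → L2T ℝ, (∀ i, HasWeakDeriv (sobDot (φ i) v) (d i)) ∧
      ∑ i, ‖d i‖ ^ 2 ≤ 2 * ‖v'‖ ^ 2 + 216 ∧ ‖v'‖ ^ 2 ≤ 2 * ∑ i, ‖d i‖ ^ 2 + 216 := by
  choose e he hen using fun i => exists_hasWeakDeriv_sobDot (φ i) hv
  have hs : ∑ i, ‖sobDot (φ i) v'‖ ^ 2 = ‖v'‖ ^ 2 := by
    rw [← real_inner_self_eq_norm_sq, ← sum_inner_sobDot hφ v' v']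
    simp_rw [real_inner_self_eq_norm_sq]
  have h6 : ∀ i, ‖e i‖ ≤ 6 := fun i => (hen i).trans (by rw [hv1]; linarith [hφ3 i])
  refine ⟨fun i => sobDot (φ i) v' + e i, he, ?_, ?_⟩
  · have h1 : ∀ i, ‖sobDot (φ i) v' + e i‖ ^ 2 ≤ 2 * ‖sobDot (φ i) v'‖ ^ 2 + 72 := by
      intro i
      have k1 := norm_add_le (sobDot (φ i) v') (e i)
      have k2 : ‖sobDot (φ i) v' + e i‖ ^ 2 ≤ (‖sobDot (φ i) v'‖ + 6) ^ 2 := by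
        gcongr; linarith [h6 i]
      nlinarith [sq_nonneg (‖sobDot (φ i) v'‖ - 6)]
    refine (Finset.sum_le_sum fun i _ => h1 i).trans (le_of_eq ?_)
    rw [Finset.sum_add_distrib, ← Finset.mul_sum, hs]
    simp; norm_num
  · have h1 : ∀ i, ‖sobDot (φ i) v'‖ ^ 2 ≤ 2 * ‖sobDot (φ i) v' + e i‖ ^ 2 + 72 := by
      intro i
      have k1 := norm_sub_le (sobDot (φ i) v' + e i) (e i)
      rw [add_sub_cancel_right] at k1
      have k2 : ‖sobDot (φ i) v'‖ ^ 2 ≤ (‖sobDot (φ i) v' + e i‖ + 6) ^ 2 := by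
        gcongr; linarith [h6 i]
      nlinarith [sq_nonneg (‖sobDot (φ i) v' + e i‖ - 6)]
    rw [← hs]
    refine (Finset.sum_le_sum fun i _ => h1 i).trans (le_of_eq ?_)
    rw [Finset.sum_add_distrib, ← Finset.mul_sum]
    simp; norm_num

/-- Square integrability in time of a continuous expression `d (f r) (g r)` with `f` bounded and `g`
square integrable. -/
theorem memLp_of_continuous₂ {X Y Z : Type*} [NormedAddCommGroup X] [NormedAddCommGroup Y]
    [NormedAddCommGroup Z] {d : X → Y → Z} (hd : Continuous fun z : X × Y => d z.1 z.2)
    {C M : ℝ} (hC : ∀ x y, ‖x‖ ≤ M → ‖d x y‖ ≤ C * ‖y‖) {μ : Measure ℝ} {f : ℝ → X} {g : ℝ → Y}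
    (hf : AEStronglyMeasurable f μ) (hM : ∀ᵐ r ∂μ, ‖f r‖ ≤ M) (hg : MemLp g 2 μ) :
    MemLp (fun r => d (f r) (g r)) 2 μ :=
  MemLp.of_le_mul (c := C) hg (hd.comp_aestronglyMeasurable (hf.prodMk hg.aestronglyMeasurable))
    (hM.mono fun _ hr => hC _ _ hr)

theorem memLp_sobDot {μ : Measure ℝ} {φ : ℝ → H2Field} (hφ : AEStronglyMeasurable φ μ)
    (h3 : ∀ᵐ r ∂μ, ‖φ r‖ ≤ 3) (hF : MemLp F 2 μ) : MemLp (fun r => sobDot (φ r) (F r)) 2 μ := by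
  refine memLp_of_continuous₂ (d := fun φ v => sobDot φ v) (C := 6)
    ((sobDot.continuous.comp continuous_fst).clm_apply continuous_snd) (fun φ v hφ => ?_) hφ h3 hF
  refine (norm_sobDot_le _ _).trans ?_
  gcongr
  linarith

theorem memLp_dotSecond {μ : Measure ℝ} {φ : ℝ → H2Field} (hφ : AEStronglyMeasurable φ μ)
    (h3 : ∀ᵐ r ∂μ, ‖φ r‖ ≤ 3) (hU : MemLp U 2 μ) :
    MemLp (fun r => dotSecond (φ r) (U r)) 2 μ := by
  refine memLp_of_continuous₂ (C := 60) continuous_dotSecond (fun φ v hφ => ?_) hφ h3 hU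
  refine (norm_dotSecond_le _ _).trans ?_
  gcongr
  linarith

theorem integrable_inner_of_memLp {X : Type*} [NormedAddCommGroup X] [InnerProductSpace ℝ X]
    {μ : Measure ℝ} {f g : ℝ → X} (hf : MemLp f 2 μ) (hg : MemLp g 2 μ) :
    Integrable (fun r => inner ℝ (f r) (g r)) μ :=
  (hf.norm.integrable_mul hg.norm).mono' (hf.aestronglyMeasurable.inner hg.aestronglyMeasurable)
    (Eventually.of_forall fun r => norm_inner_le_norm (f r) (g r))

/-- The energy balance on an interval carrying a moving frame, in terms of an upper bound `S` of
`1 + ‖∂u‖²`. The energy identity is applied to the three coordinates of `u` in the frame. -/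
theorem IsSphereSolution.energy_le_of_frame (hp : 2 ≤ p) (hp3 : p < 3) (hT : 0 < T)
    (h : IsSphereSolution T G GG F R u U D) (hd : IsAntisymmRoughDriver T p 2 G GG) {a b L : ℝ}
    (ha : 0 ≤ a) (hab : a ≤ b) (hb : b ≤ T) (hL : 0 ≤ L) (hw : driverSize p G GG a b ≤ 1)
    {φ : Fin 3 → ℝ → H2Field} (hφ : IsMovingFrame p G GG a b L φ) {S : ℝ}
    (hS : ∀ t ∈ Icc a b, 1 + ‖D t‖ ^ 2 ≤ S) {t : ℝ} (ht : t ∈ Icc a b) :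
    ‖D t‖ ^ 2 + ∫ r in Icc a t, ‖F r‖ ^ 2 ≤ 4 * ‖D a‖ ^ 2 + 648 + 12000 * S * (t - a) := by
  have hsubT : Icc a t ⊆ Icc 0 T := Icc_subset_Icc ha (ht.2.trans hb)
  have hsub : Icc a t ⊆ Icc a b := Icc_subset_Icc le_rfl ht.2
  have hμ : volume.restrict (Icc a t) ≤ volume.restrict (Icc 0 T) :=
    Measure.restrict_mono hsubT le_rfl
  have hFm : MemLp F 2 (volume.restrict (Icc a t)) := h.path.memLp.mono_measure hμ
  have hUm : MemLp U 2 (volume.restrict (Icc a t)) := h.memLp.mono_measure hμ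
  have hin : ∀ᵐ r ∂(volume.restrict (Icc a t)), r ∈ Icc a t := ae_restrict_mem measurableSet_Icc
  have hφm : ∀ i, AEStronglyMeasurable (φ i) (volume.restrict (Icc a t)) := fun i =>
    ((continuousOn_orbit hp hd ha hb hL (hφ.increment i)).mono hsub).aestronglyMeasurable_of_isCompact
      isCompact_Icc measurableSet_Icc
  have h3 : ∀ i, ∀ᵐ r ∂(volume.restrict (Icc a t)), ‖φ i r‖ ≤ 3 := fun i =>
    hin.mono fun r hr => hφ.norm_le i r (hsub hr)
  have hg : ∀ i, MemLp (fun r => sobDot (φ i r) (F r)) 2 (volume.restrict (Icc a t)) := fun i =>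
    memLp_sobDot (hφm i) (h3 i) hFm
  have hz : ∀ i, MemLp (fun r => dotSecond (φ i r) (U r)) 2 (volume.restrict (Icc a t)) := fun i =>
    memLp_dotSecond (hφm i) (h3 i) hUm
  have hgood := ae_mono hμ h.good
  obtain ⟨da, hda, hda1, -⟩ := sum_norm_sq_frame_le (hφ.orthonormal a ⟨le_rfl, hab⟩)
    (fun i => hφ.norm_le i a ⟨le_rfl, hab⟩) (h.deriv a ⟨ha, hab.trans hb⟩)
    (h.norm_one a ⟨ha, hab.trans hb⟩)
  obtain ⟨dt, hdt, -, hdt2⟩ := sum_norm_sq_frame_le (hφ.orthonormal t ht)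
    (fun i => hφ.norm_le i t ht) (h.deriv t (hsubT ⟨ht.1, le_rfl⟩))
    (h.norm_one t (hsubT ⟨ht.1, le_rfl⟩))
  have hen : ∀ i, ‖dt i‖ ^ 2 - ‖da i‖ ^ 2 =
      -2 * ∫ r in Icc a t, inner ℝ (sobDot (φ i r) (F r)) (dotSecond (φ i r) (U r)) := by
    intro i
    refine norm_sq_sub_eq_integral ht.1 (w := fun r => sobDot (φ i r) (u r)) (hg i) (hz i) ?_ ?_
      (hda i) (hdt i)
    · intro s hs
      rw [← h.sobDot_sub_eq_integral hp hp3 hT hd ha hb hL hw hφ i hs.1 (hs.2.trans ht.2)]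
      abel
    · filter_upwards [hgood] with r hr
      rw [← hr.1]
      exact exists_hasWeakDeriv_dotSecond _ _
  have hint : ∀ i, Integrable
      (fun r => inner ℝ (sobDot (φ i r) (F r)) (dotSecond (φ i r) (U r)))
      (volume.restrict (Icc a t)) := fun i =>
    integrable_inner_of_memLp (hg i) (hz i)
  have hF2 : Integrable (fun r => ‖F r‖ ^ 2) (volume.restrict (Icc a t)) :=
    hFm.integrable_norm_pow (by norm_num)
  have hlow : (∫ r in Icc a t, (‖F r‖ ^ 2 / 4 - 3000 * S)) ≤
      ∑ i, ∫ r in Icc a t, inner ℝ (sobDot (φ i r) (F r)) (dotSecond (φ i r) (U r)) := by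
    rw [← integral_finsetSum _ fun i _ => hint i]
    refine integral_mono_ae ((hF2.div_const 4).sub (integrable_const _))
      (integrable_finsetSum _ fun i _ => hint i) ?_
    filter_upwards [hgood, hin] with r hr hrt
    obtain ⟨k1, k2, k3⟩ := hr
    have e1 := sum_inner_dotSecond_ge (hφ.orthonormal r (hsub hrt))
      (fun i => hφ.norm_le i r (hsub hrt)) k2 k3
    have e2 : (U r).toSob.1 1 = D r := by
      have := (U r).hasWeakDeriv_zero
      rw [k1] at this
      exact this.unique (h.deriv r (hsubT hrt))
    rw [e2] at e1
    have := hS r (hsub hrt)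
    linarith
  have hI : ∫ r in Icc a t, (‖F r‖ ^ 2 / 4 - 3000 * S) =
      (∫ r in Icc a t, ‖F r‖ ^ 2) / 4 - 3000 * S * (t - a) := by
    rw [integral_sub (hF2.div_const 4) (integrable_const _), integral_div]
    simp [ht.1]
    ring
  have hsum : ∑ i, ‖dt i‖ ^ 2 - ∑ i, ‖da i‖ ^ 2 = -2 * ∑ i, ∫ r in Icc a t,
      inner ℝ (sobDot (φ i r) (F r)) (dotSecond (φ i r) (U r)) := by
    rw [← Finset.sum_sub_distrib, Finset.mul_sum]
    exact Finset.sum_congr rfl fun i _ => hen i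
  rw [hI] at hlow
  linarith

/-- The energy estimate on intervals which are short and on which the driver is small: the
supremum of `1 + ‖∂u‖²` on the right-hand side of the energy balance is absorbed. -/
theorem IsSphereSolution.energy_le_of_short (hp : 2 ≤ p) (hp3 : p < 3) (hT : 0 < T)
    (h : IsSphereSolution T G GG F R u U D) (hd : IsAntisymmRoughDriver T p 2 G GG) {a b L : ℝ}
    (ha : 0 ≤ a) (hab : a ≤ b) (hb : b ≤ T) (hL : 0 ≤ L) (hw : driverSize p G GG a b ≤ 1)
    {φ : Fin 3 → ℝ → H2Field} (hφ : IsMovingFrame p G GG a b L φ) (hshort : b - a ≤ 1 / 24000) :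
    1 + ‖D b‖ ^ 2 + ∫ r in Icc a b, ‖F r‖ ^ 2 ≤ 1298 * (1 + ‖D a‖ ^ 2) := by
  -- absorbing is legitimate because the supremum is finite
  obtain ⟨M, hM⟩ := h.bounded
  set A := (fun t => 1 + ‖D t‖ ^ 2) '' Icc a b with hA
  have hne : A.Nonempty := ⟨_, a, ⟨le_rfl, hab⟩, rfl⟩
  have hbdd : BddAbove A := by
    refine ⟨1 + M ^ 2, ?_⟩
    rintro _ ⟨t, ht, rfl⟩
    have := hM t ⟨ha.trans ht.1, ht.2.trans hb⟩
    dsimp only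
    gcongr
  have hS : ∀ t ∈ Icc a b, 1 + ‖D t‖ ^ 2 ≤ sSup A := fun t ht => le_csSup hbdd ⟨t, ht, rfl⟩
  have hS0 : 0 ≤ sSup A := le_trans (by positivity) (hS a ⟨le_rfl, hab⟩)
  have key : ∀ t ∈ Icc a b, 1 + ‖D t‖ ^ 2 + ∫ r in Icc a t, ‖F r‖ ^ 2 ≤
      649 * (1 + ‖D a‖ ^ 2) + sSup A / 2 := by
    intro t ht
    have e1 := h.energy_le_of_frame hp hp3 hT hd ha hab hb hL hw hφ hS ht
    have e2 : 12000 * sSup A * (t - a) ≤ 12000 * sSup A * (1 / 24000) := by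
      gcongr; linarith [ht.2]
    nlinarith [sq_nonneg ‖D a‖]
  have hSle : sSup A ≤ 1298 * (1 + ‖D a‖ ^ 2) := by
    have : sSup A ≤ 649 * (1 + ‖D a‖ ^ 2) + sSup A / 2 := by
      refine csSup_le hne ?_
      rintro _ ⟨t, ht, rfl⟩
      have := key t ht
      have h0 : 0 ≤ ∫ r in Icc a t, ‖F r‖ ^ 2 := integral_nonneg fun r => by positivity
      dsimp only
      linarith
    linarith
  linarith [key b ⟨hab, le_rfl⟩]

/-- The increments of a solution on intervals where the driver is small: the coordinates of the
increment in the frame at time `a` are split into the increment of the coordinates of `u`, which is an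
integral of the drift, and an increment of the frame. -/
theorem IsSphereSolution.norm_increment_le_of_frame (hp : 2 ≤ p) (hp3 : p < 3) (hT : 0 < T)
    (h : IsSphereSolution T G GG F R u U D) (hd : IsAntisymmRoughDriver T p 2 G GG) {a b L : ℝ}
    (ha : 0 ≤ a) (hab : a ≤ b) (hb : b ≤ T) (hL : 0 ≤ L) (hw : driverSize p G GG a b ≤ 1)
    {φ : Fin 3 → ℝ → H2Field} (hφ : IsMovingFrame p G GG a b L φ) :
    ‖u b - u a‖ ≤ 6 * L * driverSize p G GG a b ^ (1 / p) + 18 * ∫ r in Icc a b, ‖F r‖ := by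
  have hFi : IntervalIntegrable F volume a b := intervalIntegrable_of_memLp_two ha hab hb h.path.memLp
  have hFI : ∫ r in Icc a b, ‖F r‖ = ∫ r in a..b, ‖F r‖ := by
    rw [intervalIntegral.integral_of_le hab, integral_Icc_eq_integral_Ioc]
  have key : ∀ i, ‖sobDot (φ i a) (u b - u a)‖ ≤
      2 * L * driverSize p G GG a b ^ (1 / p) + 6 * ∫ r in Icc a b, ‖F r‖ := by
    intro i
    have e1 := h.sobDot_sub_eq_integral hp hp3 hT hd ha hb hL hw hφ i hab le_rfl
    have e2 : sobDot (φ i a) (u b - u a) =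
        (∫ r in a..b, sobDot (φ i r) (F r)) - sobDot (φ i b - φ i a) (u b) := by
      rw [← e1, map_sub, map_sub, sub_apply]; abel
    have e3 : ‖∫ r in a..b, sobDot (φ i r) (F r)‖ ≤ 6 * ∫ r in Icc a b, ‖F r‖ := by
      rw [hFI, ← intervalIntegral.integral_const_mul]
      refine intervalIntegral.norm_integral_le_of_norm_le hab ?_ (hFi.norm.const_mul _)
      refine Eventually.of_forall fun r hr => ?_
      refine (norm_sobDot_le _ _).trans ?_
      gcongr
      linarith [hφ.norm_le i r ⟨hr.1.le, hr.2⟩]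
    have e4 : ‖sobDot (φ i b - φ i a) (u b)‖ ≤ 2 * L * driverSize p G GG a b ^ (1 / p) := by
      refine (norm_sobDot_le _ _).trans ?_
      rw [h.norm_one b ⟨ha.trans hab, hb⟩]
      have := hφ.increment i a b le_rfl hab le_rfl
      linarith
    rw [e2]
    exact (norm_sub_le _ _).trans (by linarith)
  set K := 2 * L * driverSize p G GG a b ^ (1 / p) + 6 * ∫ r in Icc a b, ‖F r‖ with hK
  have hK0 : 0 ≤ K := (norm_nonneg _).trans (key 0)
  have hsq : ‖u b - u a‖ ^ 2 ≤ 3 * K ^ 2 := by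
    rw [← real_inner_self_eq_norm_sq, ← sum_inner_sobDot (hφ.orthonormal a ⟨le_rfl, hab⟩)]
    simp_rw [real_inner_self_eq_norm_sq]
    refine (Finset.sum_le_sum fun i (_ : i ∈ Finset.univ) =>
      pow_le_pow_left₀ (norm_nonneg _) (key i) 2).trans (le_of_eq ?_)
    simp
  have : ‖u b - u a‖ ≤ 3 * K := by
    refine abs_le_of_sq_le_sq' ?_ (by positivity) |>.2
    nlinarith [sq_nonneg K]
  rw [hK] at this
  linarith

end Solution

/-! ### The energy estimate on the whole interval -/

section Global

variable {p : ℝ}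

theorem integrableOn_norm_sq {F : ℝ → L2T R3} {T a b : ℝ}
    (hF : MemLp F 2 (volume.restrict (Icc 0 T))) (ha : 0 ≤ a) (hb : b ≤ T) :
    Integrable (fun r => ‖F r‖ ^ 2) (volume.restrict (Icc a b)) :=
  (hF.mono_measure (Measure.restrict_mono (Icc_subset_Icc ha hb) le_rfl)).integrable_norm_pow
    (by norm_num)

/-- Integrals over adjacent closed intervals add up; the common end point is a null set. -/
theorem setIntegral_Icc_add {f : ℝ → ℝ} {s r t : ℝ} (hsr : s ≤ r) (hrt : r ≤ t)
    (hf : Integrable f (volume.restrict (Icc s t))) :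
    (∫ x in Icc s r, f x) + ∫ x in Icc r t, f x = ∫ x in Icc s t, f x := by
  have hi : IntervalIntegrable f volume s t :=
    (intervalIntegrable_iff_integrableOn_Icc_of_le (hsr.trans hrt)).2 hf
  have := intervalIntegral.integral_add_adjacent_intervals
    (intervalIntegrable_sub_Icc hi le_rfl hsr hrt) (intervalIntegrable_sub_Icc hi hsr hrt le_rfl)
  rwa [intervalIntegral.integral_of_le hsr, intervalIntegral.integral_of_le hrt,
    intervalIntegral.integral_of_le (hsr.trans hrt), ← integral_Icc_eq_integral_Ioc,
    ← integral_Icc_eq_integral_Ioc, ← integral_Icc_eq_integral_Ioc] at this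

/-- The energy estimate with a constant which depends only on `p`. The estimate on short intervals is
iterated along `ω(s,t) + (t - s)`; the number of steps is proportional to this quantity, which gives
the exponential. -/
theorem exists_energy_bound (hp2 : 2 ≤ p) (hp3 : p < 3) :
    ∃ K : ℝ, 1 ≤ K ∧ ∀ (T : ℝ) (G GG : ℝ → ℝ → SobolevH 2 LR3) (F : ℝ → L2T R3)
      (R : ℝ → ℝ → L2T R3) (u : ℝ → L2T R3) (U : ℝ → H2Field) (D : ℝ → L2T R3), 0 < T →
      IsAntisymmRoughDriver T p 2 G GG → IsSphereSolution T G GG F R u U D →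
      ∀ t ∈ Icc 0 T, 1 + ‖D t‖ ^ 2 + ∫ r in Icc 0 t, ‖F r‖ ^ 2 ≤
        K * Real.exp (K * (T + driverSize p G GG 0 T)) * (1 + ‖D 0‖ ^ 2) := by
  obtain ⟨ε, L, hε, hε1, hL, hfr⟩ := exists_moving_frame hp2 hp3
  set η : ℝ := min ε (1 / 24000) with hη
  have hη0 : 0 < η := lt_min hε (by norm_num)
  -- each step multiplies the energy by at most `1298 = exp c`
  set c : ℝ := Real.log 1298 with hc
  have hc0 : 0 ≤ c := Real.log_nonneg (by norm_num)
  have hexp : Real.exp c = 1298 := Real.exp_log (by norm_num)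
  set K : ℝ := max 1298 (2 * c / η) with hK
  refine ⟨K, le_trans (by norm_num) (le_max_left _ _), ?_⟩
  intro T G GG F R u U D hT hd h t ht
  have hsup := isSuperadditive_driverSize hp2 hd.memV_fst hd.memV_snd
  set w : ℝ → ℝ → ℝ := fun s t => driverSize p G GG s t + (t - s) with hw
  have hwsup : IsSuperadditive 0 T w :=
    ⟨fun s t h1 h2 h3 => add_nonneg (hsup.nonneg s t h1 h2 h3) (by linarith),
      fun s r t h1 h2 h3 h4 => by
        have := hsup.add_le s r t h1 h2 h3 h4
        simp only [hw]; linarith⟩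
  obtain ⟨δ, hδ, hsm⟩ := exists_driverSize_small hp2 hd.memV_fst hd.memV_snd
    (half_pos hη0)
  have hgrow := growth_of_superadditive hwsup hη0 (lt_min (half_pos hδ) (half_pos hη0))
    (fun s t h1 h2 h3 h4 => by
      have e1 := hsm s t h1 h2 h3 (by linarith [h4.trans (min_le_left _ _)])
      have e2 := h4.trans (min_le_right _ _)
      simp only [hw]; linarith)
    (fun n s t => 1 + ‖D t‖ ^ 2 + ∫ r in Icc s t, ‖F r‖ ^ 2 ≤ 1298 ^ n * (1 + ‖D s‖ ^ 2))
    (fun s t h1 h2 h3 h4 => by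
      have h0 := hsup.nonneg s t h1 h2 h3
      have e1 : driverSize p G GG s t ≤ ε := by
        have : driverSize p G GG s t ≤ w s t := by simp only [hw]; linarith
        exact this.trans (h4.trans (min_le_left _ _))
      have e2 : t - s ≤ 1 / 24000 := by
        have : t - s ≤ w s t := by simp only [hw]; linarith
        exact this.trans (h4.trans (min_le_right _ _))
      obtain ⟨φ, hφ⟩ := hfr T G GG hT hd s t h1 h2 h3 e1
      rw [pow_one]
      exact h.energy_le_of_short hp2 hp3 hT hd h1 h2 h3 hL (e1.trans hε1) hφ e2)
    (fun m n s r t h1 h2 h3 h4 e1 e2 => by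
      have e3 := setIntegral_Icc_add h2 h3 (integrableOn_norm_sq h.path.memLp h1 h4)
      have e4 : 0 ≤ ∫ x in Icc s r, ‖F x‖ ^ 2 := integral_nonneg fun x => by positivity
      have e5 : (1 : ℝ) ≤ 1298 ^ n := one_le_pow₀ (by norm_num)
      have e6 : (1298 : ℝ) ^ n * (1 + ‖D r‖ ^ 2 + ∫ x in Icc s r, ‖F x‖ ^ 2) ≤
          1298 ^ n * (1298 ^ m * (1 + ‖D s‖ ^ 2)) := by gcongr
      rw [← e3, pow_add]
      nlinarith)
  have hw0 := hwsup.nonneg 0 t le_rfl ht.1 ht.2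
  set n : ℕ := ⌊w 0 t / η⌋₊ with hn
  have h1 : w 0 t ≤ (n + 1 : ℕ) * η := by
    have := (Nat.lt_floor_add_one (w 0 t / η)).le
    rw [div_le_iff₀ hη0] at this
    push_cast; exact this
  have h2 := hgrow n 0 t le_rfl ht.1 ht.2 h1
  refine h2.trans ?_
  gcongr
  have h3 : (n : ℝ) ≤ w 0 t / η := Nat.floor_le (by positivity)
  have h4 : w 0 t ≤ T + driverSize p G GG 0 T := by
    have := hwsup.mono le_rfl le_rfl ht.1 ht.2 le_rfl
    refine this.trans (le_of_eq ?_)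
    simp only [hw]; ring
  have h4' : 0 ≤ T + driverSize p G GG 0 T := hw0.trans h4
  have h5 : 2 * c * n ≤ K * (T + driverSize p G GG 0 T) := by
    calc 2 * c * n ≤ 2 * c * (w 0 t / η) := by gcongr
      _ = 2 * c / η * w 0 t := by ring
      _ ≤ K * (T + driverSize p G GG 0 T) := by
          gcongr
          exact le_max_right _ _
  calc (1298 : ℝ) ^ (2 * n + 1) = 1298 * Real.exp (2 * c * n) := by
        rw [pow_succ, mul_comm, pow_mul, ← hexp, ← Real.exp_nat_mul, ← Real.exp_nat_mul]
        congr 2; push_cast; ring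
    _ ≤ K * Real.exp (K * (T + driverSize p G GG 0 T)) :=
        mul_le_mul (le_max_left _ _) (Real.exp_le_exp.2 h5) (Real.exp_nonneg _) (by positivity)

/-! ### The second derivative -/

/-- Integration of the pointwise identity `|∂²V|² = |𝒯|² + |∂V|⁴`, with the last term estimated by
the one-dimensional Sobolev inequality for `|∂V|²`, whose derivative is `2 ⟨∂V, ∂²V⟩`; half of
`‖∂²V‖²` is absorbed. -/
theorem norm_sq_second_deriv_le {V : H2Field} {F : L2T R3} (hV : ∀ᵐ x, ‖V.fn x‖ = 1)
    (hF : F =ᵐ[volume] llgDrift V.toSob) :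
    ‖V.toSob.1 2‖ ^ 2 ≤ ‖F‖ ^ 2 + 6 * (1 + ‖V.toSob.1 1‖ ^ 2) ^ 3 := by
  set v := V.toSob.1 1 with hv
  set z := V.toSob.1 2 with hz
  set q : L2T ℝ := sobPair (innerSL ℝ) (1 : Fin 2) (1 : Fin 3) V.toSob V.toSob with hq
  set q' : L2T ℝ := (2 : ℝ) • sobPair (innerSL ℝ) (1 : Fin 2) (2 : Fin 3) V.toSob V.toSob with hq'
  have eq1 : ∀ᵐ x, q x = ‖v x‖ ^ 2 := by
    filter_upwards [sobPair_coe (innerSL ℝ) (1 : Fin 2) (1 : Fin 3) V.toSob V.toSob] with x k1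
    rw [hq, k1, innerSL_apply_apply ℝ]
    exact real_inner_self_eq_norm_sq _
  have eq2 : ∀ᵐ x, q' x = 2 * inner ℝ (v x) (z x) := by
    filter_upwards [sobPair_coe (innerSL ℝ) (1 : Fin 2) (2 : Fin 3) V.toSob V.toSob,
      Lp.coeFn_smul (2 : ℝ) (sobPair (innerSL ℝ) (1 : Fin 2) (2 : Fin 3) V.toSob V.toSob)]
      with x k1 k2
    rw [hq', k2, Pi.smul_apply, k1, innerSL_apply_apply ℝ]
    rfl
  have hder : HasWeakDeriv q q' := by
    refine HasWeakDeriv.bilin (innerSL ℝ) V.hasWeakDeriv_one V.hasWeakDeriv_one ?_ ?_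
    · filter_upwards [eq1] with x k1
      rw [k1, innerSL_apply_apply ℝ, ← hv, real_inner_self_eq_norm_sq]
    · filter_upwards [eq2] with x k1
      rw [k1, innerSL_apply_apply ℝ, innerSL_apply_apply ℝ, real_inner_comm (V.toSob.1 1 x)]
      ring
  have iv : Integrable fun x => ‖v x‖ ^ 2 := (Lp.memLp v).integrable_norm_pow (by norm_num)
  have iz : Integrable fun x => ‖z x‖ ^ 2 := (Lp.memLp z).integrable_norm_pow (by norm_num)
  have nv : ∫ x, ‖v x‖ ^ 2 = ‖v‖ ^ 2 := by
    rw [← real_inner_self_eq_norm_sq, L2.inner_def]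
    simp_rw [real_inner_self_eq_norm_sq]
  have nz : ∫ x, ‖z x‖ ^ 2 = ‖z‖ ^ 2 := by
    rw [← real_inner_self_eq_norm_sq, L2.inner_def]
    simp_rw [real_inner_self_eq_norm_sq]
  have nF : ∫ x, ‖F x‖ ^ 2 = ‖F‖ ^ 2 := by
    rw [← real_inner_self_eq_norm_sq, L2.inner_def]
    simp_rw [real_inner_self_eq_norm_sq]
  have iF : Integrable fun x => ‖F x‖ ^ 2 := (Lp.memLp F).integrable_norm_pow (by norm_num)
  have hqn : ∫ y, ‖q y‖ = ‖v‖ ^ 2 := by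
    rw [← nv]
    refine integral_congr_ae ?_
    filter_upwards [eq1] with x k1
    rw [k1, Real.norm_of_nonneg (by positivity)]
  set m := (∫ y, ‖q y‖) + ∫ y, ‖q' y‖ with hm
  have hsup : ∀ᵐ x, ‖q x‖ ≤ m := hder.ae_norm_le
  have hzz : ‖z‖ ^ 2 ≤ ‖F‖ ^ 2 / 2 + m * ‖v‖ ^ 2 := by
    rw [← nz, ← nF, ← nv, ← integral_div, ← integral_const_mul,
      ← integral_add (iF.div_const 2) (iv.const_mul m)]
    refine integral_mono_ae iz ((iF.div_const 2).add (iv.const_mul m)) ?_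
    filter_upwards [llgDrift_identities hV, hF, eq1, hsup] with x k1 k2 k3 k4
    obtain ⟨-, e1, e2⟩ := k1
    rw [k3, Real.norm_of_nonneg (by positivity)] at k4
    rw [e2, k2, e1]
    have : (‖V.toSob.1 1 x‖ ^ 2) ^ 2 ≤ m * ‖v x‖ ^ 2 := by
      rw [sq (‖V.toSob.1 1 x‖ ^ 2)]
      gcongr
    linarith
  have hq'n : ‖v‖ ^ 2 * ∫ y, ‖q' y‖ ≤ 2 * (‖v‖ ^ 2) ^ 2 * ‖v‖ ^ 2 + ‖z‖ ^ 2 / 2 := by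
    rw [← integral_const_mul, ← nz, ← integral_div]
    have : 2 * (‖v‖ ^ 2) ^ 2 * ‖v‖ ^ 2 = ∫ x, 2 * (‖v‖ ^ 2) ^ 2 * ‖v x‖ ^ 2 := by
      rw [integral_const_mul, nv]
    rw [this, ← integral_add (iv.const_mul _) (iz.div_const 2)]
    refine integral_mono_ae ((integrable_L2T q').norm.const_mul _)
      ((iv.const_mul _).add (iz.div_const 2)) ?_
    filter_upwards [eq2] with x k1
    rw [k1, norm_mul, Real.norm_ofNat]
    have e1 := norm_inner_le_norm (𝕜 := ℝ) (v x) (z x)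
    have e2 : ‖v‖ ^ 2 * (2 * ‖inner ℝ (v x) (z x)‖) ≤ ‖v‖ ^ 2 * (2 * (‖v x‖ * ‖z x‖)) := by gcongr
    nlinarith [sq_nonneg (2 * ‖v‖ ^ 2 * ‖v x‖ - ‖z x‖)]
  rw [hm, hqn] at hzz
  have hA : 0 ≤ ‖v‖ ^ 2 := by positivity
  generalize ‖v‖ ^ 2 = A at *
  nlinarith [mul_nonneg hA hA, mul_nonneg hA (mul_nonneg hA hA)]

/-! ### Variation of the solution -/

/-- The bound on increments with a constant which depends only on `p`. Where the driver is not small,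
the increment is at most `2` and the bound is trivial. -/
theorem exists_increment_bound (hp2 : 2 ≤ p) (hp3 : p < 3) :
    ∃ K : ℝ, 0 < K ∧ ∀ (T : ℝ) (G GG : ℝ → ℝ → SobolevH 2 LR3) (F : ℝ → L2T R3)
      (R : ℝ → ℝ → L2T R3) (u : ℝ → L2T R3) (U : ℝ → H2Field) (D : ℝ → L2T R3), 0 < T →
      IsAntisymmRoughDriver T p 2 G GG → IsSphereSolution T G GG F R u U D →
      ∀ s t, 0 ≤ s → s ≤ t → t ≤ T → ‖increment u s t‖ ≤
        K * (driverSize p G GG s t ^ (1 / p) + ∫ r in Icc s t, ‖F r‖) := by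
  obtain ⟨ε, L, hε, hε1, hL, hfr⟩ := exists_moving_frame hp2 hp3
  have hp0 : 0 < p := by linarith
  have hεp : 0 < ε ^ (1 / p) := by positivity
  set K : ℝ := 6 * L + 18 + 2 / ε ^ (1 / p) with hK
  have hK1 : 0 ≤ 2 / ε ^ (1 / p) := by positivity
  refine ⟨K, by positivity, fun T G GG F R u U D hT hd h s t h1 h2 h3 => ?_⟩
  have hsup := isSuperadditive_driverSize hp2 hd.memV_fst hd.memV_snd
  have hw0 := hsup.nonneg s t h1 h2 h3
  have hI : 0 ≤ ∫ r in Icc s t, ‖F r‖ := integral_nonneg fun r => norm_nonneg _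
  have hW : 0 ≤ driverSize p G GG s t ^ (1 / p) := Real.rpow_nonneg hw0 _
  by_cases hsm : driverSize p G GG s t ≤ ε
  · obtain ⟨φ, hφ⟩ := hfr T G GG hT hd s t h1 h2 h3 hsm
    have e1 := h.norm_increment_le_of_frame hp2 hp3 hT hd h1 h2 h3 hL (hsm.trans hε1) hφ
    change ‖u t - u s‖ ≤ _
    have e2 : (6 * L) * driverSize p G GG s t ^ (1 / p) ≤
        K * driverSize p G GG s t ^ (1 / p) := by gcongr; linarith
    have e3 : 18 * (∫ r in Icc s t, ‖F r‖) ≤ K * ∫ r in Icc s t, ‖F r‖ := by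
      gcongr; linarith
    linarith
  · have e1 : ‖increment u s t‖ ≤ 2 := by
      have := norm_sub_le (u t) (u s)
      rw [h.norm_one t ⟨h1.trans h2, h3⟩, h.norm_one s ⟨h1, h2.trans h3⟩] at this
      change ‖u t - u s‖ ≤ _
      linarith
    have e2 : ε ^ (1 / p) ≤ driverSize p G GG s t ^ (1 / p) :=
      Real.rpow_le_rpow hε.le (not_le.1 hsm).le (by positivity)
    calc ‖increment u s t‖ ≤ 2 := e1
      _ = 2 / ε ^ (1 / p) * ε ^ (1 / p) := by field_simp
      _ ≤ K * (driverSize p G GG s t ^ (1 / p) + ∫ r in Icc s t, ‖F r‖) := by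
          gcongr
          · linarith
          · linarith

/-- A bound by `w ^ (1 / p) + I` is a bound by the `p`-th root of a multiple of `w + I ^ p`, which is
superadditive if `w` is and `I` is additive. -/
theorem le_rpow_of_le_add {p w I K x : ℝ} (hp : 0 < p) (hw : 0 ≤ w) (hI : 0 ≤ I) (hK : 0 ≤ K)
    (hx : x ≤ K * (w ^ (1 / p) + I)) : x ≤ ((2 * K) ^ p * (w + I ^ p)) ^ (1 / p) := by
  have hIp : 0 ≤ I ^ p := by positivity
  have e1 : w ^ (1 / p) ≤ (w + I ^ p) ^ (1 / p) :=
    Real.rpow_le_rpow hw (by linarith) (by positivity)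
  have e2 : I ≤ (w + I ^ p) ^ (1 / p) := by
    calc I = (I ^ p) ^ (1 / p) := by
          rw [← Real.rpow_mul hI, mul_one_div_cancel hp.ne', Real.rpow_one]
      _ ≤ _ := Real.rpow_le_rpow hIp (by linarith) (by positivity)
  rw [Real.mul_rpow (by positivity) (by positivity), ← Real.rpow_mul (by positivity),
    mul_one_div_cancel hp.ne', Real.rpow_one]
  calc x ≤ K * (w ^ (1 / p) + I) := hx
    _ ≤ K * ((w + I ^ p) ^ (1 / p) + (w + I ^ p) ^ (1 / p)) := by gcongr
    _ = _ := by ring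

theorem IsSuperadditive.mixed {a b p K : ℝ} (hp : 1 ≤ p) (hK : 0 ≤ K) {w : ℝ → ℝ → ℝ}
    (hw : IsSuperadditive a b w) {I : ℝ → ℝ → ℝ}
    (hI : ∀ s t, a ≤ s → s ≤ t → t ≤ b → 0 ≤ I s t)
    (hIadd : ∀ s r t, a ≤ s → s ≤ r → r ≤ t → t ≤ b → I s r + I r t = I s t) :
    IsSuperadditive a b fun s t => (2 * K) ^ p * (w s t + I s t ^ p) := by
  constructor
  · intro s t h1 h2 h3
    have := hw.nonneg s t h1 h2 h3
    have := Real.rpow_nonneg (hI s t h1 h2 h3) p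
    positivity
  · intro s r t h1 h2 h3 h4
    have e1 := hw.add_le s r t h1 h2 h3 h4
    have e2 := Real.add_rpow_le_rpow_add (hI s r h1 h2 (h3.trans h4))
      (hI r t (h1.trans h2) h3 h4) hp
    rw [hIadd s r t h1 h2 h3 h4] at e2
    rw [← mul_add]
    exact mul_le_mul_of_nonneg_left (by linarith) (by positivity)

/-- Paths whose increments are bounded by a control and an integral have finite `p`-variation. -/
theorem memV_of_increment_le {E : Type*} [NormedAddCommGroup E] {p T K : ℝ} (hp : 1 ≤ p)
    (hT : 0 ≤ T) (hK : 0 ≤ K) {u : ℝ → E} (hu : ContinuousOn u (Icc 0 T)) {w : ℝ → ℝ → ℝ}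
    (hw : IsControl 0 T w) {f : ℝ → ℝ} (hf0 : ∀ r, 0 ≤ f r)
    (hf : Integrable f (volume.restrict (Icc 0 T)))
    (h : ∀ s t, 0 ≤ s → s ≤ t → t ≤ T →
      ‖increment u s t‖ ≤ K * (w s t ^ (1 / p) + ∫ r in Icc s t, f r)) : MemV p 0 T u := by
  have hp0 : 0 < p := by linarith
  have hadd : ∀ s r t, 0 ≤ s → s ≤ r → r ≤ t → t ≤ T →
      (∫ x in Icc s r, f x) + ∫ x in Icc r t, f x = ∫ x in Icc s t, f x :=
    fun s r t h1 h2 h3 h4 => setIntegral_Icc_add h2 h3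
      (hf.mono_measure (Measure.restrict_mono (Icc_subset_Icc h1 h4) le_rfl))
  have hI0 : ∀ s t, 0 ≤ s → s ≤ t → t ≤ T → 0 ≤ ∫ r in Icc s t, f r :=
    fun s t _ _ _ => integral_nonneg hf0
  have hsup := hw.isSuperadditive.mixed hp hK hI0 hadd
  have m1 : MapsTo Prod.fst (simplex2 0 T) (Icc 0 T) := fun z hz => ⟨hz.1, hz.2.1.trans hz.2.2⟩
  have m2 : MapsTo Prod.snd (simplex2 0 T) (Icc 0 T) := fun z hz => ⟨hz.1.trans hz.2.1, hz.2.2⟩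
  refine ⟨hu, ?_, fun t _ => sub_self _, fun s t => (2 * K) ^ p * (w s t + (∫ r in Icc s t, f r) ^ p),
    ⟨?_, hsup.nonneg, fun t ht => hsup.diag ht.1 ht.2, hsup.add_le⟩, ?_⟩
  · exact (hu.comp continuousOn_snd m2).sub (hu.comp continuousOn_fst m1)
  · have hJ : ContinuousOn (fun t => ∫ r in Icc 0 t, f r) (Icc 0 T) := by
      have hi : IntervalIntegrable f volume 0 T :=
        (intervalIntegrable_iff_integrableOn_Icc_of_le hT).2 hf
      have := intervalIntegral.continuousOn_primitive_interval' hi left_mem_uIcc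
      rw [uIcc_of_le hT] at this
      refine this.congr fun t ht => ?_
      change _ = ∫ x in (0 : ℝ)..t, f x
      rw [intervalIntegral.integral_of_le ht.1, integral_Icc_eq_integral_Ioc]
    have hJ2 : ContinuousOn (fun z : ℝ × ℝ => ∫ r in Icc z.1 z.2, f r) (simplex2 0 T) := by
      refine ((hJ.comp continuousOn_snd m2).sub (hJ.comp continuousOn_fst m1)).congr fun z hz => ?_
      exact eq_sub_of_add_eq' (hadd 0 z.1 z.2 le_rfl hz.1 hz.2.1 hz.2.2)
    exact continuousOn_const.mul (hw.continuousOn.add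
      (hJ2.rpow_const fun z _ => Or.inr hp0.le))
  · intro s t h1 h2 h3
    exact le_rpow_of_le_add hp0 (hw.nonneg s t h1 h2 h3) (hI0 s t h1 h2 h3) hK (h s t h1 h2 h3)

/-- The variation seminorm of paths whose increments are bounded by a superadditive function and an
integral. -/
theorem variationNorm_increment_le {E : Type*} [NormedAddCommGroup E] {p T K : ℝ} (hp : 1 ≤ p)
    (hK : 0 ≤ K) {u : ℝ → E} {w : ℝ → ℝ → ℝ}
    (hw : IsSuperadditive 0 T w) {f : ℝ → ℝ} (hf0 : ∀ r, 0 ≤ f r)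
    (hf : Integrable f (volume.restrict (Icc 0 T)))
    (h : ∀ s t, 0 ≤ s → s ≤ t → t ≤ T →
      ‖increment u s t‖ ≤ K * (w s t ^ (1 / p) + ∫ r in Icc s t, f r)) {s t : ℝ} (h1 : 0 ≤ s)
    (h2 : s ≤ t) (h3 : t ≤ T) : variationNorm p s t (increment u) ≤
      ENNReal.ofReal (2 * K * (w s t ^ (1 / p) + ∫ r in Icc s t, f r)) := by
  have hp0 : 0 < p := by linarith
  have hI0 : ∀ s t, 0 ≤ s → s ≤ t → t ≤ T → 0 ≤ ∫ r in Icc s t, f r :=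
    fun s t _ _ _ => integral_nonneg hf0
  have hsup := hw.mixed hp hK hI0 (fun s r t h1 h2 h3 h4 => setIntegral_Icc_add h2 h3
    (hf.mono_measure (Measure.restrict_mono (Icc_subset_Icc h1 h4) le_rfl)))
  have e1 := variationPow_le_of_norm_le (s := s) (t := t) hp0 hsup (G := increment u)
    (fun s t k1 k2 k3 => le_rpow_of_le_add hp0 (hw.nonneg s t k1 k2 k3) (hI0 s t k1 k2 k3) hK
      (h s t k1 k2 k3)) h1 h3
  have hw0 := hw.nonneg s t h1 h2 h3
  have hi0 := hI0 s t h1 h2 h3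
  unfold variationNorm
  refine (ENNReal.rpow_le_rpow e1 (by positivity)).trans ?_
  rw [ENNReal.ofReal_rpow_of_nonneg (hsup.nonneg s t h1 h2 h3) (by positivity)]
  refine ENNReal.ofReal_le_ofReal ?_
  generalize (∫ r in Icc s t, f r) = I at *
  have hp1 : 1 / p ≤ 1 := by rw [div_le_one hp0]; exact hp
  rw [Real.mul_rpow (by positivity) (by positivity), ← Real.rpow_mul (by positivity),
    mul_one_div_cancel hp0.ne', Real.rpow_one]
  gcongr
  refine (Real.rpow_add_le_add_rpow hw0 (by positivity) (by positivity) hp1).trans (le_of_eq ?_)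
  rw [← Real.rpow_mul hi0, mul_one_div_cancel hp0.ne', Real.rpow_one]

/-- The drift and the tension have comparable norms, as `|F|² = 2 |𝒯|²` pointwise. -/
theorem eLpNorm_tension_le {V : H2Field} {F : L2T R3} (hV : ∀ᵐ x, ‖V.fn x‖ = 1)
    (hF : F =ᵐ[volume] llgDrift V.toSob) :
    eLpNorm (tension V.toSob) 2 volume ≤ ‖F‖ₑ ∧
      ‖F‖ₑ ≤ ENNReal.ofReal 2 * eLpNorm (tension V.toSob) 2 volume := by
  rw [Lp.enorm_def]
  constructor
  · refine eLpNorm_mono_ae ?_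
    filter_upwards [llgDrift_identities hV, hF] with x k1 k2
    rw [k2]
    refine abs_le_of_sq_le_sq' ?_ (norm_nonneg _) |>.2
    nlinarith [k1.2.1, sq_nonneg ‖tension V.toSob x‖]
  · refine eLpNorm_le_mul_eLpNorm_of_ae_le_mul ?_ 2
    filter_upwards [llgDrift_identities hV, hF] with x k1 k2
    rw [k2]
    refine abs_le_of_sq_le_sq' ?_ (by positivity) |>.2
    nlinarith [k1.2.1, sq_nonneg ‖tension V.toSob x‖]

end Global

/-! ### The bounds in extended nonnegative reals -/

theorem lintegral_enorm_sq_eq {E : Type*} [NormedAddCommGroup E] {μ : Measure ℝ} {f : ℝ → E}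
    (hf : MemLp f 2 μ) : ∫⁻ r, ‖f r‖ₑ ^ 2 ∂μ = ENNReal.ofReal (∫ r, ‖f r‖ ^ 2 ∂μ) := by
  rw [ofReal_integral_eq_lintegral_ofReal (hf.integrable_norm_pow (by norm_num))
    (Eventually.of_forall fun r => by positivity)]
  refine lintegral_congr fun r => ?_
  rw [ENNReal.ofReal_pow (norm_nonneg _), ofReal_norm]

theorem norm_sq_sobolev_one {E : Type*} [NormedAddCommGroup E] [NormedSpace ℝ E]
    (f : SobolevH 1 E) : ‖f‖ ^ 2 = ‖f.1 0‖ ^ 2 + ‖f.1 1‖ ^ 2 := by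
  change ‖f.1‖ ^ 2 = _
  rw [PiLp.norm_sq_eq_of_L2, Fin.sum_univ_two]

section Bounds

variable {p T : ℝ} {G GG : ℝ → ℝ → SobolevH 2 LR3} {F : ℝ → L2T R3} {R : ℝ → ℝ → L2T R3}
  {u : ℝ → L2T R3} {U : ℝ → H2Field} {D : ℝ → L2T R3}

/-- The energy estimate in terms of a bound `B` for the sum of the energy and the dissipation. -/
theorem IsSphereSolution.iSup_add_lintegral_le (h : IsSphereSolution T G GG F R u U D) (hT : 0 < T)
    {B : ℝ} (hB : ∀ t ∈ Icc 0 T, 1 + ‖D t‖ ^ 2 + ∫ r in Icc 0 t, ‖F r‖ ^ 2 ≤ B) :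
    (⨆ t ∈ Icc 0 T, ‖D t‖ₑ ^ 2) + ∫⁻ t in Icc 0 T, eLpNorm (tension (U t).toSob) 2 volume ^ 2 ≤
      ENNReal.ofReal (2 * B) := by
  have hI : ∀ t, 0 ≤ ∫ r in Icc 0 t, ‖F r‖ ^ 2 := fun t => integral_nonneg fun r => by positivity
  have hB0 : 0 ≤ B := (by have := hI 0; positivity : (0 : ℝ) ≤ _).trans (hB 0 ⟨le_rfl, hT.le⟩)
  rw [two_mul, ENNReal.ofReal_add hB0 hB0]
  refine add_le_add (iSup₂_le fun t ht => ?_) ?_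
  · rw [← ofReal_norm, ← ENNReal.ofReal_pow (norm_nonneg _)]
    refine ENNReal.ofReal_le_ofReal ?_
    linarith [hB t ht, hI t]
  · calc _ ≤ ∫⁻ t in Icc 0 T, ‖F t‖ₑ ^ 2 := by
          refine lintegral_mono_ae ?_
          filter_upwards [h.good] with t ht
          gcongr
          exact (eLpNorm_tension_le ht.2.1 ht.2.2).1
      _ = ENNReal.ofReal (∫ r in Icc 0 T, ‖F r‖ ^ 2) := lintegral_enorm_sq_eq h.path.memLp
      _ ≤ _ := by
          refine ENNReal.ofReal_le_ofReal ?_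
          have := hB T ⟨hT.le, le_rfl⟩
          nlinarith [sq_nonneg ‖D T‖]

/-- The bound for the second derivative in time and space in terms of a bound `B` for the sum of the
energy and the dissipation. -/
theorem IsSphereSolution.lintegral_second_deriv_le (h : IsSphereSolution T G GG F R u U D)
    (hT : 0 < T) {B : ℝ} (hB : ∀ t ∈ Icc 0 T, 1 + ‖D t‖ ^ 2 + ∫ r in Icc 0 t, ‖F r‖ ^ 2 ≤ B) :
    ∫⁻ t in Icc 0 T, ‖(U t).toSob.1 2‖ₑ ^ 2 ≤ ENNReal.ofReal (B + 6 * T * B ^ 3) := by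
  have hI : ∀ t, 0 ≤ ∫ r in Icc 0 t, ‖F r‖ ^ 2 := fun t => integral_nonneg fun r => by positivity
  have hB0 : 0 ≤ B := (by have := hI 0; positivity : (0 : ℝ) ≤ _).trans (hB 0 ⟨le_rfl, hT.le⟩)
  have hFi : Integrable (fun r => ‖F r‖ ^ 2) (volume.restrict (Icc 0 T)) :=
    h.path.memLp.integrable_norm_pow (by norm_num)
  calc _ ≤ ∫⁻ t in Icc 0 T, ENNReal.ofReal (‖F t‖ ^ 2 + 6 * B ^ 3) := by
        refine lintegral_mono_ae ?_
        filter_upwards [h.good, ae_restrict_mem measurableSet_Icc] with t ht htT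
        rw [← ofReal_norm, ← ENNReal.ofReal_pow (norm_nonneg _)]
        refine ENNReal.ofReal_le_ofReal ((norm_sq_second_deriv_le ht.2.1 ht.2.2).trans ?_)
        have e : (U t).toSob.1 1 = D t := by
          have := (U t).hasWeakDeriv_zero
          rw [ht.1] at this
          exact this.unique (h.deriv t htT)
        rw [e]
        gcongr
        linarith [hB t htT, hI t]
    _ = ENNReal.ofReal (∫ t in Icc 0 T, (‖F t‖ ^ 2 + 6 * B ^ 3)) := by
        exact (ofReal_integral_eq_lintegral_ofReal (f := fun t => ‖F t‖ ^ 2 + 6 * B ^ 3)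
          (hFi.add (integrable_const _)) (Eventually.of_forall fun r => by positivity)).symm
    _ ≤ _ := by
        refine ENNReal.ofReal_le_ofReal ?_
        rw [integral_add hFi (integrable_const _)]
        have := hB T ⟨hT.le, le_rfl⟩
        simp only [integral_const, MeasurableSet.univ, measureReal_restrict_apply, univ_inter,
          Real.volume_real_Icc, sub_zero, max_eq_left hT.le, smul_eq_mul]
        nlinarith [sq_nonneg ‖D T‖]

/-- The time integral of the drift is controlled by that of the tension. -/
theorem IsSphereSolution.ofReal_integral_le (h : IsSphereSolution T G GG F R u U D) {s t : ℝ}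
    (h1 : 0 ≤ s) (h3 : t ≤ T) : ENNReal.ofReal (∫ r in Icc s t, ‖F r‖) ≤
      ENNReal.ofReal 2 * ∫⁻ r in Icc s t, eLpNorm (tension (U r).toSob) 2 volume := by
  have hμ : volume.restrict (Icc s t) ≤ volume.restrict (Icc 0 T) :=
    Measure.restrict_mono (Icc_subset_Icc h1 h3) le_rfl
  rw [ofReal_integral_norm_eq_lintegral_enorm
    ((h.path.memLp.mono_measure hμ).integrable (by norm_num)),
    ← lintegral_const_mul' _ _ ENNReal.ofReal_ne_top]
  refine lintegral_mono_ae ?_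
  filter_upwards [ae_mono hμ h.good] with r hr
  exact (eLpNorm_tension_le hr.2.1 hr.2.2).2

end Bounds

theorem mainTheorem6 (p : ℝ) (hp2 : 2 ≤ p) (hp3 : p < 3) :
    ∃ K : ℝ, 0 < K ∧
      ∀ (T : ℝ), 0 < T →
      ∀ (G GG : ℝ → ℝ → SobolevH 2 LR3), IsAntisymmRoughDriver T p 2 G GG →
      ∀ (u0 : SobolevH 1 R3), (∀ᵐ x, ‖(sobolevFn u0) x‖ = 1) →
      ∀ (u : ℝ → L2T R3) (U : ℝ → SobolevH 2 R3), IsRoughLLGSolution T G GG u0 u U →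
        (∀ᵐ t ∂(volume.restrict (Icc 0 T)), ∀ᵐ x, ‖u t x‖ = 1) →
        -- the energy estimate
        (∃ D : ℝ → L2T R3, (∀ t ∈ Icc 0 T, HasWeakDeriv (u t) (D t)) ∧
          (⨆ t ∈ Icc 0 T, ‖D t‖ₑ ^ 2) +
              ∫⁻ t in Icc 0 T, eLpNorm (tension (U t)) 2 volume ^ 2 ≤
            ENNReal.ofReal
              (K * Real.exp (K * (T + (driverControl p G GG 0 T).toReal)) * ‖u0‖ ^ 2)) ∧
        -- the bound in `L²(H²)`
        (∫⁻ t in Icc 0 T, ‖(U t).1 2‖ₑ ^ 2 ≤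
            ENNReal.ofReal
              (K * Real.exp (K * (T + (driverControl p G GG 0 T).toReal)) *
                (T * ‖u0‖ ^ 6 + ‖u0‖ ^ 2))) ∧
        -- the bound in `𝒱^p(L²)`
        MemV p 0 T u ∧
        ∀ s t, 0 ≤ s → s ≤ t → t ≤ T →
          variationNorm p s t (increment u) ≤
            ENNReal.ofReal K * (driverControl p G GG s t ^ (1 / p) +
              ∫⁻ r in Icc s t, eLpNorm (tension (U r)) 2 volume) := by
  obtain ⟨K₁, hK₁, henergy⟩ := exists_energy_bound hp2 hp3
  obtain ⟨K₂, hK₂, hincr⟩ := exists_increment_bound hp2 hp3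
  have hp0 : 0 < p := by linarith
  -- the cube of the energy bound enters the estimate of the second derivative
  set K : ℝ := 7 * K₁ ^ 3 + 4 * K₂ with hK
  have hK₁3 : K₁ ≤ K₁ ^ 3 := le_self_pow₀ hK₁ (by norm_num)
  refine ⟨K, by positivity, fun T hT G GG hd u0 hu0 u U hsol hunit => ?_⟩
  obtain ⟨F, R, D, h, h0⟩ := hsol.exists_isSphereSolution hT hd hunit
  have hsup := isSuperadditive_driverSize hp2 hd.memV_fst hd.memV_snd
  -- the initial energy; `1` is the squared `L²` norm of `u0`
  have hD0 : D 0 = u0.1 1 := by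
    have e := h.deriv 0 ⟨le_rfl, hT.le⟩
    rw [h0] at e
    exact e.unique (u0.2 0)
  have hn0 : 1 + ‖D 0‖ ^ 2 = ‖u0‖ ^ 2 := by
    have e : ‖u0.1 0‖ = 1 := norm_eq_one_of_ae hu0
    rw [norm_sq_sobolev_one, e, hD0, one_pow]
  set X : ℝ := T + (driverControl p G GG 0 T).toReal with hX
  have hX0 : 0 ≤ X := by positivity
  set B : ℝ := K₁ * Real.exp (K₁ * X) * ‖u0‖ ^ 2 with hBdef
  have hB : ∀ t ∈ Icc 0 T, 1 + ‖D t‖ ^ 2 + ∫ r in Icc 0 t, ‖F r‖ ^ 2 ≤ B := by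
    intro t ht
    rw [hBdef, ← hn0]
    exact henergy T G GG F R u U D hT hd h t ht
  have hexp1 : Real.exp (K₁ * X) ≤ Real.exp (K * X) := by
    refine Real.exp_le_exp.2 ?_
    gcongr
    linarith
  have hexp3 : Real.exp (K₁ * X) ^ 3 ≤ Real.exp (K * X) := by
    rw [← Real.exp_nat_mul]
    refine Real.exp_le_exp.2 ?_
    push_cast
    rw [← mul_assoc]
    gcongr
    linarith
  refine ⟨⟨D, h.deriv, (h.iSup_add_lintegral_le hT hB).trans (ENNReal.ofReal_le_ofReal ?_)⟩,
    (h.lintegral_second_deriv_le hT hB).trans (ENNReal.ofReal_le_ofReal ?_), ?_, ?_⟩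
  · rw [hBdef, ← mul_assoc, ← mul_assoc]
    gcongr
    linarith
  · have e1 : B ≤ K₁ * Real.exp (K * X) * ‖u0‖ ^ 2 := by
      rw [hBdef]; gcongr
    have e2 : B ^ 3 ≤ K₁ ^ 3 * Real.exp (K * X) * ‖u0‖ ^ 6 := by
      have : B ^ 3 = K₁ ^ 3 * Real.exp (K₁ * X) ^ 3 * ‖u0‖ ^ 6 := by rw [hBdef]; ring
      rw [this]; gcongr
    have e3 : K₁ * (Real.exp (K * X) * ‖u0‖ ^ 2) ≤ K * (Real.exp (K * X) * ‖u0‖ ^ 2) := by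
      gcongr
      linarith
    have e4 : 6 * K₁ ^ 3 * (Real.exp (K * X) * (T * ‖u0‖ ^ 6)) ≤
        K * (Real.exp (K * X) * (T * ‖u0‖ ^ 6)) := by
      gcongr; linarith
    have e5 : 6 * T * B ^ 3 ≤ 6 * T * (K₁ ^ 3 * Real.exp (K * X) * ‖u0‖ ^ 6) := by gcongr
    calc B + 6 * T * B ^ 3 ≤ K₁ * (Real.exp (K * X) * ‖u0‖ ^ 2) +
          6 * K₁ ^ 3 * (Real.exp (K * X) * (T * ‖u0‖ ^ 6)) := by linarith
      _ ≤ K * (Real.exp (K * X) * ‖u0‖ ^ 2) + K * (Real.exp (K * X) * (T * ‖u0‖ ^ 6)) := by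
          linarith
      _ = _ := by ring
  · obtain ⟨w, hw, hle⟩ := exists_control_ge_driverControl hp2 hd.memV_fst hd.memV_snd
    refine memV_of_increment_le (by linarith) hT.le hK₂.le h.continuousOn hw
      (fun r => norm_nonneg (F r)) (h.path.memLp.integrable (by norm_num)).norm
      fun s t h1 h2 h3 => (hincr T G GG F R u U D hT hd h s t h1 h2 h3).trans ?_
    have e1 : driverSize p G GG s t ≤ w s t :=
      ENNReal.toReal_le_of_le_ofReal (hw.nonneg s t h1 h2 h3) (hle s t h1 h2 h3)
    have e2 : driverSize p G GG s t ^ (1 / p) ≤ w s t ^ (1 / p) :=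
      Real.rpow_le_rpow (hsup.nonneg s t h1 h2 h3) e1 (by positivity)
    gcongr
  · intro s t h1 h2 h3
    have e1 := variationNorm_increment_le (by linarith) hK₂.le hsup (fun r => norm_nonneg (F r))
      (h.path.memLp.integrable (by norm_num)).norm
      (hincr T G GG F R u U D hT hd h) h1 h2 h3
    have hW : ENNReal.ofReal (driverSize p G GG s t ^ (1 / p)) =
        driverControl p G GG s t ^ (1 / p) := by
      rw [← ENNReal.ofReal_rpow_of_nonneg (hsup.nonneg s t h1 h2 h3) (by positivity)]
      congr 1
      exact ENNReal.ofReal_toReal (driverControl_ne_top hp2 hd.memV_fst hd.memV_snd h1 h2 h3)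
    have hI := h.ofReal_integral_le h1 h3
    rw [ENNReal.ofReal_mul (by positivity), ENNReal.ofReal_add
      (Real.rpow_nonneg (hsup.nonneg s t h1 h2 h3) _) (integral_nonneg fun r => norm_nonneg _),
      hW] at e1
    refine e1.trans ?_
    calc _ ≤ ENNReal.ofReal (2 * K₂) * (ENNReal.ofReal 2 * driverControl p G GG s t ^ (1 / p) +
          ENNReal.ofReal 2 * ∫⁻ r in Icc s t, eLpNorm (tension (U r)) 2 volume) := by
          gcongr
          · refine le_mul_of_one_le_left zero_le ?_
            simp
          · exact hI
      _ = ENNReal.ofReal (4 * K₂) * (driverControl p G GG s t ^ (1 / p) +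
          ∫⁻ r in Icc s t, eLpNorm (tension (U r)) 2 volume) := by
          rw [← mul_add, ← mul_assoc, ← ENNReal.ofReal_mul (by positivity)]
          congr 2
          ring
      _ ≤ _ := by
          gcongr
          have : (0 : ℝ) ≤ 7 * K₁ ^ 3 := by positivity
          linarith

end
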